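/- **Theorem 4.2 (superconvergence of the immersed finite volume method).** *Problem.* Let $a<b$, $\beta^\pm>0$, $\gamma,c\in\mathbb R$ and $p\ge 2$. For $\alpha\in[a,b]$ let $\beta=\beta^-$ on $(a,\alpha)$ and $\beta=\beta^+$ on $(\alpha,b)$, and consider $$-(\beta u')'+\gamma u'+cu=f\ \text{ on }(a,\alpha)\cup(\alpha,b),\qquad u(a)=u(b)=0,$$ with $u$ and $\beta u'$ continuous across $\alpha$. Let $A\subseteq[a,b]$ be a closed set of interface positions such that, for every $\alpha\in A$, this problem with $f=0$ has only the solution $u=0$. (If $c\ge 0$ this always holds, and one can take $A=[a,b]$; for a single interface position take $A=\{\alpha\}$.) *Polynomials.* Let $P_n$ be the Legendre polynomials on $[-1,1]$, $\psi_0=\frac{1-\xi}2$, $\psi_1=\frac{1+\xi}2$, $\psi_n=\int_{-1}^{\xi}P_{n-1}$ for $n\ge2$. For $\hat\alpha\in(-1,1)$ let $\hat\beta=\beta^-$ on $(-1,\hat\alpha)$, $\hat\beta=\beta^+$ on $(\hat\alpha,1)$, $w=1/\hat\beta$; let $L_n$ be the polynomial of degree $n$ that is orthogonal to all polynomials of lower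 degree for the weight $w$ on $[-1,1]$ (unique up to normalization); let $\phi_n=\int_{-1}^\xi wL_{n-1}$ for $n\ge 2$, and let $\phi_0,\phi_1$ be the continuous functions on $[-1,1]$ for which $\hat\beta\phi_0'$, $\hat\beta\phi_1'$ are constant, $\phi_0(-1)=\phi_1(1)=1$ and $\phi_0(1)=\phi_1(-1)=0$. *Method.* Let $a=x_0<\dots<x_N=b$ be a partition with $x_{k-1}<\alpha<x_k$, $\tau_i=[x_{i-1},x_i]$, $h=\max_i (x_i-x_{i-1})$. Let $\phi_{i,n}$ and $P_{i,n}$ be the affine transplants to $\tau_i$ of $\psi_n$, $P_n$ if $i\ne k$, and of $\phi_n$, $L_n$ (with $\hat\alpha$ the image of $\alpha$ in $[-1,1]$) if $i=k$. The (generalized) Gauss points $g_{i,1}<\dots<g_{i,p}$ are the roots of $P_{i,p}$ in $\tau_i$, and the (generalized) Lobatto points are the roots of $\phi_{i,p+1}$ in $\tau_i$. The trial space $U_{\mathcal T}$ consists of the continuous functions $v$ on $[a,b]$ with $v(a)=v(b)=0$ and $v|_{\tau_i}\in\mathrm{span}\{\phi_{i,0},\dots,\phi_{i,p}\}$ for all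 $i$. An IFV solution is a $u_{\mathcal T}\in U_{\mathcal T}$ with $$\beta u_{\mathcal T}'(g)-\beta u_{\mathcal T}'(g')+\int_g^{g'}(\gamma u_{\mathcal T}'+cu_{\mathcal T})\,dx=\int_g^{g'}f\,dx$$ for all pairs $g<g'$ of consecutive Gauss points of the whole mesh. Here and below, a flux $\beta v'$ at a point is the limit of $\beta v'$ there (which matters only if a Gauss point coincides with $\alpha$). The Gauss-Lobatto projection $\mathcal I_hu$ is given on $\tau_i$ by $\sum_{n=0}^p u_{i,n}\phi_{i,n}$ with $u_{i,0}=u(x_{i-1})$, $u_{i,1}=u(x_i)$ and $u_{i,n}=\int_{\tau_i}\beta u'\phi_{i,n}'\big/\int_{\tau_i}\beta(\phi_{i,n}')^2$ for $n\ge2$. *Regularity.* $u\in\tilde W^{2p+1,\infty}_\beta$ means: $u$ is continuous on $[a,b]$, $u(a)=u(b)=0$, $u\in W^{2p+1,\infty}(a,\alpha)$ and $u\in W^{2p+1,\infty}(\alpha,b)$, and $\beta u^{(j)}$ has equal one-sided limits at $\alpha$ for $1\le j\le 2p$. Let $\|u\|$ be the larger one of the norms of $u$ in $W^{2p+1,\infty}(a,\alpha)$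 and $W^{2p+1,\infty}(\alpha,b)$. *Claim.* There are $h_0>0$ and $C>0$, depending only on $a,b,\beta^-,\beta^+,\gamma,c,p$ and $A$, such that for every $\alpha\in A\cap(a,b)$, every partition as above with $h\le h_0$, every solution $u\in\tilde W^{2p+1,\infty}_\beta$ of the interface problem for some $f$, and every IFV solution $u_{\mathcal T}$ for the same $f$: 1. $\max_{[a,b]}|u_{\mathcal T}-\mathcal I_hu|\le Ch^{p+2}\|u\|$; 2. $|(u-u_{\mathcal T})(l)|\le Ch^{p+2}\|u\|$ at every Lobatto point $l$ of every element; 3. $|\beta(u-u_{\mathcal T})'(g)|\le Ch^{p+1}\|u\|$ at every Gauss point $g$ of every element; 4. if $\gamma=c=0$, then $|\beta(u-u_{\mathcal T})'(g)|\le Ch^{2p}\|u\|$ at every Gauss point $g$, $|(u-u_{\mathcal T})(x_i)|\le Ch^{2p}\|u\|$ for $0\le i\le N$, and $|(u-u_{\mathcal T})(x_i)-(u-u_{\mathcal T})(x_{i-1})|\le Ch^{2p+1}\|u\|$ for $1\le i\le N$. -/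

import Mathlib

open Set Filter Topology MeasureTheory Polynomial
open scoped ContDiff

noncomputable section

namespace IFVM

/-! ### Sobolev spaces `W^{m,∞}` of an open set of the line -/

/-- `g` is the `j`-th weak derivative of `v` on the open set `I`. -/
def IsWeakDeriv (I : Set ℝ) (j : ℕ) (v g : ℝ → ℝ) : Prop :=
  LocallyIntegrableOn v I ∧ LocallyIntegrableOn g I ∧
    ∀ φ : ℝ → ℝ, ContDiff ℝ ∞ φ → HasCompactSupport φ → tsupport φ ⊆ I →
      ∫ x in I, v x * iteratedDeriv j φ x = (-1) ^ j * ∫ x in I, g x * φ x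

/-- All weak derivatives of `v` on `I` up to order `m` exist and are bounded by `M` almost
everywhere. -/
def WeakDerivsBoundedBy (I : Set ℝ) (m : ℕ) (v : ℝ → ℝ) (M : ℝ) : Prop :=
  ∀ j ≤ m, ∃ g : ℝ → ℝ, IsWeakDeriv I j v g ∧ ∀ᵐ x ∂(volume.restrict I), |g x| ≤ M

/-- `v ∈ W^{m,∞}(I)`. -/
def MemSobolevInfty (I : Set ℝ) (m : ℕ) (v : ℝ → ℝ) : Prop :=
  ∃ M : ℝ, WeakDerivsBoundedBy I m v M

/-- The norm of `W^{m,∞}(I)`: the maximum over `j ≤ m` of the essential supremum over `I` of the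
absolute value of the `j`-th weak derivative, i.e. the least common essential bound. -/
def sobolevInftyNorm (I : Set ℝ) (m : ℕ) (v : ℝ → ℝ) : ℝ :=
  sInf {M : ℝ | 0 ≤ M ∧ WeakDerivsBoundedBy I m v M}

/-! ### The interface problem -/

/-- The piecewise constant diffusion coefficient: `βm` to the left of `α`, `βp` to the right. The
value at `α` itself never matters below. -/
def beta (α βm βp x : ℝ) : ℝ := if x < α then βm else βp

/-- The flux `β v'` at `x`, as the limit of `β(y) v'(y)` as `y → x`, `y ≠ x`. Where `β v'` is
continuous this is `β(x) v'(x)`; at `x = α`, where `β` and `v'` may both jump, it is the common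
value of the two one-sided limits of `β v'`. -/
def flux (α βm βp : ℝ) (v : ℝ → ℝ) (x : ℝ) : ℝ :=
  limUnder (𝓝[≠] x) (fun y => beta α βm βp y * deriv v y)

/-- The space `W̃_β^{m,∞}(a,b)`: continuous functions on `[a,b]` which vanish at `a` and `b`, are
piecewise `W^{m,∞}` on both sides of `α`, and satisfy the jump conditions `[β v^{(j)}(α)] = 0` for
all orders `1 ≤ j ≤ m - 1` for which one-sided limits of `v^{(j)}` at `α` make sense. -/
def MemInterfaceSobolev (a b α βm βp : ℝ) (m : ℕ) (v : ℝ → ℝ) : Prop :=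
  ContinuousOn v (Icc a b) ∧ v a = 0 ∧ v b = 0 ∧
    MemSobolevInfty (Ioo a α) m v ∧ MemSobolevInfty (Ioo α b) m v ∧
    ∀ j, 1 ≤ j → j < m → ∃ l : ℝ,
      Tendsto (fun x => βm * iteratedDeriv j v x) (𝓝[<] α) (𝓝 l) ∧
      Tendsto (fun x => βp * iteratedDeriv j v x) (𝓝[>] α) (𝓝 l)

/-- The norm `‖v‖_{m,∞}` of `W̃_β^{m,∞}(a,b)`: the larger one of the norms on the two sides. -/
def interfaceNorm (a b α : ℝ) (m : ℕ) (v : ℝ → ℝ) : ℝ :=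
  max (sobolevInftyNorm (Ioo a α) m v) (sobolevInftyNorm (Ioo α b) m v)

/-- `-(β u')' + γ u' + c u = f` on `(a,α) ∪ (α,b)`. -/
def SolvesEquation (a b α βm βp γ c : ℝ) (f u : ℝ → ℝ) : Prop :=
  ∀ x ∈ Ioo a b, x ≠ α →
    -(deriv (fun y => beta α βm βp y * deriv u y) x) + γ * deriv u x + c * u x = f x

/-- The interface problem with interface `α` has at most one solution: the homogeneous problem
`-(β w')' + γ w' + c w = 0`, `w(a) = w(b) = 0`, with `w` and its flux `q = β w'` continuous across
the interface, has only the zero solution. For `α = a` and `α = b` this is the problem with the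
constant coefficient `βp`, respectively `βm`. -/
def HasUniqueSolutions (a b α βm βp γ c : ℝ) : Prop :=
  ∀ w q : ℝ → ℝ, ContinuousOn w (Icc a b) → ContinuousOn q (Icc a b) → w a = 0 → w b = 0 →
    (∀ x ∈ Ioo a b, x ≠ α →
      HasDerivAt w (q x / beta α βm βp x) x ∧
      HasDerivAt q (γ * (q x / beta α βm βp x) + c * w x) x) →
    ∀ x ∈ Icc a b, w x = 0

/-! ### (Generalized) Legendre and Lobatto polynomials on `[-1,1]` -/

/-- The weighted inner product `(P, Q)_w` on `[-1,1]`. -/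
def wInner (w : ℝ → ℝ) (P Q : ℝ[X]) : ℝ := ∫ t in (-1 : ℝ)..1, w t * P.eval t * Q.eval t

/-- The `n`-th orthogonal polynomial on `[-1,1]` for the weight `w`, normalized to be monic:
Gram-Schmidt orthogonalization of the monomials. -/
def orthoPoly (w : ℝ → ℝ) (n : ℕ) : ℝ[X] :=
  X ^ n - ∑ m : Fin n,
    C (wInner w (X ^ n) (orthoPoly w m) / wInner w (orthoPoly w m) (orthoPoly w m)) *
      orthoPoly w m
termination_by n
decreasing_by exact m.isLt

/-- The Legendre polynomial `P_n`: orthogonal for the weight `1`, with `∫ P_n² = 2 / (2n + 1)` and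
positive leading coefficient. -/
def legendre (n : ℕ) : ℝ[X] :=
  C (√(2 / (2 * n + 1) /
    wInner (fun _ => 1) (orthoPoly (fun _ => 1) n) (orthoPoly (fun _ => 1) n))) *
    orthoPoly (fun _ => 1) n

/-- The Lobatto polynomials `ψ_n`. -/
def lobatto (n : ℕ) (ξ : ℝ) : ℝ :=
  if n = 0 then (1 - ξ) / 2
  else if n = 1 then (1 + ξ) / 2
  else ∫ t in (-1 : ℝ)..ξ, (legendre (n - 1)).eval t

/-- The weight `w = 1 / β̂` on the reference interval with the interface at `s`. -/
def refWeight (s βm βp ξ : ℝ) : ℝ := 1 / beta s βm βp ξ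

/-- The generalized Legendre polynomials `L_n` for the reference interface `s`. -/
def genLegendre (s βm βp : ℝ) (n : ℕ) : ℝ[X] := orthoPoly (refWeight s βm βp) n

/-- The generalized Lobatto polynomials `φ_n` for the reference interface `s`. -/
def genLobatto (s βm βp : ℝ) (n : ℕ) (ξ : ℝ) : ℝ :=
  if n = 0 then
    (if ξ < s then ((1 - s) * βm + (s - ξ) * βp) / ((1 - s) * βm + (1 + s) * βp)
      else (1 - ξ) * βm / ((1 - s) * βm + (1 + s) * βp))
  else if n = 1 then
    (if ξ < s then (1 + ξ) * βp / ((1 - s) * βm + (1 + s) * βp)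
      else ((ξ - s) * βm + (1 + s) * βp) / ((1 - s) * βm + (1 + s) * βp))
  else ∫ t in (-1 : ℝ)..ξ, refWeight s βm βp t * (genLegendre s βm βp (n - 1)).eval t

/-! ### Meshes, trial space, finite volume scheme -/

/-- A partition `a = x 0 < x 1 < ⋯ < x N = b` none of whose nodes is the interface point `α`.
The elements are `[x i, x (i + 1)]`, `i < N`; the interface element has the index `k`. -/
structure Mesh (a b α : ℝ) where
  /-- number of elements -/
  N : ℕ
  /-- nodes; only `x 0, …, x N` are used -/
  x : ℕ → ℝ
  /-- index of the interface element -/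
  k : ℕ
  x_zero : x 0 = a
  x_last : x N = b
  lt_succ : ∀ i < N, x i < x (i + 1)
  k_lt : k < N
  left_lt : x k < α
  lt_right : α < x (k + 1)

namespace Mesh

variable {a b α : ℝ}

/-- The length of the `i`-th element. -/
def len (T : Mesh a b α) (i : ℕ) : ℝ := T.x (i + 1) - T.x i

/-- The mesh size `h`, the largest element length. -/
def size (T : Mesh a b α) : ℝ := (Finset.range T.N).sup' ⟨T.k, Finset.mem_range.2 T.k_lt⟩ T.len

/-- The `i`-th element, a closed interval. -/
def elem (T : Mesh a b α) (i : ℕ) : Set ℝ := Icc (T.x i) (T.x (i + 1))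

/-- The affine map of the `i`-th element onto `[-1,1]`. -/
def toRef (T : Mesh a b α) (i : ℕ) (y : ℝ) : ℝ := (2 * y - T.x i - T.x (i + 1)) / T.len i

/-- The position `α̂` of the interface in the reference interval. -/
def refInterface (T : Mesh a b α) : ℝ := T.toRef T.k α

/-- The local basis functions `φ_{i,n}`. -/
def basis (T : Mesh a b α) (βm βp : ℝ) (i n : ℕ) (y : ℝ) : ℝ :=
  if i = T.k then genLobatto T.refInterface βm βp n (T.toRef i y) else lobatto n (T.toRef i y)

/-- The local (generalized) Legendre polynomials `P_{i,n}`. -/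
def legendreOn (T : Mesh a b α) (βm βp : ℝ) (i n : ℕ) (y : ℝ) : ℝ :=
  if i = T.k then (genLegendre T.refInterface βm βp n).eval (T.toRef i y)
  else (legendre n).eval (T.toRef i y)

/-- `y` is one of the (generalized) Gauss points `g_{i,j}` of degree `p`: a root of `P_{i,p}` in
some element. -/
def IsGaussPoint (T : Mesh a b α) (βm βp : ℝ) (p : ℕ) (y : ℝ) : Prop :=
  ∃ i < T.N, y ∈ T.elem i ∧ T.legendreOn βm βp i p y = 0

/-- `y` is one of the (generalized) Lobatto points: a root of `φ_{i,p+1}` in some element. -/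
def IsLobattoPoint (T : Mesh a b α) (βm βp : ℝ) (p : ℕ) (y : ℝ) : Prop :=
  ∃ i < T.N, y ∈ T.elem i ∧ T.basis βm βp i (p + 1) y = 0

/-- `[y, z]` is one of the control volumes `[g_{i,j}, g_{i,j+1}]` (with `g_{i,p+1} = g_{i+1,1}`) of
the dual partition: `y < z` are consecutive Gauss points. -/
def IsControlVolume (T : Mesh a b α) (βm βp : ℝ) (p : ℕ) (y z : ℝ) : Prop :=
  T.IsGaussPoint βm βp p y ∧ T.IsGaussPoint βm βp p z ∧ y < z ∧
    ∀ t, T.IsGaussPoint βm βp p t → ¬ (y < t ∧ t < z)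

/-- The trial space: continuous functions on `[a,b]` which vanish at `a` and `b` and belong, on
every element, to the span of `φ_{i,0}, …, φ_{i,p}`. -/
def MemTrialSpace (T : Mesh a b α) (βm βp : ℝ) (p : ℕ) (v : ℝ → ℝ) : Prop :=
  ContinuousOn v (Icc a b) ∧ v a = 0 ∧ v b = 0 ∧
    ∀ i < T.N, ∃ s : ℕ → ℝ, ∀ y ∈ T.elem i,
      v y = ∑ n ∈ Finset.range (p + 1), s n * T.basis βm βp i n y

/-- `v` is an immersed finite volume solution of degree `p` for the right-hand side `f`. -/
def IsIFVSolution (T : Mesh a b α) (βm βp γ c : ℝ) (p : ℕ) (f v : ℝ → ℝ) : Prop :=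
  T.MemTrialSpace βm βp p v ∧
    ∀ y z, T.IsControlVolume βm βp p y z →
      flux α βm βp v y - flux α βm βp v z + (∫ x in y..z, (γ * deriv v x + c * v x))
        = ∫ x in y..z, f x

/-- The coefficients `u_{i,n}` of the (generalized) Lobatto expansion on the `i`-th element. -/
def lobattoCoeff (T : Mesh a b α) (βm βp : ℝ) (u : ℝ → ℝ) (i n : ℕ) : ℝ :=
  if n = 0 then u (T.x i)
  else if n = 1 then u (T.x (i + 1))
  else
    (∫ y in (T.x i)..(T.x (i + 1)), beta α βm βp y * deriv u y * deriv (T.basis βm βp i n) y) /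
      ∫ y in (T.x i)..(T.x (i + 1)),
        beta α βm βp y * deriv (T.basis βm βp i n) y * deriv (T.basis βm βp i n) y

/-- The restriction of the Gauss-Lobatto projection `I_h u` to the `i`-th element. -/
def gaussLobattoProj (T : Mesh a b α) (βm βp : ℝ) (p : ℕ) (u : ℝ → ℝ) (i : ℕ) (y : ℝ) : ℝ :=
  ∑ n ∈ Finset.range (p + 1), T.lobattoCoeff βm βp u i n * T.basis βm βp i n y

end Mesh

end IFVM

end

/-! The argument is carried out for the flux q = βu' with the weight w = 1/β. The jump conditions
turn q into a function with 2p bounded derivatives across the interface (`exists_regularFlux`). On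
every element a trial function is a constant plus the primitive of w times a polynomial P of degree
less than p (`MemTrialSpace.exists_flux`). So the interface element differs from the others only in
its weight, and the local constants see w only through its two bounds. This makes them uniform in α
and in the mesh.

The Gauss points are the roots of the w-orthogonal polynomial Q of degree p. Gauss quadrature is
exact below degree 2p and has nonnegative weights, so an interpolant at the Gauss points is
controlled by its nodal values (`GaussElement.interp_le`). The flux of I_h u is the weighted
projection D of q (`exists_isProj_gaussLobattoProj`). The leading part of q - D is a multiple of Q.
Hence q - D is of order h^(p+1) at the Gauss points, and η = u - I_h u is of order h^(p+2) at the
Lobatto points, which are the zeros of ∫wQ. Moreover η vanishes at the nodes, and since p ≥ 2 so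
does ∫η.

Comparing the scheme with the integrated equation shows that, with e = u - u_T, the flux error
equals γe + c∫e + κ at all Gauss points with one unknown constant κ (`IsIFVSolution.exists_const`).
Write e = θ + η, where θ = I_h u - u_T is the primitive of wδ and δ = D - P. At the Gauss points δ
equals F = γθ + c∫θ + κ up to the small terms D - q, γη and c∫η. Thus θ solves the integrated
continuous problem with the residual ∫w(δ - F). Stability of that problem, uniform over the compact
set A, bounds θ and κ by the residual (`exists_stability`).

The residual is estimated element by element (`GaussElement.consistency_le`). Where w is constant,
quadrature exactness gives h^(p+2) times the element length, which can be summed. On the single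
interface element the pointwise bound h^(p+1) times its length is enough. Both bounds contain an
extra term h(max|θ| + |κ|), which is absorbed for small h (`IsIFVSolution.error_le`). If γ = c = 0,
the flux error is κ at every Gauss point, so P is the interpolant of q minus κ. The increments of e
- κ∫w are then pure Gauss quadrature errors, and e(b) = 0 determines the size of κ. -/

noncomputable section
namespace IFVM

/-! ### Integrals against bounded weights. -/

/-- A measurable weight with values between two constants, the lower one positive. -/
structure BoundedWeight (m m' : ℝ) (w : ℝ → ℝ) : Prop where
  meas : Measurable w
  pos : 0 < m
  lower : ∀ x, m ≤ w x
  upper : ∀ x, w x ≤ m'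

namespace BoundedWeight

variable {m m' : ℝ} {w : ℝ → ℝ}

theorem w_pos (hw : BoundedWeight m m' w) (x : ℝ) : 0 < w x := hw.pos.trans_le (hw.lower x)

theorem upper_pos (hw : BoundedWeight m m' w) : 0 < m' := (hw.w_pos 0).trans_le (hw.upper 0)

theorem abs_le (hw : BoundedWeight m m' w) (x : ℝ) : |w x| ≤ m' := by
  rw [abs_of_pos (hw.w_pos x)]; exact hw.upper x

theorem intervalIntegrable_mul (hw : BoundedWeight m m' w) {f : ℝ → ℝ} {l r : ℝ}
    (hf : IntervalIntegrable f volume l r) :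
    IntervalIntegrable (fun x => w x * f x) volume l r := by
  have key : ∀ {μ : Measure ℝ}, Integrable f μ → Integrable (fun x => w x * f x) μ := fun h =>
    h.bdd_mul (c := m') hw.meas.aestronglyMeasurable
      (Eventually.of_forall fun x => by simpa using hw.abs_le x)
  exact ⟨key hf.1, key hf.2⟩

theorem intervalIntegrable (hw : BoundedWeight m m' w) (l r : ℝ) :
    IntervalIntegrable w volume l r := by
  simpa using hw.intervalIntegrable_mul (f := fun _ => 1) (l := l) (r := r)
    intervalIntegrable_const

theorem abs_integral_mul_le (hw : BoundedWeight m m' w) {f : ℝ → ℝ} {l r B : ℝ} (hlr : l ≤ r)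
    (hf : ∀ x ∈ Icc l r, |f x| ≤ B) : |∫ x in l..r, w x * f x| ≤ m' * B * (r - l) := by
  have := intervalIntegral.norm_integral_le_of_norm_le_const (a := l) (b := r) (C := m' * B)
    (f := fun x => w x * f x) (fun x hx => by
      rw [uIoc_of_le hlr] at hx
      rw [Real.norm_eq_abs, abs_mul]
      exact mul_le_mul (hw.abs_le x) (hf x ⟨hx.1.le, hx.2⟩) (abs_nonneg _) hw.upper_pos.le)
  rwa [Real.norm_eq_abs, abs_of_nonneg (sub_nonneg.2 hlr)] at this

theorem le_integral (hw : BoundedWeight m m' w) {l r : ℝ} (hlr : l ≤ r) :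
    m * (r - l) ≤ ∫ x in l..r, w x := by
  have := intervalIntegral.integral_mono_on hlr (intervalIntegrable_const (c := m))
    (hw.intervalIntegrable l r) (fun x _ => hw.lower x)
  simpa [mul_comm] using this

theorem integral_le (hw : BoundedWeight m m' w) {l r : ℝ} (hlr : l ≤ r) :
    ∫ x in l..r, w x ≤ m' * (r - l) := by
  have := intervalIntegral.integral_mono_on hlr (hw.intervalIntegrable l r)
    (intervalIntegrable_const (c := m')) (fun x _ => hw.upper x)
  simpa [mul_comm] using this

theorem integral_mul_nonneg (hw : BoundedWeight m m' w) {f : ℝ → ℝ} {l r : ℝ} (hlr : l ≤ r)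
    (hf : ∀ x ∈ Icc l r, 0 ≤ f x) : 0 ≤ ∫ x in l..r, w x * f x :=
  intervalIntegral.integral_nonneg hlr fun x hx => mul_nonneg (hw.w_pos x).le (hf x hx)

theorem le_integral_mul (hw : BoundedWeight m m' w) {f : ℝ → ℝ} {l r : ℝ} (hlr : l ≤ r)
    (hi : IntervalIntegrable f volume l r) (hf : ∀ x ∈ Icc l r, 0 ≤ f x) :
    m * ∫ x in l..r, f x ≤ ∫ x in l..r, w x * f x := by
  rw [← intervalIntegral.integral_const_mul]
  exact intervalIntegral.integral_mono_on hlr (hi.const_mul m) (hw.intervalIntegrable_mul hi)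
    fun x hx => mul_le_mul_of_nonneg_right (hw.lower x) (hf x hx)

theorem intervalIntegrable_eval (hw : BoundedWeight m m' w) (P : ℝ[X]) (l r : ℝ) :
    IntervalIntegrable (fun x => w x * P.eval x) volume l r :=
  hw.intervalIntegrable_mul (P.continuous.intervalIntegrable l r)

theorem integral_eval_pos (hw : BoundedWeight m m' w) {l r : ℝ} (hlr : l < r) {P : ℝ[X]}
    (hP : P ≠ 0) (hnn : ∀ x ∈ Icc l r, 0 ≤ P.eval x) : 0 < ∫ x in l..r, w x * P.eval x := by
  have h1 : 0 < ∫ x in l..r, P.eval x := by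
    refine intervalIntegral.integral_pos hlr P.continuous.continuousOn
      (fun x hx => hnn x ⟨hx.1.le, hx.2⟩) ?_
    by_contra! hcon
    refine hP (Polynomial.eq_zero_of_infinite_isRoot P ((Icc_infinite hlr).mono fun x hx => ?_))
    exact le_antisymm (hcon x hx) (hnn x hx)
  exact (mul_pos hw.pos h1).trans_le
    (hw.le_integral_mul hlr.le (P.continuous.intervalIntegrable l r) hnn)

end BoundedWeight

/-! ### Roots of weighted orthogonal polynomials. -/

/-- `f` is orthogonal to all polynomials of degree less than `n` on `[l, r]`, for the weight
`w`. -/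
def OrthBelow (w : ℝ → ℝ) (l r : ℝ) (n : ℕ) (f : ℝ → ℝ) : Prop :=
  ∀ R : ℝ[X], R.degree < n → ∫ x in l..r, w x * (f x * R.eval x) = 0

section Roots

variable {m m' : ℝ} {w : ℝ → ℝ} {l r : ℝ} {p : ℕ} {Q : ℝ[X]}

/-- If Q = DR, then R has degree less than p, so Q is orthogonal to R; but the integral of wDR² is
positive. The facts about roots below follow by choosing D. -/
theorem OrthBelow.not_dvd_of_nonneg (hQ : OrthBelow w l r p fun x => Q.eval x)
    (hw : BoundedWeight m m' w) (hlr : l < r)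
    (hdeg : Q.degree = p) {D : ℝ[X]} (hD : 0 < D.degree)
    (hnn : ∀ x ∈ Icc l r, 0 ≤ D.eval x) : ¬ D ∣ Q := by
  rintro ⟨R, rfl⟩
  have hne : D * R ≠ 0 := by
    intro h; rw [h, degree_zero] at hdeg; exact absurd hdeg (by simp)
  have hR0 : R ≠ 0 := right_ne_zero_of_mul hne
  have hD0 : D ≠ 0 := left_ne_zero_of_mul hne
  have hR : R.degree < p := by
    rw [← hdeg, degree_mul, degree_eq_natDegree hR0, degree_eq_natDegree hD0, ← Nat.cast_add,
      Nat.cast_lt]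
    have := natDegree_pos_iff_degree_pos.2 hD
    omega
  have h := hQ R hR
  have h2 := hw.integral_eval_pos hlr (P := D * R * R) (mul_ne_zero hne hR0) (fun x hx => by
    rw [eval_mul, eval_mul, mul_assoc]
    exact mul_nonneg (hnn x hx) (mul_self_nonneg _))
  simp only [eval_mul] at h h2
  linarith

theorem OrthBelow.not_dvd_of_nonpos (hQ : OrthBelow w l r p fun x => Q.eval x)
    (hw : BoundedWeight m m' w) (hlr : l < r)
    (hdeg : Q.degree = p) {D : ℝ[X]} (hD : 0 < D.degree)
    (hnn : ∀ x ∈ Icc l r, D.eval x ≤ 0) : ¬ D ∣ Q := fun h =>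
  hQ.not_dvd_of_nonneg hw hlr hdeg (D := -D) (by rwa [degree_neg])
    (fun x hx => by simpa using hnn x hx) ((neg_dvd).2 h)

/-- A root outside the open interval would give a linear factor of constant sign on [l, r]. -/
theorem OrthBelow.mem_Ioo_of_isRoot (hQ : OrthBelow w l r p fun x => Q.eval x)
    (hw : BoundedWeight m m' w) (hlr : l < r)
    (hdeg : Q.degree = p) {x : ℝ} (hx : Q.eval x = 0) : x ∈ Ioo l r := by
  have hd : X - C x ∣ Q := dvd_iff_isRoot.2 hx
  have h0 : (0 : WithBot ℕ) < (X - C x).degree := by rw [degree_X_sub_C]; exact zero_lt_one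
  by_contra hcon
  rw [mem_Ioo, not_and_or, not_lt, not_lt] at hcon
  rcases hcon with h | h
  · exact hQ.not_dvd_of_nonneg hw hlr hdeg h0 (fun y hy => by simpa using h.trans hy.1) hd
  · exact hQ.not_dvd_of_nonpos hw hlr hdeg h0 (fun y hy => by simpa using hy.2.trans h) hd

/-- An irreducible factor of degree other than one has no real root, so by the intermediate value
theorem it has constant sign on [l, r]. -/
theorem OrthBelow.splits (hQ : OrthBelow w l r p fun x => Q.eval x)
    (hw : BoundedWeight m m' w) (hlr : l < r) (hdeg : Q.degree = p) : Q.Splits := by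
  have hQ0 : Q ≠ 0 := by
    rintro rfl; rw [degree_zero] at hdeg; exact absurd hdeg (by simp)
  suffices H : ∀ g : ℝ[X], Irreducible g → g ∣ Q → g.degree = 1 by
    obtain ⟨u, hu⟩ := UniqueFactorizationMonoid.factors_prod hQ0
    rw [← hu]
    exact (Splits.multisetProd fun g hg => Splits.of_degree_eq_one
      (H g (UniqueFactorizationMonoid.irreducible_of_factor g hg)
        (UniqueFactorizationMonoid.dvd_of_mem_factors hg))).mul u.isUnit.splits
  intro g hg hgQ
  by_contra hne
  have hroot : ∀ x, g.eval x ≠ 0 := fun x hx => hne (degree_eq_one_of_irreducible_of_root hg hx)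
  have hpos := degree_pos_of_irreducible hg
  rcases lt_or_gt_of_ne (hroot l) with h | h
  · refine hQ.not_dvd_of_nonpos hw hlr hdeg hpos (fun x hx => ?_) hgQ
    by_contra! hcon
    obtain ⟨y, -, hy⟩ := intermediate_value_Icc hx.1 g.continuous.continuousOn
      (show (0 : ℝ) ∈ Icc (g.eval l) (g.eval x) from ⟨h.le, hcon.le⟩)
    exact hroot y hy
  · refine hQ.not_dvd_of_nonneg hw hlr hdeg hpos (fun x hx => ?_) hgQ
    by_contra! hcon
    obtain ⟨y, -, hy⟩ := intermediate_value_Icc' hx.1 g.continuous.continuousOn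
      (show (0 : ℝ) ∈ Icc (g.eval x) (g.eval l) from ⟨hcon.le, h.le⟩)
    exact hroot y hy

theorem OrthBelow.nodup_roots (hQ : OrthBelow w l r p fun x => Q.eval x)
    (hw : BoundedWeight m m' w) (hlr : l < r) (hdeg : Q.degree = p) : Q.roots.Nodup := by
  have hQ0 : Q ≠ 0 := by
    rintro rfl; rw [degree_zero] at hdeg; exact absurd hdeg (by simp)
  rw [Multiset.nodup_iff_count_le_one]
  intro x
  rw [count_roots]
  by_contra! hcon
  have hd : (X - C x) ^ 2 ∣ Q := (le_rootMultiplicity_iff hQ0).1 hcon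
  refine hQ.not_dvd_of_nonneg hw hlr hdeg ?_ (fun y _ => ?_) hd
  · rw [degree_pow, degree_X_sub_C]; norm_num
  · simpa using sq_nonneg _

/-- The finite set of Gauss points belonging to an orthogonal polynomial. -/
def gaussSet (Q : ℝ[X]) : Finset ℝ := Q.roots.toFinset

theorem OrthBelow.card_gaussSet (hQ : OrthBelow w l r p fun x => Q.eval x)
    (hw : BoundedWeight m m' w) (hlr : l < r) (hdeg : Q.degree = p) :
    (gaussSet Q).card = p := by
  rw [gaussSet, Multiset.toFinset_card_of_nodup (hQ.nodup_roots hw hlr hdeg),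
    (splits_iff_card_roots).1 (hQ.splits hw hlr hdeg), natDegree_eq_of_degree_eq_some hdeg]

theorem mem_gaussSet (hdeg : Q.degree = p) {x : ℝ} : x ∈ gaussSet Q ↔ Q.eval x = 0 := by
  have hQ0 : Q ≠ 0 := by
    rintro rfl; rw [degree_zero] at hdeg; exact absurd hdeg (by simp)
  rw [gaussSet, Multiset.mem_toFinset, mem_roots hQ0, IsRoot]

end Roots

/-! ### Interpolation and quadrature at the Gauss points. -/

/-- The interpolant of `f` at the Gauss points belonging to `Q`. -/
def interp (Q : ℝ[X]) (f : ℝ → ℝ) : ℝ[X] := Lagrange.interpolate (gaussSet Q) id f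

theorem interp_add (Q : ℝ[X]) (f g : ℝ → ℝ) :
    interp Q (fun x => f x + g x) = interp Q f + interp Q g :=
  map_add (Lagrange.interpolate (gaussSet Q) id) f g

theorem interp_sub (Q : ℝ[X]) (f g : ℝ → ℝ) :
    interp Q (fun x => f x - g x) = interp Q f - interp Q g :=
  map_sub (Lagrange.interpolate (gaussSet Q) id) f g

theorem interp_const_mul (Q : ℝ[X]) (k : ℝ) (f : ℝ → ℝ) :
    interp Q (fun x => k * f x) = k • interp Q f :=
  map_smul (Lagrange.interpolate (gaussSet Q) id) k f

section Interp

variable {m m' : ℝ} {w : ℝ → ℝ} {l r : ℝ} {p : ℕ} {Q : ℝ[X]}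

theorem eval_interp (hdeg : Q.degree = p) (f : ℝ → ℝ) {g : ℝ} (hg : Q.eval g = 0) :
    (interp Q f).eval g = f g :=
  Lagrange.eval_interpolate_at_node (v := id) f (injOn_id _) ((mem_gaussSet hdeg).2 hg)

theorem OrthBelow.degree_interp_lt (hQ : OrthBelow w l r p fun x => Q.eval x)
    (hw : BoundedWeight m m' w) (hlr : l < r) (hdeg : Q.degree = p) (f : ℝ → ℝ) :
    (interp Q f).degree < p := by
  have := Lagrange.degree_interpolate_lt (s := gaussSet Q) (v := id) f (injOn_id _)
  rwa [hQ.card_gaussSet hw hlr hdeg] at this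

theorem OrthBelow.eq_interp (hQ : OrthBelow w l r p fun x => Q.eval x)
    (hw : BoundedWeight m m' w) (hlr : l < r) (hdeg : Q.degree = p) {f : ℝ → ℝ} {P : ℝ[X]}
    (hP : P.degree < p) (h : ∀ g, Q.eval g = 0 → P.eval g = f g) : P = interp Q f :=
  Lagrange.eq_interpolate_of_eval_eq (v := id) f (injOn_id _)
    (by rwa [hQ.card_gaussSet hw hlr hdeg]) fun g hg => h g ((mem_gaussSet hdeg).1 hg)

/-- Divide P by Q: the quotient has degree less than p, so its product with Q integrates to zero,
and the remainder is the interpolant because Q vanishes at the nodes. -/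
theorem OrthBelow.quadrature (hQ : OrthBelow w l r p fun x => Q.eval x)
    (hw : BoundedWeight m m' w) (hlr : l < r) (hdeg : Q.degree = p) {P : ℝ[X]}
    (hP : P.degree < (2 * p : ℕ)) :
    ∫ x in l..r, w x * P.eval x = ∫ x in l..r, w x * (interp Q fun x => P.eval x).eval x := by
  have hQ0 : Q ≠ 0 := by
    rintro rfl; rw [degree_zero] at hdeg; exact absurd hdeg (by simp)
  have hmod : P % Q = interp Q fun x => P.eval x := by
    refine hQ.eq_interp hw hlr hdeg (hdeg ▸ degree_mod_lt P hQ0) fun g hg => ?_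
    conv_rhs => rw [← EuclideanDomain.div_add_mod P Q, eval_add, eval_mul, hg]
    ring
  have hdiv : (P / Q).degree < p := by
    rcases lt_or_ge P.degree Q.degree with h | h
    · rw [(Polynomial.div_eq_zero_iff hQ0).2 h, degree_zero]; exact WithBot.bot_lt_coe p
    · have h1 := degree_add_div hQ0 h
      have hP0 : P ≠ 0 := by
        rintro rfl; rw [degree_zero, hdeg] at h; exact absurd h (by simp)
      by_cases hd : P / Q = 0
      · rw [hd, degree_zero]; exact WithBot.bot_lt_coe p
      rw [degree_eq_natDegree hP0] at hP h1
      rw [degree_eq_natDegree hd, hdeg] at h1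
      rw [degree_eq_natDegree hd]
      norm_cast at hP h1 ⊢
      omega
  have horth := hQ _ hdiv
  rw [← hmod]
  have e : ∀ x, w x * P.eval x = w x * (Q * (P / Q)).eval x + w x * (P % Q).eval x := fun x => by
    conv_lhs => rw [← EuclideanDomain.div_add_mod P Q, eval_add, mul_add]
  simp_rw [e]
  rw [intervalIntegral.integral_add (hw.intervalIntegrable_eval _ _ _)
    (hw.intervalIntegrable_eval _ _ _)]
  simp only [eval_mul]
  rw [horth, zero_add]

/-- The quadrature weights are the integrals of the Lagrange basis polynomials, and each of these
equals the integral of the square of that polynomial. -/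
theorem OrthBelow.quadrature_nonneg (hQ : OrthBelow w l r p fun x => Q.eval x)
    (hw : BoundedWeight m m' w) (hlr : l < r) (hdeg : Q.degree = p) {P : ℝ[X]}
    (hP : P.degree < (2 * p : ℕ)) (hnn : ∀ g, Q.eval g = 0 → 0 ≤ P.eval g) :
    0 ≤ ∫ x in l..r, w x * P.eval x := by
  have hcard := hQ.card_gaussSet hw hlr hdeg
  have hbasis : ∀ g ∈ gaussSet Q,
      0 ≤ ∫ x in l..r, w x * (Lagrange.basis (gaussSet Q) id g).eval x := by
    intro g hg
    set b := Lagrange.basis (gaussSet Q) id g with hb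
    have hbdeg : b.natDegree = p - 1 := by
      rw [hb, Lagrange.natDegree_basis (injOn_id _) hg, hcard]
    have hp : 0 < p := by rw [← hcard]; exact Finset.card_pos.2 ⟨g, hg⟩
    have hbp : b.degree < p := by
      refine (degree_le_natDegree).trans_lt ?_
      rw [hbdeg]; exact_mod_cast Nat.sub_lt hp one_pos
    -- At the nodes b takes only the values 0 and 1, so b interpolates its own square, whose degree
    -- 2p - 2 is still integrated exactly.
    have h1 : b = interp Q fun x => (b * b).eval x := by
      refine hQ.eq_interp hw hlr hdeg hbp fun y hy => ?_
      have hy' := (mem_gaussSet hdeg).2 hy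
      rw [eval_mul]
      by_cases hgy : g = y
      · subst hgy
        have : b.eval (id g) = 1 := Lagrange.eval_basis_self (injOn_id _) hg
        simp only [id] at this
        rw [this, mul_one]
      · have : b.eval (id y) = 0 := Lagrange.eval_basis_of_ne hgy hy'
        simp only [id] at this
        rw [this, mul_zero]
    have h2 := hQ.quadrature hw hlr hdeg (P := b * b) (by
      refine (degree_le_natDegree).trans_lt ?_
      have : (b * b).natDegree ≤ b.natDegree + b.natDegree := natDegree_mul_le
      rw [hbdeg] at this
      have h3 : (b * b).natDegree < 2 * p := by omega
      exact_mod_cast h3)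
    rw [← h1] at h2
    rw [← h2]
    refine hw.integral_mul_nonneg hlr.le fun x _ => ?_
    rw [eval_mul]; exact mul_self_nonneg _
  rw [hQ.quadrature hw hlr hdeg hP]
  have hsum : ∀ x, w x * (interp Q fun x => P.eval x).eval x =
      ∑ g ∈ gaussSet Q, P.eval g * (w x * (Lagrange.basis (gaussSet Q) id g).eval x) := by
    intro x
    rw [interp, Lagrange.interpolate_apply, eval_finsetSum, Finset.mul_sum]
    refine Finset.sum_congr rfl fun g _ => ?_
    rw [eval_mul, eval_C]; ring
  simp_rw [hsum]
  rw [intervalIntegral.integral_finsetSum fun g _ =>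
    (hw.intervalIntegrable_eval _ _ _).const_mul _]
  refine Finset.sum_nonneg fun g hg => ?_
  rw [intervalIntegral.integral_const_mul]
  exact mul_nonneg (hnn g ((mem_gaussSet hdeg).1 hg)) (hbasis g hg)

/-- With V the interpolant, B² - V² is nonnegative at the nodes and has degree less than 2p, so its
weighted integral is nonnegative. This is the stability of interpolation, with a bound that does not
depend on the weight. -/
theorem OrthBelow.integral_interp_sq_le (hQ : OrthBelow w l r p fun x => Q.eval x)
    (hw : BoundedWeight m m' w) (hlr : l < r) (hdeg : Q.degree = p) {f : ℝ → ℝ} {B : ℝ}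
    (hp : 0 < p) (hf : ∀ g, Q.eval g = 0 → |f g| ≤ B) :
    ∫ x in l..r, w x * (interp Q f).eval x ^ 2 ≤ B ^ 2 * ∫ x in l..r, w x := by
  set V := interp Q f with hV
  have hVp : V.degree < p := hQ.degree_interp_lt hw hlr hdeg f
  have hVn : V.natDegree < p := by
    by_cases h0 : V = 0
    · rw [h0, natDegree_zero]; exact hp
    · exact (natDegree_lt_iff_degree_lt h0).2 hVp
  have h := hQ.quadrature_nonneg hw hlr hdeg (P := C (B ^ 2) - V ^ 2) (by
    refine (degree_le_natDegree).trans_lt ?_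
    have h1 : (C (B ^ 2) - V ^ 2).natDegree ≤ max (C (B ^ 2)).natDegree (V ^ 2).natDegree :=
      natDegree_sub_le _ _
    have h2 : (V ^ 2).natDegree ≤ 2 * V.natDegree := natDegree_pow_le
    rw [natDegree_C] at h1
    have h3 : (C (B ^ 2) - V ^ 2).natDegree < 2 * p := by omega
    exact_mod_cast h3) (fun g hg => by
      rw [eval_sub, eval_C, eval_pow, hV, eval_interp hdeg f hg, sub_nonneg, sq_le_sq]
      exact (hf g hg).trans (le_abs_self B))
  have e : ∀ x, w x * (C (B ^ 2) - V ^ 2).eval x = B ^ 2 * w x - w x * (V ^ 2).eval x := by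
    intro x; rw [eval_sub, eval_C]; ring
  simp_rw [e] at h
  rw [intervalIntegral.integral_sub ((hw.intervalIntegrable l r).const_mul _)
    (hw.intervalIntegrable_eval _ _ _), intervalIntegral.integral_const_mul] at h
  simp only [eval_pow] at h
  linarith

end Interp

/-! ### Orthogonal families and Gram-Schmidt. -/

section Family

variable {m m' : ℝ} {w : ℝ → ℝ} {l r : ℝ}

theorem exists_eq_C_mul_add {L : ℝ[X]} {n : ℕ} (hL : L.degree = n) {P : ℝ[X]}
    (hP : P.degree < (n + 1 : ℕ)) : ∃ (c : ℝ) (R : ℝ[X]), R.degree < n ∧ P = C c * L + R := by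
  have hL0 : L ≠ 0 := by rintro rfl; rw [degree_zero] at hL; exact absurd hL (by simp)
  have hlc : L.leadingCoeff ≠ 0 := leadingCoeff_ne_zero.2 hL0
  have hLn : L.natDegree = n := natDegree_eq_of_degree_eq_some hL
  refine ⟨P.coeff n / L.leadingCoeff, P - C (P.coeff n / L.leadingCoeff) * L, ?_, by ring⟩
  rw [degree_lt_iff_coeff_zero]
  intro k hk
  rw [coeff_sub, coeff_C_mul]
  rcases hk.eq_or_lt with rfl | hk
  · rw [show L.coeff n = L.leadingCoeff by rw [leadingCoeff, hLn], div_mul_cancel₀ _ hlc, sub_self]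
  · rw [degree_lt_iff_coeff_zero] at hP
    rw [hP k hk, coeff_eq_zero_of_natDegree_lt (p := L) (by rw [hLn]; exact hk)]; ring

/-- A family with one member of each exact degree spans; the top coefficient is split off
inductively. -/
theorem orthBelow_of_family (hw : BoundedWeight m m' w) {L : ℕ → ℝ[X]}
    (hL : ∀ n, (L n).degree = n) {f : ℝ → ℝ} (hf : IntervalIntegrable f volume l r) {n : ℕ}
    (h : ∀ k < n, ∫ x in l..r, w x * (f x * (L k).eval x) = 0) : OrthBelow w l r n f := by
  induction n with
  | zero =>
    intro R hR
    have : R = 0 := by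
      by_contra h
      exact absurd hR (by rw [degree_eq_natDegree h]; simp)
    simp [this]
  | succ n ih =>
    intro R hR
    obtain ⟨c, R', hR', rfl⟩ := exists_eq_C_mul_add (hL n) hR
    have i : ∀ P : ℝ[X], IntervalIntegrable (fun x => w x * (f x * P.eval x)) volume l r :=
      fun P => hw.intervalIntegrable_mul (hf.mul_continuousOn P.continuous.continuousOn)
    have e : ∀ x, w x * (f x * (C c * L n + R').eval x) =
        c * (w x * (f x * (L n).eval x)) + w x * (f x * R'.eval x) := fun x => by
      rw [eval_add, eval_mul, eval_C]; ring
    simp_rw [e]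
    rw [intervalIntegral.integral_add ((i _).const_mul c) (i _),
      intervalIntegral.integral_const_mul, h n n.lt_succ_self,
      ih (fun k hk => h k (hk.trans n.lt_succ_self)) R' hR']
    ring

end Family

section OrthoPoly

variable {m m' : ℝ} {w : ℝ → ℝ}

theorem wInner_comm (w : ℝ → ℝ) (P Q : ℝ[X]) : wInner w P Q = wInner w Q P := by
  unfold wInner; congr 1; ext x; ring

theorem wInner_add_left (hw : BoundedWeight m m' w) (P P' Q : ℝ[X]) :
    wInner w (P + P') Q = wInner w P Q + wInner w P' Q := by
  unfold wInner
  have i : ∀ P : ℝ[X], IntervalIntegrable (fun x => w x * P.eval x * Q.eval x) volume (-1) 1 :=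
    fun P => (hw.intervalIntegrable_eval P _ _).mul_continuousOn Q.continuous.continuousOn
  rw [← intervalIntegral.integral_add (i _) (i _)]
  congr 1; ext x; rw [eval_add]; ring

theorem wInner_C_mul_left (w : ℝ → ℝ) (c : ℝ) (P Q : ℝ[X]) :
    wInner w (C c * P) Q = c * wInner w P Q := by
  unfold wInner
  rw [← intervalIntegral.integral_const_mul]
  congr 1; ext x; rw [eval_mul, eval_C]; ring

theorem wInner_sum_left (hw : BoundedWeight m m' w) {ι : Type*} (s : Finset ι) (P : ι → ℝ[X])
    (Q : ℝ[X]) : wInner w (∑ i ∈ s, P i) Q = ∑ i ∈ s, wInner w (P i) Q := by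
  classical
  induction s using Finset.induction_on with
  | empty => simp [wInner]
  | insert a s ha ih => rw [Finset.sum_insert ha, Finset.sum_insert ha, wInner_add_left hw, ih]

theorem wInner_sub_left (hw : BoundedWeight m m' w) (P P' Q : ℝ[X]) :
    wInner w (P - P') Q = wInner w P Q - wInner w P' Q := by
  have := wInner_add_left hw (P - P') P' Q
  rw [sub_add_cancel] at this; linarith

theorem wInner_self_pos (hw : BoundedWeight m m' w) {P : ℝ[X]} (hP : P ≠ 0) :
    0 < wInner w P P := by
  have := hw.integral_eval_pos (l := -1) (r := 1) (by norm_num) (mul_ne_zero hP hP)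
    (fun x _ => by rw [eval_mul]; exact mul_self_nonneg _)
  unfold wInner
  simpa only [eval_mul, mul_assoc] using this

theorem degree_orthoPoly (w : ℝ → ℝ) (n : ℕ) : (orthoPoly w n).degree = n := by
  induction n using Nat.strong_induction_on with
  | _ n ih =>
    rw [orthoPoly, degree_sub_eq_left_of_degree_lt, degree_X_pow]
    rw [degree_X_pow]
    refine mem_degreeLT.1 (Submodule.sum_mem _ fun m _ => mem_degreeLT.2 ?_)
    refine (degree_mul_le _ _).trans_lt ?_
    rw [ih m m.2]
    calc _ ≤ (0 : WithBot ℕ) + (m : ℕ) := add_le_add_left degree_C_le _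
      _ < n := by rw [zero_add]; exact_mod_cast m.2

theorem orthoPoly_ne_zero (w : ℝ → ℝ) (n : ℕ) : orthoPoly w n ≠ 0 := by
  intro h; have := degree_orthoPoly w n; rw [h, degree_zero] at this; exact absurd this (by simp)

theorem wInner_orthoPoly_of_lt (hw : BoundedWeight m m' w) (n : ℕ) :
    ∀ k < n, wInner w (orthoPoly w n) (orthoPoly w k) = 0 := by
  induction n using Nat.strong_induction_on with
  | _ n ih =>
    intro k hk
    -- By induction the earlier polynomials are mutually orthogonal, so only the k-th summand meets
    -- the k-th polynomial, and its coefficient is chosen to cancel the monomial.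
    rw [orthoPoly, wInner_sub_left hw, wInner_sum_left hw,
      Finset.sum_eq_single (⟨k, hk⟩ : Fin n)]
    · rw [wInner_C_mul_left, div_mul_cancel₀ _ (wInner_self_pos hw (orthoPoly_ne_zero w k)).ne',
        sub_self]
    · intro j _ hj
      rw [wInner_C_mul_left]
      rcases lt_trichotomy (j : ℕ) k with h | h | h
      · rw [wInner_comm w (orthoPoly w j) (orthoPoly w k), ih k hk j h, mul_zero]
      · exact absurd (Fin.ext h) hj
      · rw [ih j j.2 k h, mul_zero]
    · simp

theorem orthBelow_orthoPoly (hw : BoundedWeight m m' w) (n : ℕ) :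
    OrthBelow w (-1) 1 n fun x => (orthoPoly w n).eval x :=
  orthBelow_of_family hw (degree_orthoPoly w) ((orthoPoly w n).continuous.intervalIntegrable _ _)
    fun k hk => by
      have := wInner_orthoPoly_of_lt hw n k hk
      unfold wInner at this
      simpa only [mul_assoc] using this

/-- Proportional weights have the same orthogonal polynomials. -/
theorem orthoPoly_congr {w w' : ℝ → ℝ} {k : ℝ} (hk : k ≠ 0)
    (h : ∀ x ∈ Ioo (-1 : ℝ) 1, w' x = k * w x) (n : ℕ) : orthoPoly w' n = orthoPoly w n := by
  have hin : ∀ P Q, wInner w' P Q = k * wInner w P Q := fun P Q => by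
    unfold wInner
    rw [← intervalIntegral.integral_const_mul,
      intervalIntegral.integral_of_le (by norm_num), intervalIntegral.integral_of_le (by norm_num),
      integral_Ioc_eq_integral_Ioo, integral_Ioc_eq_integral_Ioo]
    refine setIntegral_congr_fun measurableSet_Ioo fun x hx => ?_
    simp only [h x hx]; ring
  induction n using Nat.strong_induction_on with
  | _ n ih =>
    rw [orthoPoly, orthoPoly]
    congr 1
    refine Finset.sum_congr rfl fun m _ => ?_
    rw [ih m m.2, hin, hin, mul_div_mul_left _ _ hk]

end OrthoPoly

/-! ### Maximum of a polynomial in terms of its root mean square. -/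

section SupNorm

/-- Equivalence of norms in finite dimension, proved by splitting off the component along the top
orthogonal polynomial and applying induction to the rest. -/
theorem exists_sq_eval_le_ref (n : ℕ) : ∃ K : ℝ, 0 < K ∧ ∀ P : ℝ[X], P.degree < n →
    ∀ x ∈ Icc (-1 : ℝ) 1, P.eval x ^ 2 ≤ K * ∫ t in (-1 : ℝ)..1, P.eval t ^ 2 := by
  have hw : BoundedWeight 1 1 (fun _ => (1 : ℝ)) :=
    ⟨measurable_const, one_pos, fun _ => le_rfl, fun _ => le_rfl⟩
  induction n with
  | zero =>
    refine ⟨1, one_pos, fun P hP x _ => ?_⟩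
    have : P = 0 := by
      by_contra h
      exact absurd hP (by rw [degree_eq_natDegree h]; simp)
    simp [this]
  | succ n ih =>
    obtain ⟨K, hK, ih⟩ := ih
    set L := orthoPoly (fun _ => 1) n with hL
    have hN : 0 < ∫ t in (-1 : ℝ)..1, L.eval t ^ 2 := by
      have := wInner_self_pos hw (orthoPoly_ne_zero (fun _ => 1) n)
      unfold wInner at this
      simpa only [one_mul, ← pow_two] using this
    set N := ∫ t in (-1 : ℝ)..1, L.eval t ^ 2
    obtain ⟨S, hS⟩ := isCompact_Icc.exists_bound_of_continuousOn
      (s := Icc (-1 : ℝ) 1) (f := fun x => L.eval x) L.continuous.continuousOn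
    -- The factor 2 comes from (s + t)² ≤ 2s² + 2t². The quotient S²/N serves the new component, and
    -- K serves the remainder.
    refine ⟨2 * (S ^ 2 / N + K), by positivity, fun P hP x hx => ?_⟩
    obtain ⟨a, R, hR, rfl⟩ := exists_eq_C_mul_add (degree_orthoPoly (fun _ => 1) n) hP
    rw [← hL]
    have horth := orthBelow_orthoPoly hw n R hR
    simp only [one_mul, ← hL] at horth
    have e : ∫ t in (-1 : ℝ)..1, (C a * L + R).eval t ^ 2 =
        a ^ 2 * N + ∫ t in (-1 : ℝ)..1, R.eval t ^ 2 := by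
      have e1 : ∀ t, (C a * L + R).eval t ^ 2 =
          a ^ 2 * L.eval t ^ 2 + 2 * a * (L.eval t * R.eval t) + R.eval t ^ 2 := fun t => by
        rw [eval_add, eval_mul, eval_C]; ring
      have c : ∀ F : ℝ[X], IntervalIntegrable (fun t => F.eval t) volume (-1) 1 :=
        fun F => F.continuous.intervalIntegrable _ _
      have c1 := (c (L ^ 2)).const_mul (a ^ 2)
      have c2 := (c (L * R)).const_mul (2 * a)
      have c3 := c (R ^ 2)
      simp only [eval_mul, eval_pow] at c1 c2 c3
      simp_rw [e1]
      rw [intervalIntegral.integral_add (c1.add c2) c3, intervalIntegral.integral_add c1 c2,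
        intervalIntegral.integral_const_mul, intervalIntegral.integral_const_mul, horth]
      ring
    rw [e]
    have h1 := ih R hR x hx
    have h2 : L.eval x ^ 2 ≤ S ^ 2 := by
      rw [sq_le_sq]; exact (hS x hx).trans (le_abs_self S)
    have h3 : 0 ≤ ∫ t in (-1 : ℝ)..1, R.eval t ^ 2 :=
      intervalIntegral.integral_nonneg (by norm_num) fun _ _ => sq_nonneg _
    set J := ∫ t in (-1 : ℝ)..1, R.eval t ^ 2
    calc (C a * L + R).eval x ^ 2 = (a * L.eval x + R.eval x) ^ 2 := by
          rw [eval_add, eval_mul, eval_C]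
      _ ≤ 2 * (a ^ 2 * L.eval x ^ 2 + R.eval x ^ 2) := by
          nlinarith [sq_nonneg (a * L.eval x - R.eval x)]
      _ ≤ 2 * (a ^ 2 * S ^ 2 + K * J) := by gcongr
      _ ≤ 2 * (S ^ 2 / N + K) * (a ^ 2 * N + J) := by
          have : 2 * (S ^ 2 / N + K) * (a ^ 2 * N + J) =
            2 * (a ^ 2 * S ^ 2 + K * J) + 2 * (S ^ 2 / N * J + K * a ^ 2 * N) := by
            field_simp; ring
          rw [this]
          have : 0 ≤ S ^ 2 / N * J + K * a ^ 2 * N := by positivity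
          linarith

/-- Transplanted from [-1, 1] by an affine map; the factor r - l is the Jacobian, so the constant is
the same for all elements. -/
theorem exists_sq_eval_le (n : ℕ) : ∃ K : ℝ, 0 < K ∧ ∀ (l r : ℝ), l < r → ∀ P : ℝ[X],
    P.degree < n → ∀ x ∈ Icc l r, (r - l) * P.eval x ^ 2 ≤ K * ∫ t in l..r, P.eval t ^ 2 := by
  obtain ⟨K, hK, h⟩ := exists_sq_eval_le_ref n
  refine ⟨2 * K, by positivity, fun l r hlr P hP x hx => ?_⟩
  have hH : 0 < (r - l) / 2 := by linarith
  set A : ℝ[X] := C ((r - l) / 2) * X + C ((l + r) / 2) with hA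
  have hAe : ∀ t, A.eval t = (r - l) / 2 * t + (l + r) / 2 := fun t => by simp [hA]
  have hd : (P.comp A).degree < n := by
    by_cases hP0 : P = 0
    · simp [hP0]
    have hAd : A.natDegree = 1 := by rw [hA]; exact natDegree_linear hH.ne'
    refine degree_le_natDegree.trans_lt ?_
    rw [natDegree_comp, hAd, mul_one]
    rwa [← degree_eq_natDegree hP0]
  have hx' : (2 * x - l - r) / (r - l) ∈ Icc (-1 : ℝ) 1 := by
    constructor
    · rw [le_div_iff₀ (by linarith)]; linarith [hx.1]
    · rw [div_le_iff₀ (by linarith)]; linarith [hx.2]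
  have h1 := h _ hd _ hx'
  simp only [eval_comp, hAe] at h1
  rw [intervalIntegral.integral_comp_mul_add (fun t => P.eval t ^ 2) hH.ne' ((l + r) / 2)] at h1
  have e1 : (r - l) / 2 * ((2 * x - l - r) / (r - l)) + (l + r) / 2 = x := by
    have : r - l ≠ 0 := by linarith
    field_simp; ring
  have e2 : (r - l) / 2 * -1 + (l + r) / 2 = l := by ring
  have e3 : (r - l) / 2 * 1 + (l + r) / 2 = r := by ring
  rw [e1, e2, e3, smul_eq_mul] at h1
  set J := ∫ t in l..r, P.eval t ^ 2
  calc (r - l) * P.eval x ^ 2 ≤ (r - l) * (K * (((r - l) / 2)⁻¹ * J)) := by gcongr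
    _ = 2 * K * J := by
      have : r - l ≠ 0 := by linarith
      field_simp

/-- A polynomial is bounded by its root mean square with respect to the weight. -/
theorem exists_abs_eval_le (n : ℕ) (m m' : ℝ) : ∃ K : ℝ, 1 ≤ K ∧ ∀ (w : ℝ → ℝ),
    BoundedWeight m m' w → ∀ (l r : ℝ), l < r → ∀ P : ℝ[X], P.degree < n → ∀ B : ℝ, 0 ≤ B →
    ∫ t in l..r, w t * P.eval t ^ 2 ≤ B ^ 2 * ∫ t in l..r, w t →
    ∀ x ∈ Icc l r, |P.eval x| ≤ K * B := by
  obtain ⟨K, hK, h⟩ := exists_sq_eval_le n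
  -- The square root alone would do for the bound; adding 1 secures that the constant is at least 1,
  -- which later estimates use.
  refine ⟨1 + √(K * m' / m), le_add_of_nonneg_right (Real.sqrt_nonneg _),
    fun w hw l r hlr P hP B hB hint x hx => ?_⟩
  suffices H : |P.eval x| ≤ √(K * m' / m) * B from H.trans (by gcongr; linarith)
  have hm := hw.pos
  have hm' := hw.upper_pos
  have h1 := h l r hlr P hP x hx
  have h2 := hw.le_integral_mul hlr.le
    ((P.continuous.pow 2).intervalIntegrable l r) (fun x _ => sq_nonneg _)
  have h3 := hw.integral_le hlr.le
  have hH : 0 < r - l := by linarith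
  rw [← Real.sqrt_sq hB, ← Real.sqrt_mul (by positivity)]
  refine Real.abs_le_sqrt ?_
  set J := ∫ t in l..r, P.eval t ^ 2
  have h4 : m * J ≤ B ^ 2 * (m' * (r - l)) := h2.trans (hint.trans (by gcongr))
  have h5 : (r - l) * (m * P.eval x ^ 2) ≤ (r - l) * (K * m' * B ^ 2) := by
    calc (r - l) * (m * P.eval x ^ 2) = m * ((r - l) * P.eval x ^ 2) := by ring
      _ ≤ m * (K * J) := by gcongr
      _ = K * (m * J) := by ring
      _ ≤ K * (B ^ 2 * (m' * (r - l))) := by gcongr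
      _ = _ := by ring
  have h6 := le_of_mul_le_mul_left h5 hH
  calc P.eval x ^ 2 = m * P.eval x ^ 2 / m := by field_simp
    _ ≤ K * m' * B ^ 2 / m := by gcongr
    _ = K * m' / m * B ^ 2 := by ring

end SupNorm

/-- Integration by parts for a merely integrable g: its primitive is absolutely continuous and has
derivative g almost everywhere. Integrability is all that is available for w times a flux, or for
weak derivatives. -/
theorem integral_mul_eq_sub_integral_deriv_mul {φ φ' g : ℝ → ℝ} {l r : ℝ}
    (hφ : ∀ x, HasDerivAt φ (φ' x) x) (hφ' : Continuous φ')
    (hg : IntervalIntegrable g volume l r) :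
    ∫ x in l..r, φ x * g x =
      φ r * (∫ t in l..r, g t) - ∫ x in l..r, φ' x * ∫ t in l..x, g t := by
  have hG := hg.absolutelyContinuousOnInterval_intervalIntegral (c := l) left_mem_uIcc
  have hd : deriv φ = φ' := funext fun x => (hφ x).deriv
  have hφc : ContDiff ℝ 1 φ := contDiff_one_iff_deriv.2
    ⟨fun x => (hφ x).differentiableAt, by rw [hd]; exact hφ'⟩
  have hA : AbsolutelyContinuousOnInterval φ l r :=
    hφc.contDiffOn.absolutelyContinuousOnInterval
  have h := hA.integral_mul_deriv_eq_deriv_mul hG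
  rw [hd] at h
  simp only [intervalIntegral.integral_same, mul_zero, sub_zero] at h
  rw [← h]
  refine intervalIntegral.integral_congr_ae ?_
  filter_upwards [hg.ae_hasDerivAt_integral] with x hx hxm
  rw [(hx (uIoc_subset_uIcc hxm) l left_mem_uIcc).deriv]

/-- Integration by parts against the identity function. -/
theorem integral_primitive_eq_zero {g : ℝ → ℝ} {l r : ℝ} (hg : IntervalIntegrable g volume l r)
    (h0 : ∫ t in l..r, g t = 0) (h1 : ∫ t in l..r, t * g t = 0) :
    ∫ x in l..r, ∫ t in l..x, g t = 0 := by
  have := integral_mul_eq_sub_integral_deriv_mul (φ := id) (φ' := fun _ => 1)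
    (fun x => hasDerivAt_id x) continuous_const hg
  simp only [id, one_mul] at this
  rw [h1, h0, mul_zero, zero_sub] at this
  linarith

theorem exists_derivative_eq (Q : ℝ[X]) :
    ∃ S : ℝ[X], derivative S = Q ∧ S.natDegree ≤ Q.natDegree + 1 := by
  refine ⟨∑ i ∈ Finset.range (Q.natDegree + 1), C (Q.coeff i / (i + 1)) * X ^ (i + 1), ?_, ?_⟩
  · conv_rhs => rw [Q.as_sum_range_C_mul_X_pow]
    rw [derivative_sum]
    refine Finset.sum_congr rfl fun i _ => ?_
    rw [derivative_C_mul_X_pow]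
    have : (i : ℝ) + 1 ≠ 0 := by positivity
    push_cast
    rw [div_mul_cancel₀ _ this]
  · refine natDegree_sum_le_of_forall_le _ _ fun i hi => ?_
    refine (natDegree_C_mul_X_pow_le _ _).trans ?_
    exact Finset.mem_range.1 hi

/-! ### Interpolation, projection and quadrature errors on one element. -/

/-- An element `[l, r]` with a bounded weight and an orthogonal polynomial of degree `p`. -/
structure GaussElement (m m' : ℝ) (w : ℝ → ℝ) (l r : ℝ) (p : ℕ) (Q : ℝ[X]) : Prop where
  weight : BoundedWeight m m' w
  lt : l < r
  deg : Q.degree = p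
  orth : OrthBelow w l r p fun x => Q.eval x

/-- `K` bounds polynomials of degree less than `n` in terms of their weighted root mean square. -/
def IsStabilityConst (n : ℕ) (m m' K : ℝ) : Prop :=
  1 ≤ K ∧ ∀ (w : ℝ → ℝ),
    BoundedWeight m m' w → ∀ (l r : ℝ), l < r → ∀ P : ℝ[X], P.degree < n → ∀ B : ℝ, 0 ≤ B →
    ∫ t in l..r, w t * P.eval t ^ 2 ≤ B ^ 2 * ∫ t in l..r, w t →
    ∀ x ∈ Icc l r, |P.eval x| ≤ K * B

/-- `q` can be approximated on `[l, r]` by polynomials of degree less than `n` as well as a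
function with `n`-th derivative bounded by `M`. -/
def Approx (n : ℕ) (M : ℝ) (q : ℝ → ℝ) (l r : ℝ) : Prop :=
  ∃ T : ℝ[X], T.degree < n ∧ ∀ x ∈ Icc l r, |q x - T.eval x| ≤ M * (r - l) ^ n

/-- `D` is the weighted `L²`-projection of `q` onto the polynomials of degree less than `p`. -/
structure IsProj (w : ℝ → ℝ) (l r : ℝ) (p : ℕ) (q : ℝ → ℝ) (D : ℝ[X]) : Prop where
  deg : D.degree < p
  orth : OrthBelow w l r p fun x => q x - D.eval x

section Local

variable {m m' : ℝ} {w : ℝ → ℝ} {l r : ℝ} {p : ℕ} {Q : ℝ[X]} {K : ℝ}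

/-- A bound for the Lebesgue constant of the Gauss points that does not see where they lie, hence
holds for every position of the interface. -/
theorem GaussElement.interp_le (E : GaussElement m m' w l r p Q) (hK : IsStabilityConst p m m' K)
    (hp : 0 < p) {f : ℝ → ℝ} {B : ℝ} (hB : 0 ≤ B) (hf : ∀ g, Q.eval g = 0 → |f g| ≤ B) :
    ∀ x ∈ Icc l r, |(interp Q f).eval x| ≤ K * B :=
  hK.2 w E.weight l r E.lt _ (E.orth.degree_interp_lt E.weight E.lt E.deg f) B hB
    (E.orth.integral_interp_sq_le E.weight E.lt E.deg hp hf)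

theorem GaussElement.mem_Ioo (E : GaussElement m m' w l r p Q) {g : ℝ} (hg : Q.eval g = 0) :
    g ∈ Ioo l r := E.orth.mem_Ioo_of_isRoot E.weight E.lt E.deg hg

theorem GaussElement.mem_Icc (E : GaussElement m m' w l r p Q) {g : ℝ} (hg : Q.eval g = 0) :
    g ∈ Icc l r := Ioo_subset_Icc_self (E.mem_Ioo hg)

/-- The pointwise inequality D² + 2(q - D)D ≤ q² ≤ B² is integrated; the mixed term vanishes by
orthogonality, which leaves a root mean square bound for D. -/
theorem IsProj.abs_le {q : ℝ → ℝ} {D : ℝ[X]} (hD : IsProj w l r p q D)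
    (hw : BoundedWeight m m' w) (hlr : l < r) (hK : IsStabilityConst p m m' K)
    (hq : ContinuousOn q (Icc l r)) {B : ℝ} (hB : 0 ≤ B) (hqB : ∀ x ∈ Icc l r, |q x| ≤ B) :
    ∀ x ∈ Icc l r, |D.eval x| ≤ K * B := by
  refine hK.2 w hw l r hlr D hD.deg B hB ?_
  have horth := hD.orth D hD.deg
  have hqi : IntervalIntegrable q volume l r := by
    rw [← uIcc_of_le hlr.le] at hq; exact hq.intervalIntegrable
  have hDi := D.continuous.intervalIntegrable (μ := volume) l r
  have i1 : IntervalIntegrable (fun t => w t * D.eval t ^ 2) volume l r :=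
    hw.intervalIntegrable_mul ((D.continuous.pow 2).intervalIntegrable l r)
  have i2 : IntervalIntegrable (fun t => w t * ((q t - D.eval t) * D.eval t)) volume l r :=
    hw.intervalIntegrable_mul ((hqi.sub hDi).mul_continuousOn D.continuous.continuousOn)
  have i3 := (hw.intervalIntegrable l r).const_mul (B ^ 2)
  have h := intervalIntegral.integral_mono_on hlr.le (i1.add (i2.const_mul 2)) i3 (fun t ht => by
    have h1 : D.eval t ^ 2 + 2 * ((q t - D.eval t) * D.eval t) ≤ B ^ 2 := by
      have : q t ^ 2 ≤ B ^ 2 := by rw [sq_le_sq]; exact (hqB t ht).trans (le_abs_self B)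
      nlinarith [sq_nonneg (q t - D.eval t)]
    have := mul_le_mul_of_nonneg_left h1 (hw.w_pos t).le
    linarith)
  rw [intervalIntegral.integral_add i1 (i2.const_mul 2), intervalIntegral.integral_const_mul,
    horth, intervalIntegral.integral_const_mul] at h
  linarith

theorem IsProj.sub_poly {q : ℝ → ℝ} {D : ℝ[X]} (hD : IsProj w l r p q D) {R : ℝ[X]}
    (hR : R.degree < p) : IsProj w l r p (fun x => q x - R.eval x) (D - R) where
  deg := (degree_sub_le _ _).trans_lt (max_lt hD.deg hR)
  orth := by
    have : (fun x => q x - R.eval x - (D - R).eval x) = fun x => q x - D.eval x := by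
      ext x; rw [eval_sub]; ring
    rw [this]; exact hD.orth

/-- The projection reproduces the approximating polynomial T, so stability is applied to q - T. -/
theorem IsProj.error_le {q : ℝ → ℝ} {D : ℝ[X]} (hD : IsProj w l r p q D)
    (hw : BoundedWeight m m' w) (hlr : l < r) (hK : IsStabilityConst p m m' K)
    (hq : ContinuousOn q (Icc l r)) {M : ℝ} (hM : 0 ≤ M) (hA : Approx p M q l r) :
    ∀ x ∈ Icc l r, |q x - D.eval x| ≤ (1 + K) * M * (r - l) ^ p := by
  obtain ⟨T, hT, hTe⟩ := hA
  have hH : 0 ≤ r - l := by linarith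
  intro x hx
  have h := (hD.sub_poly hT).abs_le hw hlr hK (hq.sub T.continuous.continuousOn)
    (B := M * (r - l) ^ p) (by positivity) hTe x hx
  calc |q x - D.eval x| = |(q x - T.eval x) - (D - T).eval x| := by rw [eval_sub]; congr 1; ring
    _ ≤ |q x - T.eval x| + |(D - T).eval x| := abs_sub _ _
    _ ≤ M * (r - l) ^ p + K * (M * (r - l) ^ p) := add_le_add (hTe x hx) h
    _ = _ := by ring

/-- The leading part of the error of the projection is a multiple of the orthogonal
polynomial. -/
theorem GaussElement.exists_proj_error_le (E : GaussElement m m' w l r p Q)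
    (hK : IsStabilityConst p m m' K) {q : ℝ → ℝ} {D : ℝ[X]} (hD : IsProj w l r p q D)
    (hq : ContinuousOn q (Icc l r)) {M : ℝ} (hM : 0 ≤ M) (hA : Approx (p + 1) M q l r) :
    ∃ k : ℝ, ∀ x ∈ Icc l r,
      |q x - D.eval x - k * Q.eval x| ≤ (1 + K) * M * (r - l) ^ (p + 1) := by
  obtain ⟨T, hT, hTe⟩ := hA
  obtain ⟨k, R, hR, rfl⟩ := exists_eq_C_mul_add E.deg hT
  have hw := E.weight
  have hlr := E.lt
  have hH : 0 ≤ r - l := by linarith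
  have hqi : IntervalIntegrable q volume l r := by
    have := hq; rw [← uIcc_of_le hlr.le] at this; exact this.intervalIntegrable
  -- The approximation has degree p, one too many for the projection, but its part kQ projects to
  -- zero.
  have hP : IsProj w l r p (fun x => q x - (C k * Q + R).eval x) (D - R) := by
    refine ⟨(degree_sub_le _ _).trans_lt (max_lt hD.deg hR), fun S hS => ?_⟩
    have e : ∀ x, w x * ((q x - (C k * Q + R).eval x - (D - R).eval x) * S.eval x) =
        w x * ((q x - D.eval x) * S.eval x) - k * (w x * (Q.eval x * S.eval x)) := fun x => by
      simp only [eval_add, eval_sub, eval_mul, eval_C]; ring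
    simp_rw [e]
    have hDi := D.continuous.intervalIntegrable (μ := volume) l r
    have hQS : IntervalIntegrable (fun x => w x * (Q.eval x * S.eval x)) volume l r :=
      hw.intervalIntegrable_mul ((Q.continuous.mul S.continuous).intervalIntegrable l r)
    rw [intervalIntegral.integral_sub
      (hw.intervalIntegrable_mul ((hqi.sub hDi).mul_continuousOn S.continuous.continuousOn))
      (hQS.const_mul k),
      intervalIntegral.integral_const_mul, hD.orth S hS, E.orth S hS]
    ring
  refine ⟨k, fun x hx => ?_⟩
  have h := hP.abs_le hw hlr hK (hq.sub (C k * Q + R).continuous.continuousOn)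
    (B := M * (r - l) ^ (p + 1)) (by positivity) hTe x hx
  calc |q x - D.eval x - k * Q.eval x|
      = |(q x - (C k * Q + R).eval x) - (D - R).eval x| := by
        simp only [eval_sub, eval_add, eval_mul, eval_C]; congr 1; ring
    _ ≤ |q x - (C k * Q + R).eval x| + |(D - R).eval x| := abs_sub _ _
    _ ≤ M * (r - l) ^ (p + 1) + K * (M * (r - l) ^ (p + 1)) := add_le_add (hTe x hx) h
    _ = _ := by ring

/-- One order is gained at the Gauss points, since the leading error is a multiple of Q. -/
theorem GaussElement.proj_error_node_le (E : GaussElement m m' w l r p Q)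
    (hK : IsStabilityConst p m m' K) {q : ℝ → ℝ} {D : ℝ[X]} (hD : IsProj w l r p q D)
    (hq : ContinuousOn q (Icc l r)) {M : ℝ} (hM : 0 ≤ M) (hA : Approx (p + 1) M q l r)
    {g : ℝ} (hg : Q.eval g = 0) : |D.eval g - q g| ≤ (1 + K) * M * (r - l) ^ (p + 1) := by
  obtain ⟨k, hk⟩ := E.exists_proj_error_le hK hD hq hM hA
  have := hk g (E.mem_Icc hg)
  rwa [hg, mul_zero, sub_zero, abs_sub_comm] at this

/-- Quadrature is exact for the approximation T of degree less than 2p; what remains is q - T and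
its interpolant, both of size (r - l)^(2p). -/
theorem GaussElement.quadrature_error_le (E : GaussElement m m' w l r p Q)
    (hK : IsStabilityConst p m m' K) (hp : 0 < p) {q : ℝ → ℝ}
    (hq : ContinuousOn q (Icc l r)) {M : ℝ} (hM : 0 ≤ M) (hA : Approx (2 * p) M q l r) :
    |∫ x in l..r, w x * (q x - (interp Q q).eval x)| ≤
      m' * (1 + K) * M * (r - l) ^ (2 * p + 1) := by
  obtain ⟨T, hT, hTe⟩ := hA
  have hw := E.weight
  have hlr := E.lt
  have hH : 0 ≤ r - l := by linarith
  have hquad := E.orth.quadrature hw hlr E.deg hT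
  have hqi : IntervalIntegrable q volume l r := by
    have := hq; rw [← uIcc_of_le hlr.le] at this; exact this.intervalIntegrable
  have hlin : ∀ x, w x * (q x - (interp Q q).eval x) =
      w x * (q x - T.eval x - (interp Q fun x => q x - T.eval x).eval x) +
        (w x * T.eval x - w x * (interp Q fun x => T.eval x).eval x) := fun x => by
    rw [interp_sub, eval_sub]; ring
  simp_rw [hlin]
  have iq : IntervalIntegrable (fun x => w x *
      (q x - T.eval x - (interp Q fun x => q x - T.eval x).eval x)) volume l r :=
    hw.intervalIntegrable_mul ((hqi.sub (T.continuous.intervalIntegrable _ _)).sub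
      ((interp Q _).continuous.intervalIntegrable _ _))
  rw [intervalIntegral.integral_add iq
    ((hw.intervalIntegrable_eval _ _ _).sub (hw.intervalIntegrable_eval _ _ _)),
    intervalIntegral.integral_sub (hw.intervalIntegrable_eval _ _ _)
    (hw.intervalIntegrable_eval _ _ _), hquad, sub_self, add_zero]
  have hi := E.interp_le hK hp (f := fun x => q x - T.eval x) (B := M * (r - l) ^ (2 * p))
    (by positivity) (fun g hg => hTe g (E.mem_Icc hg))
  have := hw.abs_integral_mul_le hlr.le (B := (1 + K) * (M * (r - l) ^ (2 * p)))
    (f := fun x => q x - T.eval x - (interp Q fun x => q x - T.eval x).eval x) (fun x hx => by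
      refine (abs_sub _ _).trans ?_
      have h1 := hi x hx
      have h2 := hTe x hx
      linarith)
  refine this.trans_eq ?_
  ring

/-- The constant f(l) is its own interpolant and can be subtracted. Only a Lipschitz bound is asked
for, because the function F to which this is applied involves the discrete error, whose derivative
may jump. -/
theorem GaussElement.interp_sub_le (E : GaussElement m m' w l r p Q)
    (hK : IsStabilityConst p m m' K) (hp : 0 < p) {f : ℝ → ℝ} {Λ : ℝ} (hΛ : 0 ≤ Λ)
    (hf : ∀ x ∈ Icc l r, ∀ y ∈ Icc l r, |f x - f y| ≤ Λ * |x - y|) :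
    ∀ x ∈ Icc l r, |(interp Q f).eval x - f x| ≤ (1 + K) * Λ * (r - l) := by
  have hH : 0 ≤ r - l := sub_nonneg.2 E.lt.le
  have hl : l ∈ Icc l r := left_mem_Icc.2 E.lt.le
  have hb : ∀ x ∈ Icc l r, |f x - f l| ≤ Λ * (r - l) := fun x hx =>
    (hf x hx l hl).trans (by
      rw [abs_of_nonneg (sub_nonneg.2 hx.1)]
      exact mul_le_mul_of_nonneg_left (by linarith [hx.2]) hΛ)
  have hc : interp Q (fun _ => f l) = C (f l) := by
    refine (E.orth.eq_interp E.weight E.lt E.deg ?_ fun g _ => by rw [eval_C]).symm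
    exact degree_C_le.trans_lt (by exact_mod_cast hp)
  have hi := E.interp_le hK hp (f := fun x => f x - f l) (B := Λ * (r - l))
    (by positivity) (fun g hg => hb g (E.mem_Icc hg))
  intro x hx
  have h1 := hi x hx
  have h2 := hb x hx
  rw [interp_sub, hc, eval_sub, eval_C] at h1
  calc |(interp Q f).eval x - f x| = |((interp Q f).eval x - f l) - (f x - f l)| := by
        congr 1; ring
    _ ≤ _ := abs_sub _ _
    _ ≤ _ := by linarith

/-- The error `u - I_h u` on an element, as the primitive of the error of the flux. -/
theorem IsProj.primitive_le {q : ℝ → ℝ} {D : ℝ[X]} (hD : IsProj w l r p q D)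
    (hw : BoundedWeight m m' w) (hlr : l < r) (hK : IsStabilityConst p m m' K)
    (hq : ContinuousOn q (Icc l r)) {M : ℝ} (hM : 0 ≤ M) (hA : Approx p M q l r) :
    ∀ y ∈ Icc l r, |∫ x in l..y, w x * (q x - D.eval x)| ≤
      m' * (1 + K) * M * (r - l) ^ (p + 1) := by
  intro y hy
  have hH : 0 ≤ r - l := sub_nonneg.2 hlr.le
  have hK0 := hK.1
  have hm' := hw.upper_pos
  have h := hw.abs_integral_mul_le hy.1 (f := fun x => q x - D.eval x) (fun x hx =>
    hD.error_le hw hlr hK hq hM hA x ⟨hx.1, hx.2.trans hy.2⟩)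
  refine h.trans ?_
  calc m' * ((1 + K) * M * (r - l) ^ p) * (y - l)
      ≤ m' * ((1 + K) * M * (r - l) ^ p) * (r - l) := by gcongr; exact hy.2
    _ = _ := by ring

theorem IsProj.intervalIntegrable {q : ℝ → ℝ} {D : ℝ[X]} (_ : IsProj w l r p q D)
    (hw : BoundedWeight m m' w) (hlr : l < r) (hq : ContinuousOn q (Icc l r)) :
    IntervalIntegrable (fun x => w x * (q x - D.eval x)) volume l r := by
  rw [← uIcc_of_le hlr.le] at hq
  exact hw.intervalIntegrable_mul (hq.intervalIntegrable.sub
    (D.continuous.intervalIntegrable _ _))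

theorem IsProj.integral_eq_zero {q : ℝ → ℝ} {D : ℝ[X]} (hD : IsProj w l r p q D) (hp : 0 < p) :
    ∫ x in l..r, w x * (q x - D.eval x) = 0 := by
  simpa using hD.orth 1 (degree_one_le.trans_lt (by exact_mod_cast hp))

/-- Orthogonality to 1 and to X kills the moments of order zero and one; this is where p ≥ 2 enters.
-/
theorem IsProj.integral_primitive {q : ℝ → ℝ} {D : ℝ[X]} (hD : IsProj w l r p q D)
    (hw : BoundedWeight m m' w) (hlr : l < r) (hp : 2 ≤ p) (hq : ContinuousOn q (Icc l r)) :
    ∫ y in l..r, ∫ x in l..y, w x * (q x - D.eval x) = 0 := by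
  refine integral_primitive_eq_zero (hD.intervalIntegrable hw hlr hq)
    (hD.integral_eq_zero (by omega)) ?_
  have := hD.orth X (degree_X_le.trans_lt (by exact_mod_cast hp))
  rw [← this]
  congr 1; ext x; rw [eval_X]; ring

/-- Superconvergence of the projection at the Lobatto points. -/
theorem GaussElement.primitive_lobatto_le (E : GaussElement m m' w l r p Q)
    (hK : IsStabilityConst p m m' K) {q : ℝ → ℝ} {D : ℝ[X]} (hD : IsProj w l r p q D)
    (hq : ContinuousOn q (Icc l r)) {M : ℝ} (hM : 0 ≤ M) (hA : Approx (p + 1) M q l r) :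
    ∃ k : ℝ, ∀ y ∈ Icc l r,
      |(∫ x in l..y, w x * (q x - D.eval x)) - k * ∫ x in l..y, w x * Q.eval x| ≤
        m' * (1 + K) * M * (r - l) ^ (p + 2) := by
  obtain ⟨k, hk⟩ := E.exists_proj_error_le hK hD hq hM hA
  refine ⟨k, fun y hy => ?_⟩
  have hw := E.weight
  have hlr := E.lt
  have hH : 0 ≤ r - l := sub_nonneg.2 hlr.le
  have hK0 := hK.1
  have hm' := hw.upper_pos
  have hint : IntervalIntegrable (fun x => w x * (q x - D.eval x)) volume l y :=
    (hD.intervalIntegrable hw hlr hq).mono_set (by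
      rw [uIcc_of_le hlr.le, uIcc_of_le hy.1]; exact Icc_subset_Icc_right hy.2)
  rw [← intervalIntegral.integral_const_mul, ← intervalIntegral.integral_sub hint
    ((hw.intervalIntegrable_eval _ _ _).const_mul k)]
  have e : ∀ x, w x * (q x - D.eval x) - k * (w x * Q.eval x) =
      w x * (q x - D.eval x - k * Q.eval x) := fun x => by ring
  simp_rw [e]
  have h := hw.abs_integral_mul_le hy.1 (f := fun x => q x - D.eval x - k * Q.eval x)
    (fun x hx => hk x ⟨hx.1, hx.2.trans hy.2⟩)
  refine h.trans ?_
  calc m' * ((1 + K) * M * (r - l) ^ (p + 1)) * (y - l)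
      ≤ m' * ((1 + K) * M * (r - l) ^ (p + 1)) * (r - l) := by gcongr; exact hy.2
    _ = _ := by ring

/-- Where the weight is constant, Gauss quadrature of `u - I_h u` is of higher order. -/
theorem GaussElement.integral_interp_primitive_le (E : GaussElement m m' w l r p Q)
    (hK : IsStabilityConst p m m' K) (hp : 2 ≤ p) {κ : ℝ} (hκ : ∀ x ∈ Ioo l r, w x = κ)
    {q : ℝ → ℝ} {D : ℝ[X]} (hD : IsProj w l r p q D)
    (hq : ContinuousOn q (Icc l r)) {M : ℝ} (hM : 0 ≤ M) (hA : Approx (p + 1) M q l r) :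
    |∫ y in l..r, w y * (interp Q fun y => ∫ x in l..y, w x * (q x - D.eval x)).eval y| ≤
      m' ^ 2 * K * (1 + K) * M * (r - l) ^ (p + 3) := by
  have hw := E.weight
  have hlr := E.lt
  have hH : 0 ≤ r - l := sub_nonneg.2 hlr.le
  have hK0 := hK.1
  have hm' := hw.upper_pos
  obtain ⟨k, hk⟩ := E.primitive_lobatto_le hK hD hq hM hA
  have hconst : ∀ (f : ℝ → ℝ) (y : ℝ), y ∈ Icc l r →
      ∫ x in l..y, w x * f x = κ * ∫ x in l..y, f x := by
    intro f y hy
    rw [← intervalIntegral.integral_const_mul, intervalIntegral.integral_of_le hy.1,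
      intervalIntegral.integral_of_le hy.1, integral_Ioc_eq_integral_Ioo,
      integral_Ioc_eq_integral_Ioo]
    exact setIntegral_congr_fun measurableSet_Ioo fun x hx => by
      simp only [hκ x ⟨hx.1, hx.2.trans_le hy.2⟩]
  have hκ0 : κ ≠ 0 := by
    rw [← hκ ((l + r) / 2) ⟨by linarith, by linarith⟩]; exact (hw.w_pos _).ne'
  obtain ⟨S, hS, hSdeg⟩ := exists_derivative_eq Q
  have hQint : ∀ y, ∫ x in l..y, Q.eval x = S.eval y - S.eval l := by
    intro y
    exact intervalIntegral.integral_eq_sub_of_hasDerivAt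
      (fun x _ => by rw [← hS]; exact S.hasDerivAt x) (Q.continuous.intervalIntegrable _ _)
  set S' := S - C (S.eval l) with hS'
  have hS'e : ∀ y, S'.eval y = ∫ x in l..y, Q.eval x := fun y => by
    rw [hQint, hS', eval_sub, eval_C]
  -- The primitive of Q has degree at most p + 1, and p + 1 < 2p because p ≥ 2, so quadrature is
  -- exact for it.
  have hS'd : S'.degree < (2 * p : ℕ) := by
    refine degree_le_natDegree.trans_lt ?_
    have h1 : S'.natDegree ≤ max S.natDegree (C (S.eval l)).natDegree := natDegree_sub_le _ _
    rw [natDegree_C] at h1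
    rw [natDegree_eq_of_degree_eq_some E.deg] at hSdeg
    have : S'.natDegree < 2 * p := by omega
    exact_mod_cast this
  -- With a constant weight the moments of Q itself vanish, hence so does the integral of its
  -- primitive. At an interface ∫wQ is not a polynomial and this cancellation is lost.
  have hzero : ∫ y in l..r, w y * (interp Q fun y => S'.eval y).eval y = 0 := by
    rw [← E.orth.quadrature hw hlr E.deg hS'd, hconst _ r (right_mem_Icc.2 hlr.le)]
    simp_rw [hS'e]
    have h0 := E.orth 1 (degree_one_le.trans_lt (by exact_mod_cast (by omega : 0 < p)))
    have h1 := E.orth X (degree_X_le.trans_lt (by exact_mod_cast hp))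
    rw [hconst _ r (right_mem_Icc.2 hlr.le)] at h0 h1
    rw [integral_primitive_eq_zero (Q.continuous.intervalIntegrable _ _), mul_zero]
    · simpa [hκ0] using h0
    · have := (mul_eq_zero.1 h1).resolve_left hκ0
      rw [← this]; congr 1; ext x; rw [eval_X]; ring
  -- What remains after removal of the leading multiple of ∫wQ is one order smaller, and
  -- interpolation is stable.
  set ρ : ℝ → ℝ := fun y => (∫ x in l..y, w x * (q x - D.eval x)) - k * κ * S'.eval y with hρ
  have hsplit : interp Q (fun y => ∫ x in l..y, w x * (q x - D.eval x)) =
      interp Q ρ + (k * κ) • interp Q fun y => S'.eval y := by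
    rw [← interp_const_mul, ← interp_add]
    congr 1; ext y; rw [hρ]; ring
  have hρle := E.interp_le hK (by omega) (f := ρ) (B := m' * (1 + K) * M * (r - l) ^ (p + 2))
    (by positivity) (fun g hg => by
      have := hk g (E.mem_Icc hg)
      rw [hconst (fun x => Q.eval x) g (E.mem_Icc hg)] at this
      rw [hρ]
      simp only [hS'e]
      rwa [mul_assoc])
  have e : ∀ y, w y * (interp Q fun y => ∫ x in l..y, w x * (q x - D.eval x)).eval y =
      w y * (interp Q ρ).eval y + (k * κ) * (w y * (interp Q fun y => S'.eval y).eval y) := by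
    intro y; rw [hsplit, eval_add, eval_smul, smul_eq_mul]; ring
  simp_rw [e]
  rw [intervalIntegral.integral_add (hw.intervalIntegrable_eval _ _ _)
    ((hw.intervalIntegrable_eval _ _ _).const_mul _), intervalIntegral.integral_const_mul, hzero,
    mul_zero, add_zero]
  refine (hw.abs_integral_mul_le hlr.le hρle).trans_eq ?_
  ring

end Local

/-! ### Test functions and weak derivatives. -/

/-- Smooth functions with compact support in `(a, b)`. -/
structure IsTest (a b : ℝ) (φ : ℝ → ℝ) : Prop where
  smooth : ContDiff ℝ ∞ φ
  compact : HasCompactSupport φ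
  subset : tsupport φ ⊆ Ioo a b

theorem setIntegral_Ioo_eq {a b : ℝ} (hab : a ≤ b) (f : ℝ → ℝ) :
    ∫ x in Ioo a b, f x = ∫ x in a..b, f x := by
  rw [intervalIntegral.integral_of_le hab, integral_Ioc_eq_integral_Ioo]

section Test

variable {a b : ℝ} {φ ψ : ℝ → ℝ}

theorem IsTest.eq_zero_of_notMem (hφ : IsTest a b φ) {x : ℝ} (hx : x ∉ Ioo a b) : φ x = 0 :=
  image_eq_zero_of_notMem_tsupport fun h => hx (hφ.subset h)

theorem IsTest.deriv (hφ : IsTest a b φ) : IsTest a b (deriv φ) where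
  smooth := (contDiff_infty_iff_deriv.1 hφ.smooth).2
  compact := hφ.compact.deriv
  subset := (tsupport_deriv_subset (f := φ)).trans hφ.subset

theorem IsTest.hasDerivAt (hφ : IsTest a b φ) (x : ℝ) : HasDerivAt φ (_root_.deriv φ x) x :=
  ((contDiff_infty_iff_deriv.1 hφ.smooth).1 x).hasDerivAt

theorem exists_isTest_integral_eq_one (hab : a < b) :
    ∃ ψ, IsTest a b ψ ∧ ∫ x in a..b, ψ x = 1 := by
  let f : ContDiffBump ((a + b) / 2) := ⟨(b - a) / 8, (b - a) / 4, by linarith, by linarith⟩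
  have hsub : tsupport (f.normed volume) ⊆ Ioo a b := by
    rw [f.tsupport_normed_eq, Real.closedBall_eq_Icc]
    intro x hx
    have h1 : f.rOut = (b - a) / 4 := rfl
    rw [h1] at hx
    constructor <;> linarith [hx.1, hx.2]
  refine ⟨f.normed volume, ⟨f.contDiff_normed, f.hasCompactSupport_normed, hsub⟩, ?_⟩
  rw [intervalIntegral.integral_eq_integral_of_support_subset, f.integral_normed]
  exact (subset_tsupport _).trans (hsub.trans Ioo_subset_Ioc_self)

theorem IsTest.sub_const_mul (hφ : IsTest a b φ) (hψ : IsTest a b ψ) (k : ℝ) :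
    IsTest a b fun x => φ x - k * ψ x := by
  have hs : tsupport (fun x => φ x - k * ψ x) ⊆ tsupport φ ∪ tsupport ψ := by
    refine closure_minimal (fun x hx => ?_) ((isClosed_tsupport _).union (isClosed_tsupport _))
    by_contra hcon
    rw [mem_union, not_or] at hcon
    refine hx ?_
    simp [image_eq_zero_of_notMem_tsupport hcon.1, image_eq_zero_of_notMem_tsupport hcon.2]
  refine ⟨hφ.smooth.sub (contDiff_const.mul hψ.smooth), ?_,
    hs.trans (union_subset hφ.subset hψ.subset)⟩
  exact (hφ.compact.isCompact.union hψ.compact.isCompact).of_isClosed_subset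
    (isClosed_tsupport _) hs

/-- To the right of the support the primitive equals the total integral, which is zero, so its
support is compact again. -/
theorem IsTest.primitive (hab : a < b) (hφ : IsTest a b φ) (h0 : ∫ x in a..b, φ x = 0) :
    ∃ Φ, IsTest a b Φ ∧ _root_.deriv Φ = φ := by
  have hc : Continuous φ := hφ.smooth.continuous
  have hd : ∀ x, HasDerivAt (fun x => ∫ t in a..x, φ t) (φ x) x := fun x =>
    intervalIntegral.integral_hasDerivAt_right (hc.intervalIntegrable _ _)
      (hc.stronglyMeasurableAtFilter _ _) hc.continuousAt
  have hdd : _root_.deriv (fun x => ∫ t in a..x, φ t) = φ := funext fun x => (hd x).deriv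
  obtain ⟨c, d, hac, hdb, hcd⟩ : ∃ c d, a < c ∧ d < b ∧ ∀ x, x ∉ Icc c d → φ x = 0 := by
    by_cases hne : (tsupport φ).Nonempty
    · obtain ⟨c, hc1, hc2⟩ := hφ.compact.isCompact.exists_isLeast hne
      obtain ⟨d, hd1, hd2⟩ := hφ.compact.isCompact.exists_isGreatest hne
      exact ⟨c, d, (hφ.subset hc1).1, (hφ.subset hd1).2, fun x hx =>
        image_eq_zero_of_notMem_tsupport fun h => hx ⟨hc2 h, hd2 h⟩⟩
    · refine ⟨(a + b) / 2, (a + b) / 2, by linarith, by linarith, fun x _ =>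
        image_eq_zero_of_notMem_tsupport fun h => hne ⟨x, h⟩⟩
  have hz : ∀ x, x ∉ Icc c d → ∫ t in a..x, φ t = 0 := by
    intro x hx
    rw [mem_Icc, not_and_or, not_le, not_le] at hx
    rcases hx with hx | hx
    · rw [intervalIntegral.integral_congr (g := fun _ => 0) fun t ht => ?_]
      · simp
      · refine hcd t fun h => ?_
        have := ht.2.trans (max_le hac.le hx.le)
        rcases this.lt_or_eq with h1 | h1
        · exact absurd h.1 (not_le.2 h1)
        · have h2 := ht.2
          rw [h1] at h2
          exact absurd h2 (not_le.2 (max_lt hac hx))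
    · have h1 := intervalIntegral.integral_add_adjacent_intervals
        (hc.intervalIntegrable (μ := volume) a x) (hc.intervalIntegrable x b)
      have h2 : ∫ t in x..b, φ t = 0 := by
        rw [intervalIntegral.integral_congr (g := fun _ => 0) fun t ht => ?_]
        · simp
        · refine hcd t fun h => ?_
          have h3 : d < t := (lt_min hx hdb).trans_le ht.1
          exact absurd h.2 (not_le.2 h3)
      rw [h2, h0, add_zero] at h1
      exact h1
  have hs : tsupport (fun x => ∫ t in a..x, φ t) ⊆ Icc c d :=
    closure_minimal (fun x hx => by
      by_contra hcon
      exact hx (hz x hcon)) isClosed_Icc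
  refine ⟨fun x => ∫ t in a..x, φ t, ⟨?_, ?_, hs.trans fun x hx =>
    ⟨hac.trans_le hx.1, hx.2.trans_lt hdb⟩⟩, hdd⟩
  · rw [contDiff_infty_iff_deriv, hdd]
    exact ⟨fun x => (hd x).differentiableAt, hφ.smooth⟩
  · exact isCompact_Icc.of_isClosed_subset (isClosed_tsupport _) hs

theorem ae_eq_zero_of_test {W : ℝ → ℝ} (hW : IntegrableOn W (Ioo a b))
    (h : ∀ φ, IsTest a b φ → ∫ x in a..b, W x * φ x = 0) :
    ∀ᵐ x, x ∈ Ioo a b → W x = 0 := by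
  refine isOpen_Ioo.ae_eq_zero_of_integral_contDiff_smul_eq_zero hW.locallyIntegrableOn
    fun φ h1 h2 h3 => ?_
  have hφ : IsTest a b φ := ⟨h1, h2, h3⟩
  rw [← h φ hφ, intervalIntegral.integral_eq_integral_of_support_subset]
  · congr 1; ext x; rw [smul_eq_mul, mul_comm]
  · intro x hx
    have : φ x ≠ 0 := right_ne_zero_of_mul hx
    exact Ioo_subset_Ioc_self (h3 (subset_tsupport φ this))

/-- The lemma of du Bois-Reymond. -/
theorem exists_ae_eq_const_of_test {W : ℝ → ℝ} (hab : a < b) (hW : IntegrableOn W (Ioo a b))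
    (h : ∀ φ, IsTest a b φ → ∫ x in a..b, W x * deriv φ x = 0) :
    ∃ κ : ℝ, ∀ᵐ x, x ∈ Ioo a b → W x = κ := by
  obtain ⟨ψ, hψ, hψ1⟩ := exists_isTest_integral_eq_one hab
  have hWi : IntervalIntegrable W volume a b := by
    rw [intervalIntegrable_iff_integrableOn_Ioo_of_le hab.le]; exact hW
  have hi : ∀ {φ : ℝ → ℝ}, IsTest a b φ → IntervalIntegrable (fun x => W x * φ x) volume a b :=
    fun hφ => hWi.mul_continuousOn hφ.smooth.continuous.continuousOn
  set κ := ∫ x in a..b, W x * ψ x with hκ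
  refine ⟨κ, ?_⟩
  have key := ae_eq_zero_of_test (a := a) (b := b) (W := fun x => W x - κ)
    (hW.sub (integrableOn_const (by simp))) fun φ hφ => by
      have hφc := hφ.smooth.continuous
      have hψc := hψ.smooth.continuous
      set s := ∫ x in a..b, φ x with hs
      -- Subtracting its integral times the normalized bump ψ makes any test function the derivative
      -- of a test function; the constant is therefore the value of W against ψ.
      obtain ⟨Φ, hΦ, hΦd⟩ := (hφ.sub_const_mul hψ s).primitive hab (by
        rw [intervalIntegral.integral_sub (hφc.intervalIntegrable _ _)
          ((hψc.intervalIntegrable _ _).const_mul _), intervalIntegral.integral_const_mul, hψ1]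
        ring)
      have h1 := h Φ hΦ
      rw [hΦd] at h1
      have e1 : ∀ x, W x * (φ x - s * ψ x) = W x * φ x - s * (W x * ψ x) := fun x => by ring
      have e2 : ∀ x, (W x - κ) * φ x = W x * φ x - κ * φ x := fun x => by ring
      simp_rw [e1] at h1
      simp_rw [e2]
      rw [intervalIntegral.integral_sub (hi hφ) ((hi hψ).const_mul s),
        intervalIntegral.integral_const_mul] at h1
      rw [intervalIntegral.integral_sub (hi hφ) ((hφc.intervalIntegrable _ _).const_mul κ),
        intervalIntegral.integral_const_mul, ← hs, ← h1]
      ring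
  filter_upwards [key] with x hx hxm
  linarith [hx hxm]

/-- By parts, G minus the primitive of H annihilates derivatives of test functions. -/
theorem exists_ae_eq_primitive {G H : ℝ → ℝ} (hab : a < b) (hG : IntegrableOn G (Ioo a b))
    (hH : IntegrableOn H (Ioo a b))
    (h : ∀ φ, IsTest a b φ → ∫ x in a..b, G x * deriv φ x = -∫ x in a..b, H x * φ x) :
    ∃ κ : ℝ, ∀ᵐ x, x ∈ Ioo a b → G x = κ + ∫ t in a..x, H t := by
  have hGi : IntervalIntegrable G volume a b := by
    rw [intervalIntegrable_iff_integrableOn_Ioo_of_le hab.le]; exact hG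
  have hHi : IntervalIntegrable H volume a b := by
    rw [intervalIntegrable_iff_integrableOn_Ioo_of_le hab.le]; exact hH
  have hVc : ContinuousOn (fun x => ∫ t in a..x, H t) (uIcc a b) :=
    intervalIntegral.continuousOn_primitive_interval' hHi left_mem_uIcc
  have hVi : IntegrableOn (fun x => ∫ t in a..x, H t) (Ioo a b) := by
    rw [← intervalIntegrable_iff_integrableOn_Ioo_of_le hab.le]
    exact hVc.intervalIntegrable
  obtain ⟨κ, hκ⟩ := exists_ae_eq_const_of_test hab (hG.sub hVi) fun φ hφ => by
    have hφ' := hφ.deriv.smooth.continuous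
    have h1 := integral_mul_eq_sub_integral_deriv_mul (l := a) (r := b) hφ.hasDerivAt hφ' hHi
    rw [hφ.eq_zero_of_notMem (x := b) (by simp), zero_mul, zero_sub] at h1
    have h2 := h φ hφ
    have e : ∀ x, (G - fun x => ∫ t in a..x, H t) x * deriv φ x =
        G x * deriv φ x - deriv φ x * ∫ t in a..x, H t := fun x => by
      rw [Pi.sub_apply]; ring
    have i1 : IntervalIntegrable (fun x => deriv φ x * ∫ t in a..x, H t) volume a b :=
      (hφ'.continuousOn.mul hVc).intervalIntegrable
    simp_rw [e]
    rw [intervalIntegral.integral_sub (hGi.mul_continuousOn hφ'.continuousOn) i1, h2]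
    have e3 : ∀ x, φ x * H x = H x * φ x := fun x => mul_comm _ _
    simp_rw [e3] at h1
    linarith
  refine ⟨κ, ?_⟩
  filter_upwards [hκ] with x hx hxm
  have := hx hxm
  rw [Pi.sub_apply] at this
  linarith

end Test

/-! ### From bounded weak derivatives to chains of primitives and polynomial approximation. -/

section Chain

variable {a b : ℝ}

theorem abs_le_on_Icc_of_ae {f : ℝ → ℝ} {M : ℝ} (hab : a < b) (hf : ContinuousOn f (Icc a b))
    (h : ∀ᵐ x, x ∈ Ioo a b → |f x| ≤ M) : ∀ x ∈ Icc a b, |f x| ≤ M := by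
  have h' : ∀ᵐ x ∂volume.restrict (Icc a b), |f x| ≤ M := by
    rw [← restrict_Ioo_eq_restrict_Icc, ae_restrict_iff' measurableSet_Ioo]; exact h
  have heq := Measure.eqOn_Icc_of_ae_eq volume hab.ne
    (f := fun x => |f x|) (g := fun x => min |f x| M)
    (by filter_upwards [h'] with x hx; rw [min_eq_left hx]) hf.abs
    (hf.abs.inf continuousOn_const)
  intro x hx
  have h1 : |f x| = min |f x| M := heq hx
  rw [h1]; exact min_le_right _ _

/-- A function all of whose weak derivatives up to the order `m` are bounded by `M` is the start
of a chain of bounded functions each of which is the primitive of the next one. -/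
theorem exists_primitive_chain {m : ℕ} (hm : 0 < m) {v : ℝ → ℝ} {M : ℝ} (hab : a < b)
    (hM : 0 ≤ M) (hv : ContinuousOn v (Icc a b)) (hvM : WeakDerivsBoundedBy (Ioo a b) m v M) :
    ∃ W : ℕ → ℝ → ℝ, EqOn (W 0) v (Icc a b) ∧
      (∀ j ≤ m, ∀ x ∈ Icc a b, |W j x| ≤ M) ∧
      (∀ j ≤ m, IntervalIntegrable (W j) volume a b) ∧
      (∀ j < m, ∀ x ∈ Icc a b, W j x = W j a + ∫ t in a..x, W (j + 1) t) := by
  have hG : ∀ j, ∃ G : ℝ → ℝ, j ≤ m → Measurable G ∧ (∀ x, |G x| ≤ M) ∧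
      ∀ φ, IsTest a b φ →
        ∫ x in a..b, v x * iteratedDeriv j φ x = (-1) ^ j * ∫ x in a..b, G x * φ x := by
    intro j
    by_cases hj : j ≤ m
    swap
    · exact ⟨0, fun h => absurd h hj⟩
    obtain ⟨g, ⟨-, hg, hgt⟩, hgM⟩ := hvM j hj
    have hgm : AEStronglyMeasurable g (volume.restrict (Ioo a b)) :=
      hg.aestronglyMeasurable
    set g' := hgm.mk g
    have hg'm : Measurable g' := hgm.stronglyMeasurable_mk.measurable
    -- A measurable representative, set to zero where the bound fails, is measurable and bounded
    -- everywhere, so it is integrable on every interval.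
    refine ⟨fun x => if |g' x| ≤ M then g' x else 0, fun _ => ⟨?_, ?_, ?_⟩⟩
    · exact Measurable.ite (measurableSet_le hg'm.abs measurable_const) hg'm measurable_const
    · intro x
      beta_reduce
      split_ifs with h
      · exact h
      · simpa using hM
    · intro φ hφ
      rw [← setIntegral_Ioo_eq hab.le, ← setIntegral_Ioo_eq hab.le,
        hgt φ hφ.smooth hφ.compact hφ.subset]
      congr 1
      refine integral_congr_ae ?_
      filter_upwards [hgM, hgm.ae_eq_mk] with x h1 h2
      have h3 : g' x = g x := h2.symm
      rw [h3, if_pos h1]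
  choose G hG using hG
  have hGi : ∀ j ≤ m, ∀ c d, IntervalIntegrable (G j) volume c d := by
    intro j hj c d
    have := (intervalIntegrable_const (c := (1 : ℝ)) (a := c) (b := d) (μ := volume))
    have key : ∀ {μ : Measure ℝ} [IsFiniteMeasure μ], Integrable (G j) μ := fun {μ} _ =>
      Integrable.of_bound (hG j hj).1.aestronglyMeasurable M
        (Eventually.of_forall (hG j hj).2.1)
    exact ⟨key, key⟩
  have hGo : ∀ j ≤ m, IntegrableOn (G j) (Ioo a b) := fun j hj => by
    rw [← intervalIntegrable_iff_integrableOn_Ioo_of_le hab.le]; exact hGi j hj a b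
  have hstep : ∀ j, ∃ κ : ℝ, j < m → ∀ᵐ x, x ∈ Ioo a b → G j x = κ + ∫ t in a..x, G (j + 1) t := by
    intro j
    by_cases hj : j < m
    swap
    · exact ⟨0, fun h => absurd h hj⟩
    obtain ⟨κ, hκ⟩ := exists_ae_eq_primitive hab (hGo j hj.le) (hGo (j + 1) hj) fun φ hφ => by
      have h1 := (hG j hj.le).2.2 (deriv φ) hφ.deriv
      have h2 := (hG (j + 1) hj).2.2 φ hφ
      rw [iteratedDeriv_succ', h1, pow_succ] at h2
      have hne : ((-1 : ℝ)) ^ j ≠ 0 := pow_ne_zero _ (by norm_num)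
      have h3 : (-1 : ℝ) ^ j * (∫ x in a..b, G j x * deriv φ x) =
        (-1) ^ j * (-∫ x in a..b, G (j + 1) x * φ x) := by rw [h2]; ring
      exact mul_left_cancel₀ hne h3
    exact ⟨κ, fun _ => hκ⟩
  choose κ hκ using hstep
  -- Below the top order the continuous representative is taken; the top derivative is only bounded
  -- and measurable.
  set W : ℕ → ℝ → ℝ := fun j x => if j < m then κ j + ∫ t in a..x, G (j + 1) t else G j x with hW
  have hWlt : ∀ j < m, W j = fun x => κ j + ∫ t in a..x, G (j + 1) t := fun j hj => by
    ext x; simp only [hW, if_pos hj]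
  have hWG : ∀ j ≤ m, ∀ᵐ x, x ∈ Ioo a b → W j x = G j x := by
    intro j hj
    rcases hj.lt_or_eq with hj | rfl
    · filter_upwards [hκ j hj] with x hx hxm
      rw [hWlt j hj, hx hxm]
    · filter_upwards with x _
      simp only [hW, if_neg (lt_irrefl _)]
  have hWc : ∀ j < m, ContinuousOn (W j) (Icc a b) := by
    intro j hj
    rw [hWlt j hj]
    have := intervalIntegral.continuousOn_primitive_interval' (hGi (j + 1) hj a b)
      (left_mem_uIcc)
    rw [uIcc_of_le hab.le] at this
    exact continuousOn_const.add this
  have hWint : ∀ j < m, ∀ x ∈ Icc a b, ∫ t in a..x, W (j + 1) t = ∫ t in a..x, G (j + 1) t := by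
    intro j hj x hx
    rw [← setIntegral_Ioo_eq hx.1, ← setIntegral_Ioo_eq hx.1]
    refine setIntegral_congr_ae measurableSet_Ioo ?_
    filter_upwards [hWG (j + 1) hj] with t ht htm
    exact ht ⟨htm.1, htm.2.trans_le hx.2⟩
  refine ⟨W, ?_, ?_, ?_, ?_⟩
  · refine Measure.eqOn_Icc_of_ae_eq volume hab.ne ?_ (hWc 0 hm) hv
    rw [← restrict_Ioo_eq_restrict_Icc]
    refine (ae_restrict_iff' measurableSet_Ioo).2 ?_
    have hvi : IntervalIntegrable v volume a b := by
      rw [← uIcc_of_le hab.le] at hv; exact hv.intervalIntegrable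
    have h0 := ae_eq_zero_of_test (a := a) (b := b) (W := fun x => v x - G 0 x) (by
      rw [← intervalIntegrable_iff_integrableOn_Ioo_of_le hab.le]
      exact hvi.sub (hGi 0 (Nat.zero_le _) a b)) fun φ hφ => by
        have h1 := (hG 0 (Nat.zero_le _)).2.2 φ hφ
        rw [iteratedDeriv_zero, pow_zero, one_mul] at h1
        have e : ∀ x, (v x - G 0 x) * φ x = v x * φ x - G 0 x * φ x := fun x => by ring
        simp_rw [e]
        have hc := hφ.smooth.continuous.continuousOn (s := uIcc a b)
        rw [intervalIntegral.integral_sub (hvi.mul_continuousOn hc)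
          ((hGi 0 (Nat.zero_le _) a b).mul_continuousOn hc), h1, sub_self]
    filter_upwards [h0, hWG 0 (Nat.zero_le _)] with x h1 h2 hx
    rw [h2 hx]; linarith [h1 hx]
  · intro j hj x hx
    rcases hj.lt_or_eq with hj' | rfl
    · refine abs_le_on_Icc_of_ae hab (hWc j hj') ?_ x hx
      filter_upwards [hWG j hj] with y hy hym
      rw [hy hym]; exact (hG j hj).2.1 y
    · simp only [hW, if_neg (lt_irrefl _)]; exact (hG _ le_rfl).2.1 x
  · intro j hj
    rcases hj.lt_or_eq with hj' | rfl
    · have := hWc j hj'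
      rw [← uIcc_of_le hab.le] at this; exact this.intervalIntegrable
    · simp only [hW, if_neg (lt_irrefl _)]; exact hGi _ le_rfl a b
  · intro j hj x hx
    rw [hWint j hj x hx, hWlt j hj]
    simp only [intervalIntegral.integral_same, add_zero]

end Chain

section Chain

variable {a b : ℝ}

theorem continuousOn_of_eq_primitive {F G : ℝ → ℝ} (hab : a ≤ b)
    (hG : IntervalIntegrable G volume a b)
    (h : ∀ x ∈ Icc a b, F x = F a + ∫ t in a..x, G t) : ContinuousOn F (Icc a b) := by
  have := intervalIntegral.continuousOn_primitive_interval' hG left_mem_uIcc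
  rw [uIcc_of_le hab] at this
  exact (continuousOn_const.add this).congr h

theorem hasDerivAt_of_eq_primitive {F G : ℝ → ℝ} (hG : ContinuousOn G (Icc a b))
    (h : ∀ x ∈ Icc a b, F x = F a + ∫ t in a..x, G t) : ∀ x ∈ Ioo a b, HasDerivAt F (G x) x := by
  intro x hx
  have hn : Icc a b ∈ 𝓝 x := Icc_mem_nhds hx.1 hx.2
  have hGx : ContinuousAt G x := hG.continuousAt hn
  have h1 : HasDerivAt (fun x => F a + ∫ t in a..x, G t) (G x) x := by
    refine HasDerivAt.const_add _ (intervalIntegral.integral_hasDerivAt_right ?_ ?_ hGx)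
    · refine ContinuousOn.intervalIntegrable (hG.mono ?_)
      rw [uIcc_of_le hx.1.le]; exact Icc_subset_Icc_right hx.2.le
    · exact ⟨Icc a b, hn, hG.aestronglyMeasurable measurableSet_Icc⟩
  refine h1.congr_of_eventuallyEq ?_
  filter_upwards [hn] with y hy using h y hy

/-- Connects the weak derivatives with the classical ones in the jump conditions. The order m is
excluded because the last member of the chain need not be continuous. -/
theorem iteratedDeriv_eq_of_primitive_chain {m : ℕ} {W : ℕ → ℝ → ℝ} {v : ℝ → ℝ} (hab : a ≤ b)
    (h0 : EqOn (W 0) v (Icc a b)) (hi : ∀ j ≤ m, IntervalIntegrable (W j) volume a b)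
    (hc : ∀ j < m, ∀ x ∈ Icc a b, W j x = W j a + ∫ t in a..x, W (j + 1) t) :
    ∀ j < m, ∀ x ∈ Ioo a b, iteratedDeriv j v x = W j x := by
  intro j
  induction j with
  | zero =>
    intro _ x hx
    rw [iteratedDeriv_zero, h0 (Ioo_subset_Icc_self hx)]
  | succ j ih =>
    intro hj x hx
    have hd := hasDerivAt_of_eq_primitive (continuousOn_of_eq_primitive hab
      (hi (j + 2) hj) (hc (j + 1) hj)) (hc j (by omega)) x hx
    rw [iteratedDeriv_succ, ← hd.deriv]
    refine EventuallyEq.deriv_eq ?_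
    filter_upwards [isOpen_Ioo.mem_nhds hx] with y hy using ih (by omega) y hy

/-- A chain of bounded primitives yields polynomial approximations. -/
theorem approx_of_primitive_chain {m : ℕ} {G : ℕ → ℝ → ℝ} {M : ℝ} (hM : 0 ≤ M)
    (hGM : ∀ j ≤ m, ∀ x ∈ Icc a b, |G j x| ≤ M)
    (hi : ∀ j ≤ m, IntervalIntegrable (G j) volume a b)
    (hc : ∀ j < m, ∀ x ∈ Icc a b, G j x = G j a + ∫ t in a..x, G (j + 1) t) {l r : ℝ}
    (hal : a ≤ l) (hlr : l ≤ r) (hrb : r ≤ b) :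
    ∀ n j, j + n ≤ m → Approx n M (G j) l r := by
  intro n
  induction n with
  | zero =>
    intro j hj
    refine ⟨0, by simp, fun x hx => ?_⟩
    simpa using hGM j hj x ⟨hal.trans hx.1, hx.2.trans hrb⟩
  | succ n ih =>
    intro j hj
    obtain ⟨T, hT, hTe⟩ := ih (j + 1) (by omega)
    obtain ⟨S, hS, hSd⟩ := exists_derivative_eq T
    have hl : l ∈ Icc a b := ⟨hal, hlr.trans hrb⟩
    -- The approximation of the derivative is integrated and its value matched at l; each
    -- integration gains a factor r - l.
    refine ⟨S - C (S.eval l) + C (G j l), ?_, fun x hx => ?_⟩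
    · by_cases hn : n = 0
      · subst hn
        have hT0 : T = 0 := by
          by_contra h
          exact absurd hT (by rw [degree_eq_natDegree h]; simp)
        rw [hT0] at hS hSd
        have : S = C (S.coeff 0) := eq_C_of_derivative_eq_zero hS
        rw [this, eval_C, sub_self, zero_add]
        exact degree_C_le.trans_lt (by norm_num)
      · refine degree_le_natDegree.trans_lt ?_
        have hTn : T.natDegree < n := by
          by_cases h0 : T = 0
          · rw [h0, natDegree_zero]; omega
          · exact (natDegree_lt_iff_degree_lt h0).2 hT
        have h1 := natDegree_add_le (S - C (S.eval l)) (C (G j l))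
        have h2 := natDegree_sub_le S (C (S.eval l))
        rw [natDegree_C] at h1 h2
        have h3 : (S - C (S.eval l) + C (G j l)).natDegree < n + 1 := by omega
        exact_mod_cast h3
    · have hxm : x ∈ Icc a b := ⟨hal.trans hx.1, hx.2.trans hrb⟩
      have hii : ∀ c d, c ∈ Icc a b → d ∈ Icc a b →
          IntervalIntegrable (G (j + 1)) volume c d := fun c d hcm hdm =>
        (hi (j + 1) (by omega)).mono_set (by
          rw [uIcc_of_le (hcm.1.trans hcm.2)]
          exact uIcc_subset_Icc hcm hdm)
      have ha : a ∈ Icc a b := ⟨le_rfl, hal.trans hl.2⟩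
      have h1 : G j x = G j l + ∫ t in l..x, G (j + 1) t := by
        rw [hc j (by omega) x hxm, hc j (by omega) l hl, add_assoc,
          intervalIntegral.integral_add_adjacent_intervals (hii a l ha hl) (hii l x hl hxm)]
      have h2 : ∫ t in l..x, T.eval t = S.eval x - S.eval l :=
        intervalIntegral.integral_eq_sub_of_hasDerivAt
          (fun y _ => by rw [← hS]; exact S.hasDerivAt y) (T.continuous.intervalIntegrable _ _)
      have h3 : G j x - (S - C (S.eval l) + C (G j l)).eval x =
          ∫ t in l..x, (G (j + 1) t - T.eval t) := by
        rw [intervalIntegral.integral_sub (hii l x hl hxm) (T.continuous.intervalIntegrable _ _),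
          h2, h1]
        simp only [eval_add, eval_sub, eval_C]; ring
      rw [h3]
      have h4 := intervalIntegral.norm_integral_le_of_norm_le_const (a := l) (b := x)
        (f := fun t => G (j + 1) t - T.eval t) (C := M * (r - l) ^ n) fun t ht => by
          rw [uIoc_of_le hx.1] at ht
          exact hTe t ⟨ht.1.le, ht.2.trans hx.2⟩
      rw [Real.norm_eq_abs, abs_of_nonneg (sub_nonneg.2 hx.1)] at h4
      refine h4.trans ?_
      have : 0 ≤ r - l := by linarith
      calc M * (r - l) ^ n * (x - l) ≤ M * (r - l) ^ n * (r - l) := by gcongr; exact hx.2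
        _ = _ := by ring

end Chain

/-- What is used of the regularity of a solution `u`: its flux `q` is continuously differentiable
across the interface and well approximable by polynomials. -/
structure RegularFlux (a b α βm βp : ℝ) (n : ℕ) (M : ℝ) (u q q' : ℝ → ℝ) : Prop where
  cont : ContinuousOn q (Icc a b)
  cont' : ContinuousOn q' (Icc a b)
  hasDerivAt : ∀ x ∈ Ioo a b, HasDerivAt q (q' x) x
  hasDerivAt_u : ∀ x ∈ Ioo a b, x ≠ α → HasDerivAt u ((beta α βm βp x)⁻¹ * q x) x
  eq_integral : ∀ x ∈ Icc a b, u x = ∫ t in a..x, (beta α βm βp t)⁻¹ * q t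
  approx : ∀ k ≤ n, ∀ l r, a ≤ l → l ≤ r → r ≤ b → Approx k M q l r

theorem exists_regularFlux {a b α βm βp : ℝ} (hα : α ∈ Ioo a b) (hβm : 0 < βm) (hβp : 0 < βp)
    {n : ℕ} (hn : 2 ≤ n) {u : ℝ → ℝ} (hu : MemInterfaceSobolev a b α βm βp (n + 1) u) {M : ℝ}
    (hM : 0 ≤ M) (hl : WeakDerivsBoundedBy (Ioo a α) (n + 1) u M)
    (hr : WeakDerivsBoundedBy (Ioo α b) (n + 1) u M) :
    ∃ q q' : ℝ → ℝ, RegularFlux a b α βm βp n (max βm βp * M) u q q' := by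
  obtain ⟨huc, hua, -, -, -, hjump⟩ := hu
  have hαI := Ioo_subset_Icc_self hα
  obtain ⟨U, hU0, hUM, hUi, hUc⟩ := exists_primitive_chain (Nat.succ_pos n) hα.1 hM
    (huc.mono (Icc_subset_Icc_right hα.2.le)) hl
  obtain ⟨V, hV0, hVM, hVi, hVc⟩ := exists_primitive_chain (Nat.succ_pos n) hα.2 hM
    (huc.mono (Icc_subset_Icc_left hα.1.le)) hr
  have hUcont : ∀ j ≤ n, ContinuousOn (U j) (Icc a α) := fun j hj =>
    continuousOn_of_eq_primitive hα.1.le (hUi (j + 1) (by omega)) (hUc j (by omega))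
  have hVcont : ∀ j ≤ n, ContinuousOn (V j) (Icc α b) := fun j hj =>
    continuousOn_of_eq_primitive hα.2.le (hVi (j + 1) (by omega)) (hVc j (by omega))
  -- The one-sided limits of the classical derivatives are the values at α of the continuous chain
  -- members.
  have hmatch : ∀ j, 1 ≤ j → j ≤ n → βm * U j α = βp * V j α := by
    intro j hj1 hjn
    obtain ⟨l, hl1, hl2⟩ := hjump j hj1 (by omega)
    have h1 : Tendsto (fun x => βm * iteratedDeriv j u x) (𝓝[<] α) (𝓝 (βm * U j α)) := by
      have hc : ContinuousWithinAt (U j) (Iio α) α :=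
        ((hUcont j hjn) α (right_mem_Icc.2 hα.1.le)).mono_of_mem_nhdsWithin
          (Icc_mem_nhdsLT hα.1)
      refine (hc.tendsto.const_mul βm).congr' ?_
      filter_upwards [Ioo_mem_nhdsLT hα.1] with x hx
      rw [iteratedDeriv_eq_of_primitive_chain hα.1.le hU0 hUi hUc j (by omega) x hx]
    have h2 : Tendsto (fun x => βp * iteratedDeriv j u x) (𝓝[>] α) (𝓝 (βp * V j α)) := by
      have hc : ContinuousWithinAt (V j) (Ioi α) α :=
        ((hVcont j hjn) α (left_mem_Icc.2 hα.2.le)).mono_of_mem_nhdsWithin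
          (Icc_mem_nhdsGT hα.2)
      refine (hc.tendsto.const_mul βp).congr' ?_
      filter_upwards [Ioo_mem_nhdsGT hα.2] with x hx
      rw [iteratedDeriv_eq_of_primitive_chain hα.2.le hV0 hVi hVc j (by omega) x hx]
    rw [tendsto_nhds_unique h1 hl1, tendsto_nhds_unique h2 hl2]
  -- The j-th derivative of the flux. By `hmatch` the two pieces fit continuously at α for j < n, so
  -- these functions form a single chain of primitives on [a, b].
  set G : ℕ → ℝ → ℝ := fun j x => if x < α then βm * U (j + 1) x else βp * V (j + 1) x with hG
  have hGl : ∀ j x, x < α → G j x = βm * U (j + 1) x := fun j x hx => by simp only [hG, if_pos hx]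
  have hGr : ∀ j x, α ≤ x → G j x = βp * V (j + 1) x := fun j x hx => by
    simp only [hG, if_neg (not_lt.2 hx)]
  have hGl' : ∀ j < n, ∀ x ≤ α, G j x = βm * U (j + 1) x := by
    intro j hj x hx
    rcases hx.lt_or_eq with h | rfl
    · exact hGl j x h
    · rw [hGr j x le_rfl, hmatch (j + 1) (by omega) (by omega)]
  have hil : ∀ j ≤ n, ∀ x ∈ Icc a α, IntervalIntegrable (G j) volume a x ∧
      ∫ t in a..x, G j t = βm * ∫ t in a..x, U (j + 1) t := by
    intro j hj x hx
    have h1 : IntervalIntegrable (fun t => βm * U (j + 1) t) volume a x :=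
      ((hUi (j + 1) (by omega)).mono_set (by
        rw [uIcc_of_le hx.1, uIcc_of_le hα.1.le]; exact Icc_subset_Icc_right hx.2)).const_mul βm
    constructor
    · rw [intervalIntegrable_iff_integrableOn_Ioo_of_le hx.1] at h1 ⊢
      exact h1.congr_fun (fun t ht => (hGl j t (ht.2.trans_le hx.2)).symm) measurableSet_Ioo
    · rw [← intervalIntegral.integral_const_mul, ← setIntegral_Ioo_eq hx.1,
        ← setIntegral_Ioo_eq hx.1]
      exact setIntegral_congr_fun measurableSet_Ioo fun t ht => hGl j t (ht.2.trans_le hx.2)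
  have hir : ∀ j ≤ n, ∀ x ∈ Icc α b, IntervalIntegrable (G j) volume α x ∧
      ∫ t in α..x, G j t = βp * ∫ t in α..x, V (j + 1) t := by
    intro j hj x hx
    have h1 : IntervalIntegrable (fun t => βp * V (j + 1) t) volume α x :=
      ((hVi (j + 1) (by omega)).mono_set (by
        rw [uIcc_of_le hx.1, uIcc_of_le hα.2.le]; exact Icc_subset_Icc_right hx.2)).const_mul βp
    constructor
    · rw [intervalIntegrable_iff_integrableOn_Ioo_of_le hx.1] at h1 ⊢
      exact h1.congr_fun (fun t ht => (hGr j t ht.1.le).symm) measurableSet_Ioo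
    · rw [← intervalIntegral.integral_const_mul, ← setIntegral_Ioo_eq hx.1,
        ← setIntegral_Ioo_eq hx.1]
      exact setIntegral_congr_fun measurableSet_Ioo fun t ht => hGr j t ht.1.le
  have hαa : α ∈ Icc a α := right_mem_Icc.2 hα.1.le
  have haa : a ∈ Icc a α := left_mem_Icc.2 hα.1.le
  have hGi : ∀ j ≤ n, IntervalIntegrable (G j) volume a b := fun j hj =>
    (hil j hj α hαa).1.trans (hir j hj b (right_mem_Icc.2 hα.2.le)).1
  have hGc : ∀ j < n, ∀ x ∈ Icc a b, G j x = G j a + ∫ t in a..x, G (j + 1) t := by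
    intro j hj x hx
    have hl : ∀ y ∈ Icc a α, G j y = G j a + ∫ t in a..y, G (j + 1) t := fun y hy => by
      rw [hGl' j hj y hy.2, hGl' j hj a hα.1.le, (hil (j + 1) hj y hy).2,
        hUc (j + 1) (by omega) y hy]
      ring
    rcases le_total x α with h | h
    · exact hl x ⟨hx.1, h⟩
    · rw [← intervalIntegral.integral_add_adjacent_intervals (hil (j + 1) hj α hαa).1
        (hir (j + 1) hj x ⟨h, hx.2⟩).1, ← add_assoc, ← hl α hαa,
        (hir (j + 1) hj x ⟨h, hx.2⟩).2, hGr j x h, hGr j α le_rfl,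
        hVc (j + 1) (by omega) x ⟨h, hx.2⟩]
      ring
  have hB : 0 ≤ max βm βp := hβm.le.trans (le_max_left _ _)
  have hGM : ∀ j ≤ n, ∀ x ∈ Icc a b, |G j x| ≤ max βm βp * M := by
    intro j hj x hx
    rcases lt_or_ge x α with h | h
    · rw [hGl j x h, abs_mul, abs_of_pos hβm]
      exact mul_le_mul (le_max_left _ _) (hUM (j + 1) (by omega) x ⟨hx.1, h.le⟩)
        (abs_nonneg _) hB
    · rw [hGr j x h, abs_mul, abs_of_pos hβp]
      exact mul_le_mul (le_max_right _ _) (hVM (j + 1) (by omega) x ⟨h, hx.2⟩)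
        (abs_nonneg _) hB
  have hab : a ≤ b := hα.1.le.trans hα.2.le
  have hc0 := continuousOn_of_eq_primitive hab (hGi 1 (by omega)) (hGc 0 (by omega))
  have hc1 := continuousOn_of_eq_primitive hab (hGi 2 (by omega)) (hGc 1 (by omega))
  have hbl : ∀ t, t < α → (beta α βm βp t)⁻¹ * G 0 t = U 1 t := fun t ht => by
    rw [beta, if_pos ht, hGl 0 t ht, zero_add, inv_mul_cancel_left₀ hβm.ne']
  have hbr : ∀ t, α ≤ t → (beta α βm βp t)⁻¹ * G 0 t = V 1 t := fun t ht => by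
    rw [beta, if_neg (not_lt.2 ht), hGr 0 t ht, zero_add, inv_mul_cancel_left₀ hβp.ne']
  refine ⟨G 0, G 1, hc0, hc1, hasDerivAt_of_eq_primitive hc1 (hGc 0 (by omega)), ?_, ?_, ?_⟩
  · intro x hx hxα
    rcases lt_or_gt_of_ne hxα with h | h
    · rw [hbl x h]
      refine (hasDerivAt_of_eq_primitive (hUcont 1 (by omega)) (hUc 0 (by omega)) x
        ⟨hx.1, h⟩).congr_of_eventuallyEq ?_
      filter_upwards [Icc_mem_nhds hx.1 h] with y hy using (hU0 hy).symm
    · rw [hbr x h.le]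
      refine (hasDerivAt_of_eq_primitive (hVcont 1 (by omega)) (hVc 0 (by omega)) x
        ⟨h, hx.2⟩).congr_of_eventuallyEq ?_
      filter_upwards [Icc_mem_nhds h hx.2] with y hy using (hV0 hy).symm
  · have hl : ∀ x ∈ Icc a α, IntervalIntegrable (fun t => (beta α βm βp t)⁻¹ * G 0 t) volume a x ∧
        u x = ∫ t in a..x, (beta α βm βp t)⁻¹ * G 0 t := by
      intro x hx
      constructor
      · have h1 : IntervalIntegrable (U 1) volume a x := (hUi 1 (by omega)).mono_set (by
          rw [uIcc_of_le hx.1, uIcc_of_le hα.1.le]; exact Icc_subset_Icc_right hx.2)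
        rw [intervalIntegrable_iff_integrableOn_Ioo_of_le hx.1] at h1 ⊢
        exact h1.congr_fun (fun t ht => (hbl t (ht.2.trans_le hx.2)).symm) measurableSet_Ioo
      · rw [← hU0 hx, hUc 0 (by omega) x hx, hU0 haa, hua, zero_add, zero_add,
          ← setIntegral_Ioo_eq hx.1, ← setIntegral_Ioo_eq hx.1]
        exact setIntegral_congr_fun measurableSet_Ioo fun t ht =>
          (hbl t (ht.2.trans_le hx.2)).symm
    intro x hx
    rcases le_total x α with h | h
    · exact (hl x ⟨hx.1, h⟩).2
    · have h1 : IntervalIntegrable (V 1) volume α x := (hVi 1 (by omega)).mono_set (by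
        rw [uIcc_of_le h, uIcc_of_le hα.2.le]; exact Icc_subset_Icc_right hx.2)
      have h2 : IntervalIntegrable (fun t => (beta α βm βp t)⁻¹ * G 0 t) volume α x := by
        rw [intervalIntegrable_iff_integrableOn_Ioo_of_le h] at h1 ⊢
        exact h1.congr_fun (fun t ht => (hbr t ht.1.le).symm) measurableSet_Ioo
      rw [← intervalIntegral.integral_add_adjacent_intervals (hl α hαa).1 h2, ← (hl α hαa).2,
        ← hV0 ⟨h, hx.2⟩, hVc 0 (by omega) x ⟨h, hx.2⟩, hV0 (left_mem_Icc.2 hα.2.le)]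
      congr 1
      rw [← setIntegral_Ioo_eq h, ← setIntegral_Ioo_eq h]
      exact setIntegral_congr_fun measurableSet_Ioo fun t ht => (hbr t ht.1.le).symm
  · intro k hk l r hal hlr hrb
    exact approx_of_primitive_chain (mul_nonneg hB hM) hGM hGi hGc hal hlr hrb k 0 (by omega)

/-! ### Stability of the interface problem, uniformly in the interface position. -/

/-- Gronwall's inequality in integral form. The differential form is applied to the primitive of N,
since N is only continuous. -/
theorem le_mul_exp_of_le_integral {N : ℝ → ℝ} {a b R L : ℝ} (hab : a ≤ b) (hR : 0 ≤ R)
    (hL : 0 ≤ L) (hN : ContinuousOn N (Icc a b)) (hN0 : ∀ x ∈ Icc a b, 0 ≤ N x)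
    (h : ∀ x ∈ Icc a b, N x ≤ R + L * ∫ t in a..x, N t) :
    ∀ x ∈ Icc a b, N x ≤ R * Real.exp (L * (b - a)) := by
  intro x hx
  have hNi : IntervalIntegrable N volume a b := by
    rw [← uIcc_of_le hab] at hN; exact hN.intervalIntegrable
  have hGc : ContinuousOn (fun x => ∫ t in a..x, N t) (Icc a b) := by
    have := intervalIntegral.continuousOn_primitive_interval' hNi left_mem_uIcc
    rwa [uIcc_of_le hab] at this
  have hnn : ∀ x ∈ Icc a b, 0 ≤ ∫ t in a..x, N t := fun x hx =>
    intervalIntegral.integral_nonneg hx.1 fun t ht => hN0 t ⟨ht.1, ht.2.trans hx.2⟩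
  have hd : ∀ x ∈ Ico a b, HasDerivWithinAt (fun x => ∫ t in a..x, N t) (N x) (Ici x) x := by
    intro x hx
    have hxI : x ∈ Icc a b := Ico_subset_Icc_self hx
    have hn : Icc a b ∈ 𝓝[>] x :=
      mem_of_superset (Icc_mem_nhdsGT hx.2) (Icc_subset_Icc_left hx.1)
    refine intervalIntegral.integral_hasDerivWithinAt_right (t := Ioi x) ?_ ?_ ?_
    · exact hNi.mono_set (by
        rw [uIcc_of_le hx.1, uIcc_of_le hab]; exact Icc_subset_Icc_right hx.2.le)
    · exact ⟨Icc a b, hn, hN.aestronglyMeasurable measurableSet_Icc⟩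
    · exact (hN x hxI).mono_of_mem_nhdsWithin hn
  have hg := norm_le_gronwallBound_of_norm_deriv_right_le (δ := 0) (K := L) (ε := R) hGc hd
    (by simp) (fun y hy => by
      have hyI := Ico_subset_Icc_self hy
      rw [Real.norm_of_nonneg (hN0 y hyI), Real.norm_of_nonneg (hnn y hyI)]
      linarith [h y hyI]) x hx
  rw [Real.norm_of_nonneg (hnn x hx)] at hg
  have h1 : R + L * gronwallBound 0 L R (x - a) = R * Real.exp (L * (x - a)) := by
    by_cases hL0 : L = 0
    · simp [hL0]
    · rw [gronwallBound_of_K_ne_0 hL0]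
      field_simp; ring
  calc N x ≤ R + L * ∫ t in a..x, N t := h x hx
    _ ≤ R + L * gronwallBound 0 L R (x - a) := by gcongr
    _ = R * Real.exp (L * (x - a)) := h1
    _ ≤ R * Real.exp (L * (b - a)) := by gcongr; exact hx.2

section Fundamental

/-- The matrix of the first order system for `(v, β v')` with the constant coefficient `β`. -/
def systemMatrix (γ c β : ℝ) : ℝ × ℝ →L[ℝ] ℝ × ℝ :=
  ((β⁻¹) • ContinuousLinearMap.snd ℝ ℝ ℝ).prod
    ((γ * β⁻¹) • ContinuousLinearMap.snd ℝ ℝ ℝ + c • ContinuousLinearMap.fst ℝ ℝ ℝ)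

/-- The solution of the homogeneous equation with `v(a) = 0` and `β v'(a) = 1` left of the
interface. -/
def leftSol (a βm γ c x : ℝ) : ℝ × ℝ :=
  NormedSpace.exp ((x - a) • systemMatrix γ c βm) (0, 1)

/-- The solution of the homogeneous equation right of the interface. -/
def rightSol (a βm βp γ c α x : ℝ) : ℝ × ℝ :=
  NormedSpace.exp ((x - α) • systemMatrix γ c βp) (leftSol a βm γ c α)

/-- The solution of the homogeneous interface equation with `v(a) = 0` and `β v'(a) = 1`, together
with its flux. -/
def fundSol (a βm βp γ c α x : ℝ) : ℝ × ℝ :=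
  if x ≤ α then leftSol a βm γ c x else rightSol a βm βp γ c α x

variable (a b βm βp γ c α : ℝ)

theorem hasDerivAt_exp_smul_apply (A : ℝ × ℝ →L[ℝ] ℝ × ℝ) (v : ℝ × ℝ) (s x : ℝ) :
    HasDerivAt (fun x => NormedSpace.exp ((x - s) • A) v)
      (A (NormedSpace.exp ((x - s) • A) v)) x := by
  have h1 := hasDerivAt_exp_smul_const' (𝕂 := ℝ) A (x - s)
  have h2 := h1.scomp x ((hasDerivAt_id' x).sub_const s)
  have h3 := ((ContinuousLinearMap.apply ℝ (ℝ × ℝ) v).hasFDerivAt.comp_hasDerivAt x h2)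
  exact h3.congr_deriv (by simp)

theorem continuous_leftSol : Continuous (leftSol a βm γ c) := by
  unfold leftSol
  exact continuous_iff_continuousAt.2 fun x => (hasDerivAt_exp_smul_apply _ _ _ x).continuousAt

/-- Continuity jointly in the interface position and the variable is what the compactness arguments
over α rest on. -/
theorem continuous_rightSol :
    Continuous fun q : ℝ × ℝ => rightSol a βm βp γ c q.1 q.2 := by
  unfold rightSol
  have h1 : Continuous fun q : ℝ × ℝ => (q.2 - q.1) • systemMatrix γ c βp := by fun_prop
  let _ : NormedAlgebra ℚ (ℝ × ℝ →L[ℝ] ℝ × ℝ) := NormedAlgebra.restrictScalars ℚ ℝ _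
  exact (NormedSpace.exp_continuous.comp h1).clm_apply
    ((continuous_leftSol a βm γ c).comp continuous_fst)

theorem rightSol_self : rightSol a βm βp γ c α α = leftSol a βm γ c α := by
  simp [rightSol]

theorem continuous_fundSol : Continuous (fundSol a βm βp γ c α) := by
  unfold fundSol
  refine Continuous.if_le (continuous_leftSol a βm γ c)
    ((continuous_rightSol a βm βp γ c).comp (continuous_const.prodMk continuous_id))
    continuous_id continuous_const fun x hx => ?_
  rw [hx]; exact (rightSol_self a βm βp γ c α).symm

theorem fundSol_start {α : ℝ} (hα : a ≤ α) : fundSol a βm βp γ c α a = (0, 1) := by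
  rw [fundSol, if_pos hα]; simp [leftSol]

theorem fundSol_end {α b : ℝ} (hα : α ≤ b) :
    fundSol a βm βp γ c α b = rightSol a βm βp γ c α b := by
  rw [fundSol]
  split_ifs with h
  · rw [le_antisymm h hα, rightSol_self]
  · rfl

theorem hasDerivAt_fundSol {α x : ℝ} (hx : x ≠ α) :
    HasDerivAt (fun x => (fundSol a βm βp γ c α x).1)
      ((fundSol a βm βp γ c α x).2 / beta α βm βp x) x ∧
    HasDerivAt (fun x => (fundSol a βm βp γ c α x).2)
      (γ * ((fundSol a βm βp γ c α x).2 / beta α βm βp x) + c * (fundSol a βm βp γ c α x).1) x := by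
  have key : HasDerivAt (fundSol a βm βp γ c α)
      (systemMatrix γ c (beta α βm βp x) (fundSol a βm βp γ c α x)) x := by
    rcases lt_or_gt_of_ne hx with h | h
    · rw [beta, if_pos h, fundSol, if_pos h.le]
      refine (hasDerivAt_exp_smul_apply _ _ a x).congr_of_eventuallyEq ?_
      filter_upwards [Iio_mem_nhds h] with y hy
      rw [fundSol, if_pos (le_of_lt hy), leftSol]
    · rw [beta, if_neg (not_lt.2 h.le), fundSol, if_neg (not_le.2 h)]
      refine (hasDerivAt_exp_smul_apply _ _ α x).congr_of_eventuallyEq ?_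
      filter_upwards [Ioi_mem_nhds h] with y hy
      rw [fundSol, if_neg (not_le.2 hy), rightSol]
  constructor
  · refine ((ContinuousLinearMap.fst ℝ ℝ ℝ).hasFDerivAt.comp_hasDerivAt x key).congr_deriv ?_
    simp [systemMatrix, div_eq_inv_mul]
  · refine ((ContinuousLinearMap.snd ℝ ℝ ℝ).hasFDerivAt.comp_hasDerivAt x key).congr_deriv ?_
    simp [systemMatrix, div_eq_inv_mul, mul_assoc]

/-- Otherwise the fundamental solution would solve the homogeneous boundary value problem and
vanish, and so would its flux, whose value at a is 1. -/
theorem fundSol_end_ne_zero {a b βm βp γ c α : ℝ} (hab : a < b) (hβm : 0 < βm) (hβp : 0 < βp)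
    (hα : α ∈ Icc a b)
    (hun : HasUniqueSolutions a b α βm βp γ c) : (fundSol a βm βp γ c α b).1 ≠ 0 := by
  intro h0
  have hc := continuous_fundSol a βm βp γ c α
  have hz := hun (fun x => (fundSol a βm βp γ c α x).1) (fun x => (fundSol a βm βp γ c α x).2)
    hc.fst.continuousOn hc.snd.continuousOn (by simp [fundSol_start a βm βp γ c hα.1]) h0
    (fun x _ hx => hasDerivAt_fundSol a βm βp γ c hx)
  have hz2 : ∀ x ∈ Ioo a b, x ≠ α → (fundSol a βm βp γ c α x).2 = 0 := by
    intro x hx hxα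
    have h1 := (hasDerivAt_fundSol a βm βp γ c hxα).1
    have h2 : HasDerivAt (fun x => (fundSol a βm βp γ c α x).1) 0 x := by
      refine (hasDerivAt_const x (0 : ℝ)).congr_of_eventuallyEq ?_
      filter_upwards [Icc_mem_nhds hx.1 hx.2] with y hy using hz y hy
    have h3 := h1.unique h2
    have hb : beta α βm βp x ≠ 0 := by
      rw [beta]; split_ifs
      · exact hβm.ne'
      · exact hβp.ne'
    exact (div_eq_zero_iff.1 h3).resolve_right hb
  have hone : (fundSol a βm βp γ c α a).2 = 1 := by rw [fundSol_start a βm βp γ c hα.1]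
  have hlim : Tendsto (fun x => (fundSol a βm βp γ c α x).2) (𝓝[>] a) (𝓝 1) := by
    rw [← hone]; exact hc.snd.continuousAt.tendsto.mono_left nhdsWithin_le_nhds
  have hlim0 : Tendsto (fun x => (fundSol a βm βp γ c α x).2) (𝓝[>] a) (𝓝 0) := by
    refine tendsto_const_nhds.congr' ?_
    -- The interface may sit at a; approaching a from the right avoids it in either case.
    have hne : ∀ᶠ x in 𝓝[>] a, x ≠ α := by
      rcases hα.1.lt_or_eq with h | h
      · filter_upwards [Ioo_mem_nhdsGT h] with x hx using hx.2.ne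
      · filter_upwards [self_mem_nhdsWithin] with x hx using fun h' =>
          (ne_of_gt hx) (h'.trans h.symm)
    filter_upwards [Ioo_mem_nhdsGT hab, hne] with x hx hxα using (hz2 x hx hxα).symm
  exact one_ne_zero (tendsto_nhds_unique hlim hlim0)

theorem exists_abs_fundSol_le :
    ∃ Y : ℝ, 0 ≤ Y ∧ ∀ α ∈ Icc a b, ∀ x ∈ Icc a b, |(fundSol a βm βp γ c α x).1| ≤ Y := by
  obtain ⟨Y₁, h1⟩ := (isCompact_Icc (a := a) (b := b)).exists_bound_of_continuousOn
    (continuous_leftSol a βm γ c).continuousOn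
  obtain ⟨Y₂, h2⟩ := ((isCompact_Icc (a := a) (b := b)).prod
    (isCompact_Icc (a := a) (b := b))).exists_bound_of_continuousOn
    (continuous_rightSol a βm βp γ c).continuousOn
  refine ⟨max (max Y₁ Y₂) 0, le_max_right _ _, fun α hα x hx => ?_⟩
  refine le_trans ?_ (le_max_left _ _)
  rw [fundSol]
  split_ifs
  · exact ((norm_fst_le _).trans (h1 x hx)).trans (le_max_left _ _)
  · exact ((norm_fst_le _).trans (h2 (α, x) ⟨hα, hx⟩)).trans (le_max_right _ _)

end Fundamental

theorem boundedWeight_beta {βm βp : ℝ} (hβm : 0 < βm) (hβp : 0 < βp) (α : ℝ) :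
    BoundedWeight (min βm⁻¹ βp⁻¹) (max βm⁻¹ βp⁻¹) fun x => (beta α βm βp x)⁻¹ where
  meas := by
    unfold beta
    exact (Measurable.ite measurableSet_Iio measurable_const measurable_const).inv
  pos := lt_min (inv_pos.2 hβm) (inv_pos.2 hβp)
  lower x := by
    unfold beta; split_ifs
    · exact min_le_left _ _
    · exact min_le_right _ _
  upper x := by
    unfold beta; split_ifs
    · exact le_max_left _ _
    · exact le_max_right _ _

/-- Stability of the interface problem in integrated form, uniformly in the interface position. -/
theorem exists_stability {a b βm βp γ c : ℝ} (hab : a < b) (hβm : 0 < βm) (hβp : 0 < βp)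
    {A : Set ℝ} (hAclosed : IsClosed A) (hAsub : A ⊆ Icc a b)
    (hA : ∀ α ∈ A, HasUniqueSolutions a b α βm βp γ c) :
    ∃ S : ℝ, 0 < S ∧ ∀ α ∈ A, ∀ (θ r : ℝ → ℝ) (κ R : ℝ), 0 ≤ R →
      ContinuousOn θ (Icc a b) → θ b = 0 →
      (∀ x ∈ Icc a b, θ x = (∫ t in a..x, (beta α βm βp t)⁻¹ *
        (γ * θ t + c * (∫ y in a..t, θ y) + κ)) + r x) →
      (∀ x ∈ Icc a b, |r x| ≤ R) → |κ| ≤ S * R ∧ ∀ x ∈ Icc a b, |θ x| ≤ S * R := by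
  obtain ⟨Y, hY0, hY⟩ := exists_abs_fundSol_le a b βm βp γ c
  have hAc : IsCompact A := isCompact_Icc.of_isClosed_subset hAclosed hAsub
  -- The end value depends continuously on α and vanishes nowhere on the compact set A. Including α
  -- = a and α = b in the uniqueness hypothesis makes this work when A contains them.
  obtain ⟨δ, hδ, hδA⟩ : ∃ δ : ℝ, 0 < δ ∧ ∀ α ∈ A, δ ≤ |(fundSol a βm βp γ c α b).1| := by
    rcases A.eq_empty_or_nonempty with rfl | hne
    · exact ⟨1, one_pos, fun α h => absurd h (notMem_empty α)⟩
    have hcont : ContinuousOn (fun α => |(rightSol a βm βp γ c α b).1|) A :=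
      ((continuous_rightSol a βm βp γ c).comp
        (continuous_id.prodMk continuous_const)).fst.abs.continuousOn
    obtain ⟨α₀, h0, hmin⟩ := hAc.exists_isMinOn hne hcont
    refine ⟨|(rightSol a βm βp γ c α₀ b).1|, ?_, fun α hα => ?_⟩
    · rw [← fundSol_end a βm βp γ c (hAsub h0).2]
      exact abs_pos.2 (fundSol_end_ne_zero hab hβm hβp (hAsub h0) (hA α₀ h0))
    · rw [fundSol_end a βm βp γ c (hAsub hα).2]; exact hmin hα
  set m' := max βm⁻¹ βp⁻¹ with hm'
  have hm'0 : 0 < m' := lt_max_of_lt_left (inv_pos.2 hβm)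
  set L := m' * (|γ| + |c| * (b - a)) with hL
  have hba : 0 < b - a := sub_pos.2 hab
  have hL0 : 0 ≤ L := by positivity
  set E := Real.exp (L * (b - a)) with hE
  have hE0 : 0 < E := Real.exp_pos _
  refine ⟨E / δ + (E / δ * Y + E), by positivity, fun α hα θ r κ R hR hθ hθb heq hr => ?_⟩
  have hαI := hAsub hα
  have hw := boundedWeight_beta hβm hβp α
  set w : ℝ → ℝ := fun x => (beta α βm βp x)⁻¹ with hwdef
  set y : ℝ → ℝ := fun x => (fundSol a βm βp γ c α x).1 with hy
  set z : ℝ → ℝ := fun x => (fundSol a βm βp γ c α x).2 with hz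
  have hyc : Continuous y := (continuous_fundSol a βm βp γ c α).fst
  have hzc : Continuous z := (continuous_fundSol a βm βp γ c α).snd
  have hya : y a = 0 := by simp [hy, fundSol_start a βm βp γ c hαI.1]
  have hza : z a = 1 := by simp [hz, fundSol_start a βm βp γ c hαI.1]
  have hyint : ∀ x ∈ Icc a b, y x = ∫ t in a..x, w t * z t := by
    intro x hx
    have h := integral_eq_of_hasDerivAt_off_countable
      (a := a) (b := x) y (fun t => w t * z t)
      (countable_singleton α) hyc.continuousOn (fun t ht => by
        have := (hasDerivAt_fundSol a βm βp γ c (α := α) ht.2).1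
        rwa [div_eq_inv_mul] at this)
      (hw.intervalIntegrable_mul (hzc.intervalIntegrable _ _))
    rw [h, hya, sub_zero]
  have hzint : ∀ x ∈ Icc a b, z x = γ * y x + c * (∫ t in a..x, y t) + 1 := by
    intro x hx
    have h := integral_eq_of_hasDerivAt_off_countable
      (a := a) (b := x) (fun t => z t - γ * y t) (fun t => c * y t)
      (countable_singleton α) (hzc.sub (hyc.const_mul γ)).continuousOn (fun t ht => by
        have h1 := hasDerivAt_fundSol a βm βp γ c (α := α) ht.2
        refine (h1.2.sub (h1.1.const_mul γ)).congr_deriv ?_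
        simp [hy])
      ((hyc.const_mul c).intervalIntegrable _ _)
    rw [intervalIntegral.integral_const_mul] at h
    rw [hya, hza] at h
    linarith
  -- The fundamental solution y satisfies the integrated equation with constant 1 and no residual,
  -- so subtracting κy removes the unknown constant and leaves an equation to which Gronwall
  -- applies.
  set ζ : ℝ → ℝ := fun x => θ x - κ * y x with hζ
  have hζc : ContinuousOn ζ (Icc a b) := hθ.sub (hyc.const_mul κ).continuousOn
  have hsub : ∀ x ∈ Icc a b, uIcc a x ⊆ Icc a b := fun x hx => by
    rw [uIcc_of_le hx.1]; exact Icc_subset_Icc_right hx.2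
  have hprim : ∀ f : ℝ → ℝ, ContinuousOn f (Icc a b) →
      ContinuousOn (fun x => ∫ t in a..x, f t) (Icc a b) := fun f hf => by
    rw [← uIcc_of_le hab.le] at hf ⊢
    exact intervalIntegral.continuousOn_primitive_interval' hf.intervalIntegrable left_mem_uIcc
  have hζeq : ∀ x ∈ Icc a b,
      ζ x = (∫ t in a..x, w t * (γ * ζ t + c * ∫ s in a..t, ζ s)) + r x := by
    intro x hx
    have hθi : ContinuousOn (fun t => γ * θ t + c * (∫ y in a..t, θ y) + κ) (uIcc a x) :=
      ((hθ.const_smul γ).add ((hprim θ hθ).const_smul c) |>.add continuousOn_const).mono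
        (hsub x hx)
    have e : ∫ t in a..x, w t * (γ * ζ t + c * ∫ s in a..t, ζ s) =
        ∫ t in a..x, (w t * (γ * θ t + c * (∫ y in a..t, θ y) + κ) - κ * (w t * z t)) := by
      refine intervalIntegral.integral_congr fun t ht => ?_
      have htI := hsub x hx ht
      have h1 : ∫ s in a..t, ζ s = (∫ s in a..t, θ s) - κ * ∫ s in a..t, y s := by
        rw [hζ, intervalIntegral.integral_sub ((hθ.mono (hsub t htI)).intervalIntegrable)
          ((hyc.const_mul κ).intervalIntegrable _ _), intervalIntegral.integral_const_mul]
      rw [h1, hzint t htI]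
      simp only [hζ]
      ring
    rw [e, intervalIntegral.integral_sub (hw.intervalIntegrable_mul hθi.intervalIntegrable)
      ((hw.intervalIntegrable_mul (hzc.intervalIntegrable _ _)).const_mul κ),
      intervalIntegral.integral_const_mul, ← hyint x hx]
    simp only [hζ]
    linarith [heq x hx]
  have hζN : ∀ x ∈ Icc a b, |ζ x| ≤ R + L * ∫ t in a..x, |ζ t| := by
    intro x hx
    have hii : ∀ t ∈ Icc a b, IntervalIntegrable (fun s => |ζ s|) volume a t := fun t ht =>
      (hζc.abs.mono (hsub t ht)).intervalIntegrable
    have hB : |∫ t in a..x, w t * (γ * ζ t + c * ∫ s in a..t, ζ s)| ≤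
        ∫ t in a..x, m' * (|γ| * |ζ t| + |c| * ∫ s in a..x, |ζ s|) := by
      have := intervalIntegral.norm_integral_le_of_norm_le (a := a) (b := x) hx.1
        (f := fun t => w t * (γ * ζ t + c * ∫ s in a..t, ζ s))
        (g := fun t => m' * (|γ| * |ζ t| + |c| * ∫ s in a..x, |ζ s|))
        (Eventually.of_forall fun t ht => by
          have htI : t ∈ Icc a b := ⟨ht.1.le, ht.2.trans hx.2⟩
          rw [Real.norm_eq_abs, abs_mul]
          refine mul_le_mul (hw.abs_le t) ?_ (abs_nonneg _) hm'0.le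
          refine (abs_add_le _ _).trans ?_
          rw [abs_mul, abs_mul]
          gcongr
          refine (intervalIntegral.abs_integral_le_integral_abs ht.1.le).trans ?_
          refine intervalIntegral.integral_mono_interval le_rfl ht.1.le ht.2 ?_ (hii x hx)
          exact Eventually.of_forall fun _ => abs_nonneg _)
        ((((hii x hx).const_mul _).add intervalIntegrable_const).const_mul _)
      exact this
    rw [intervalIntegral.integral_const_mul, intervalIntegral.integral_add
      ((hii x hx).const_mul _) intervalIntegrable_const, intervalIntegral.integral_const_mul,
      intervalIntegral.integral_const, smul_eq_mul] at hB
    have hJ : 0 ≤ ∫ t in a..x, |ζ t| :=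
      intervalIntegral.integral_nonneg hx.1 fun _ _ => abs_nonneg _
    set J := ∫ t in a..x, |ζ t|
    calc |ζ x| ≤ |∫ t in a..x, w t * (γ * ζ t + c * ∫ s in a..t, ζ s)| + |r x| := by
          rw [hζeq x hx]; exact abs_add_le _ _
      _ ≤ m' * (|γ| * J + (x - a) * (|c| * J)) + R := add_le_add hB (hr x hx)
      _ ≤ m' * (|γ| * J + (b - a) * (|c| * J)) + R := by gcongr; exact hx.2
      _ = R + L * J := by rw [hL]; ring
  have hζle := le_mul_exp_of_le_integral hab.le hR hL0 hζc.abs (fun _ _ => abs_nonneg _) hζN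
  -- Since θ(b) = 0, the bound for ζ at b is a bound for κy(b), and |y(b)| is at least δ.
  have hκ : |κ| ≤ E / δ * R := by
    have hb := hζle b (right_mem_Icc.2 hab.le)
    simp only [hζ, hθb, zero_sub, abs_neg, abs_mul] at hb
    have h1 : |κ| * δ ≤ R * E := (mul_le_mul_of_nonneg_left (hδA α hα) (abs_nonneg κ)).trans hb
    calc |κ| = |κ| * δ / δ := by field_simp
      _ ≤ R * E / δ := by gcongr
      _ = _ := by ring
  refine ⟨hκ.trans ?_, fun x hx => ?_⟩
  · have : 0 ≤ (E / δ * Y + E) * R := by positivity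
    nlinarith
  · have h1 : θ x = κ * y x + ζ x := by simp only [hζ]; ring
    have h2 : |κ * y x| ≤ E / δ * R * Y := by
      rw [abs_mul]
      exact mul_le_mul hκ (hY α hαI x hx) (abs_nonneg _) (by positivity)
    have h3 : 0 ≤ E / δ * R := by positivity
    calc |θ x| ≤ |κ * y x| + |ζ x| := by rw [h1]; exact abs_add_le _ _
      _ ≤ E / δ * R * Y + R * E := add_le_add h2 (hζle x hx)
      _ ≤ (E / δ + (E / δ * Y + E)) * R := by linarith

/-! ### Mesh geometry and the local basis functions. -/

namespace Mesh

variable {a b α : ℝ} (T : Mesh a b α)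

theorem x_le_x {i j : ℕ} (hij : i ≤ j) (hj : j ≤ T.N) : T.x i ≤ T.x j := by
  induction j, hij using Nat.le_induction with
  | base => exact le_rfl
  | succ j hij ih => exact (ih (by omega)).trans (T.lt_succ j (by omega)).le

theorem x_mem {i : ℕ} (hi : i ≤ T.N) : T.x i ∈ Icc a b := by
  constructor
  · exact T.x_zero.symm.trans_le (T.x_le_x (Nat.zero_le i) hi)
  · exact (T.x_le_x hi le_rfl).trans_eq T.x_last

theorem elem_subset {i : ℕ} (hi : i < T.N) : T.elem i ⊆ Icc a b := fun _ hy =>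
  ⟨(T.x_mem hi.le).1.trans hy.1, hy.2.trans (T.x_mem (i := i + 1) hi).2⟩

theorem len_pos {i : ℕ} (hi : i < T.N) : 0 < T.len i := sub_pos.2 (T.lt_succ i hi)

theorem len_le_size {i : ℕ} (hi : i < T.N) : T.len i ≤ T.size :=
  Finset.le_sup' T.len (Finset.mem_range.2 hi)

theorem exists_mem_elem {y : ℝ} (hy : y ∈ Icc a b) : ∃ i < T.N, y ∈ T.elem i := by
  have key : ∀ n ≤ T.N, 0 < n → y ≤ T.x n → ∃ i < T.N, y ∈ T.elem i := by
    intro n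
    induction n with
    | zero => intro _ h; omega
    | succ n ih =>
      intro hn _ hyn
      rcases le_total (T.x n) y with h | h
      · exact ⟨n, hn, h, hyn⟩
      · rcases Nat.eq_zero_or_pos n with rfl | hpos
        · exact ⟨0, hn, by rw [T.x_zero]; exact hy.1, hyn⟩
        · exact ih (by omega) hpos h
  exact key T.N le_rfl (Nat.zero_lt_of_lt T.k_lt) (by rw [T.x_last]; exact hy.2)

theorem le_or_le_of_ne {i : ℕ} (hi : i < T.N) (hik : i ≠ T.k) : T.x (i + 1) < α ∨ α < T.x i := by
  rcases lt_or_gt_of_ne hik with h | h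
  · exact Or.inl ((T.x_le_x h T.k_lt.le).trans_lt T.left_lt)
  · exact Or.inr (T.lt_right.trans_le (T.x_le_x h hi.le))

theorem beta_eq_of_ne (βm βp : ℝ) {i : ℕ} (hi : i < T.N) (hik : i ≠ T.k) :
    ∃ β₀, (β₀ = βm ∨ β₀ = βp) ∧ ∀ y ∈ T.elem i, beta α βm βp y = β₀ := by
  rcases T.le_or_le_of_ne hi hik with h | h
  · exact ⟨βm, Or.inl rfl, fun y hy => if_pos (hy.2.trans_lt h)⟩
  · exact ⟨βp, Or.inr rfl, fun y hy => if_neg (not_lt.2 (h.le.trans hy.1))⟩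

theorem toRef_eq (i : ℕ) (y : ℝ) :
    T.toRef i y = 2 / T.len i * y - (T.x i + T.x (i + 1)) / T.len i := by
  unfold toRef; ring

theorem toRef_left {i : ℕ} (hi : i < T.N) : T.toRef i (T.x i) = -1 := by
  have := (T.len_pos hi).ne'
  unfold toRef; rw [div_eq_iff this]; unfold len; ring

theorem toRef_right {i : ℕ} (hi : i < T.N) : T.toRef i (T.x (i + 1)) = 1 := by
  have := (T.len_pos hi).ne'
  unfold toRef; rw [div_eq_iff this]; unfold len; ring

theorem beta_toRef (βm βp : ℝ) {i : ℕ} (hi : i < T.N) (y : ℝ) :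
    beta (T.toRef i α) βm βp (T.toRef i y) = beta α βm βp y := by
  have h : T.toRef i y < T.toRef i α ↔ y < α := by
    unfold toRef
    rw [div_lt_div_iff_of_pos_right (T.len_pos hi)]
    constructor <;> intro h <;> linarith
  unfold beta
  simp only [h]

theorem integral_comp_toRef {i : ℕ} (hi : i < T.N) (F : ℝ → ℝ) (y : ℝ) :
    ∫ t in (T.x i)..y, F (T.toRef i t) = T.len i / 2 * ∫ ξ in (-1 : ℝ)..(T.toRef i y), F ξ := by
  have hne : 2 / T.len i ≠ 0 := div_ne_zero two_ne_zero (T.len_pos hi).ne'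
  have := intervalIntegral.integral_comp_mul_sub (a := T.x i) (b := y) F hne
    ((T.x i + T.x (i + 1)) / T.len i)
  simp only [← T.toRef_eq, T.toRef_left hi] at this
  rw [this, smul_eq_mul, inv_div]

/-- The orthogonal polynomials on the `i`-th element, in the physical variable. -/
def orthoOn (βm βp : ℝ) (i n : ℕ) : ℝ[X] :=
  (orthoPoly (refWeight (T.toRef i α) βm βp) n).comp
    (C (2 / T.len i) * X + C (-((T.x i + T.x (i + 1)) / T.len i)))

theorem eval_orthoOn (βm βp : ℝ) (i n : ℕ) (y : ℝ) : (T.orthoOn βm βp i n).eval y =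
    (orthoPoly (refWeight (T.toRef i α) βm βp) n).eval (T.toRef i y) := by
  rw [orthoOn, eval_comp]
  congr 1
  rw [T.toRef_eq i y]
  simp [sub_eq_add_neg]

theorem degree_comp_affine {P : ℝ[X]} {s t : ℝ} (hs : s ≠ 0) :
    (P.comp (C s * X + C t)).degree = P.degree := by
  by_cases hP : P = 0
  · simp [hP]
  have h1 : (C s * X + C t).natDegree = 1 := natDegree_linear hs
  have h2 : P.comp (C s * X + C t) ≠ 0 := by
    intro h
    rcases comp_eq_zero_iff.1 h with h | ⟨-, h⟩
    · exact hP h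
    · have := congrArg natDegree h
      rw [h1, natDegree_C] at this
      exact one_ne_zero this
  rw [degree_eq_natDegree hP, degree_eq_natDegree h2, natDegree_comp, h1, mul_one]

theorem degree_orthoOn (βm βp : ℝ) {i : ℕ} (hi : i < T.N) (n : ℕ) :
    (T.orthoOn βm βp i n).degree = n := by
  rw [orthoOn, degree_comp_affine (div_ne_zero two_ne_zero (T.len_pos hi).ne'), degree_orthoPoly]

variable {βm βp : ℝ}

theorem boundedWeight_refWeight (hβm : 0 < βm) (hβp : 0 < βp) (s : ℝ) :
    BoundedWeight (min βm⁻¹ βp⁻¹) (max βm⁻¹ βp⁻¹) (refWeight s βm βp) := by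
  have : refWeight s βm βp = fun x => (beta s βm βp x)⁻¹ := by
    ext x; rw [refWeight, one_div]
  rw [this]; exact boundedWeight_beta hβm hβp s

/-- Test polynomials are pulled back to [-1, 1] with unchanged degree. Ordinary and interface
elements are covered alike, with the same bounds on the weight. -/
theorem gaussElement (hβm : 0 < βm) (hβp : 0 < βp) {i : ℕ} (hi : i < T.N) (n : ℕ) :
    GaussElement (min βm⁻¹ βp⁻¹) (max βm⁻¹ βp⁻¹) (fun x => (beta α βm βp x)⁻¹)
      (T.x i) (T.x (i + 1)) n (T.orthoOn βm βp i n) where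
  weight := boundedWeight_beta hβm hβp α
  lt := T.lt_succ i hi
  deg := T.degree_orthoOn βm βp hi n
  orth := by
    intro R hR
    have hlen := (T.len_pos hi).ne'
    set R' : ℝ[X] := R.comp (C (T.len i / 2) * X + C ((T.x i + T.x (i + 1)) / 2)) with hR'
    have hR'd : R'.degree < n := by
      rw [hR', degree_comp_affine (div_ne_zero hlen two_ne_zero)]; exact hR
    have hR'e : ∀ y, R.eval y = R'.eval (T.toRef i y) := fun y => by
      rw [hR', eval_comp, toRef]
      congr 1
      simp only [eval_add, eval_mul, eval_C, eval_X]
      field_simp; ring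
    have h := orthBelow_orthoPoly (boundedWeight_refWeight hβm hβp (T.toRef i α)) n R' hR'd
    have h2 := T.integral_comp_toRef hi (fun ξ => refWeight (T.toRef i α) βm βp ξ *
      ((orthoPoly (refWeight (T.toRef i α) βm βp) n).eval ξ * R'.eval ξ)) (T.x (i + 1))
    rw [T.toRef_right hi, h, mul_zero] at h2
    rw [← h2]
    congr 1; ext y
    beta_reduce
    rw [T.eval_orthoOn, hR'e, refWeight, T.beta_toRef _ _ hi, one_div]

theorem legendre_eq (n : ℕ) : ∃ κ : ℝ, κ ≠ 0 ∧ legendre n = C κ * orthoPoly (fun _ => 1) n := by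
  have hw : BoundedWeight 1 1 (fun _ => (1 : ℝ)) :=
    ⟨measurable_const, one_pos, fun _ => le_rfl, fun _ => le_rfl⟩
  refine ⟨_, ?_, rfl⟩
  have := wInner_self_pos hw (orthoPoly_ne_zero (fun _ => 1) n)
  exact (Real.sqrt_pos.2 (by positivity)).ne'

/-- Off the interface element the image of α lies outside [-1, 1], so the reference weight is
constant there. -/
theorem orthoPoly_refWeight_of_ne (hβm : 0 < βm) (hβp : 0 < βp) {i : ℕ} (hi : i < T.N)
    (hik : i ≠ T.k) (n : ℕ) :
    orthoPoly (refWeight (T.toRef i α) βm βp) n = orthoPoly (fun _ => 1) n := by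
  obtain ⟨β₀, hβ₀, h⟩ := T.beta_eq_of_ne βm βp hi hik
  have hβ₀' : β₀ ≠ 0 := by rcases hβ₀ with rfl | rfl; exacts [hβm.ne', hβp.ne']
  refine orthoPoly_congr (k := β₀⁻¹) (inv_ne_zero hβ₀') (fun ξ hξ => ?_) n
  have hlen := T.len_pos hi
  have he : T.toRef i (T.len i / 2 * ξ + (T.x i + T.x (i + 1)) / 2) = ξ := by
    unfold toRef; field_simp; ring
  have h1 := T.beta_toRef βm βp hi (T.len i / 2 * ξ + (T.x i + T.x (i + 1)) / 2)
  rw [he] at h1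
  rw [refWeight, h1, h, one_div, mul_one]
  constructor
  · have : T.len i = T.x (i + 1) - T.x i := rfl
    nlinarith [hξ.1]
  · have : T.len i = T.x (i + 1) - T.x i := rfl
    nlinarith [hξ.2]

/-- The normalization is immaterial: the Gauss points are the roots of the monic polynomials on all
elements. -/
theorem legendreOn_eq (hβm : 0 < βm) (hβp : 0 < βp) {i : ℕ} (hi : i < T.N) (n : ℕ) :
    ∃ κ : ℝ, κ ≠ 0 ∧ ∀ y, T.legendreOn βm βp i n y = κ * (T.orthoOn βm βp i n).eval y := by
  by_cases hik : i = T.k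
  · refine ⟨1, one_ne_zero, fun y => ?_⟩
    rw [legendreOn, if_pos hik, one_mul, T.eval_orthoOn, genLegendre, refInterface, hik]
  · obtain ⟨κ, hκ, h⟩ := legendre_eq n
    refine ⟨κ, hκ, fun y => ?_⟩
    rw [legendreOn, if_neg hik, h, eval_mul, eval_C, T.eval_orthoOn,
      T.orthoPoly_refWeight_of_ne hβm hβp hi hik]

/-- The local basis functions of order at least two are primitives of the weighted orthogonal
polynomials. -/
theorem basis_eq_integral (hβm : 0 < βm) (hβp : 0 < βp) {i : ℕ} (hi : i < T.N) (n : ℕ) :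
    ∃ κ : ℝ, κ ≠ 0 ∧ ∀ y ∈ T.elem i, T.basis βm βp i (n + 2) y =
      κ * ∫ t in (T.x i)..y, (beta α βm βp t)⁻¹ * (T.orthoOn βm βp i (n + 1)).eval t := by
  have hlen := (T.len_pos hi).ne'
  by_cases hik : i = T.k
  · refine ⟨2 / T.len i, div_ne_zero two_ne_zero hlen, fun y _ => ?_⟩
    have h := T.integral_comp_toRef hi (fun ξ => refWeight (T.toRef i α) βm βp ξ *
      (orthoPoly (refWeight (T.toRef i α) βm βp) (n + 1)).eval ξ) y
    have e : ∀ t, (beta α βm βp t)⁻¹ * (T.orthoOn βm βp i (n + 1)).eval t =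
        refWeight (T.toRef i α) βm βp (T.toRef i t) *
          (orthoPoly (refWeight (T.toRef i α) βm βp) (n + 1)).eval (T.toRef i t) := fun t => by
      rw [T.eval_orthoOn, refWeight, T.beta_toRef _ _ hi, one_div]
    simp_rw [e]
    rw [h, basis, if_pos hik, genLobatto, if_neg (by omega), if_neg (by omega), refInterface,
      ← hik]
    simp only [genLegendre, show n + 2 - 1 = n + 1 by omega]
    field_simp
  · obtain ⟨κ, hκ, hleg⟩ := legendre_eq (n + 1)
    obtain ⟨β₀, hβ₀, hβ⟩ := T.beta_eq_of_ne βm βp hi hik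
    have hβ₀' : β₀ ≠ 0 := by rcases hβ₀ with rfl | rfl; exacts [hβm.ne', hβp.ne']
    -- The classical Lobatto functions carry no weight; the factor β₀ compensates the constant
    -- weight, and 2 over the length is the Jacobian.
    refine ⟨κ * (2 / T.len i) * β₀, by positivity, fun y hy => ?_⟩
    have e : ∫ t in (T.x i)..y, (beta α βm βp t)⁻¹ * (T.orthoOn βm βp i (n + 1)).eval t =
        ∫ t in (T.x i)..y, β₀⁻¹ * (orthoPoly (fun _ => 1) (n + 1)).eval (T.toRef i t) := by
      refine intervalIntegral.integral_congr fun t ht => ?_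
      rw [uIcc_of_le hy.1] at ht
      simp only [hβ t ⟨ht.1, ht.2.trans hy.2⟩, T.eval_orthoOn,
        T.orthoPoly_refWeight_of_ne hβm hβp hi hik]
    rw [e, intervalIntegral.integral_const_mul, T.integral_comp_toRef hi
      (fun ξ => (orthoPoly (fun _ => 1) (n + 1)).eval ξ), basis, if_neg hik, lobatto,
      if_neg (by omega), if_neg (by omega)]
    simp only [show n + 2 - 1 = n + 1 by omega, hleg, eval_mul, eval_C]
    rw [intervalIntegral.integral_const_mul]
    field_simp

theorem integral_inv_beta_left {l y : ℝ} (hly : l ≤ y) (hy : y ≤ α) :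
    ∫ t in l..y, (beta α βm βp t)⁻¹ = (y - l) * βm⁻¹ := by
  rw [← setIntegral_Ioo_eq hly, setIntegral_congr_fun measurableSet_Ioo (g := fun _ => βm⁻¹)
    fun t ht => by simp only [beta, if_pos (ht.2.trans_le hy)]]
  rw [setIntegral_Ioo_eq hly, intervalIntegral.integral_const, smul_eq_mul]

theorem integral_inv_beta_right {l y : ℝ} (hly : l ≤ y) (hl : α ≤ l) :
    ∫ t in l..y, (beta α βm βp t)⁻¹ = (y - l) * βp⁻¹ := by
  rw [← setIntegral_Ioo_eq hly, setIntegral_congr_fun measurableSet_Ioo (g := fun _ => βp⁻¹)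
    fun t ht => by simp only [beta, if_neg (not_lt.2 (hl.trans ht.1.le))]]
  rw [setIntegral_Ioo_eq hly, intervalIntegral.integral_const, smul_eq_mul]

theorem integral_inv_beta_cross (hβm : 0 < βm) (hβp : 0 < βp) {l y : ℝ} (hl : l ≤ α)
    (hy : α ≤ y) : ∫ t in l..y, (beta α βm βp t)⁻¹ = (α - l) * βm⁻¹ + (y - α) * βp⁻¹ := by
  have hw := boundedWeight_beta hβm hβp α
  rw [← intervalIntegral.integral_add_adjacent_intervals (hw.intervalIntegrable l α)
    (hw.intervalIntegrable α y), integral_inv_beta_left hl le_rfl,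
    integral_inv_beta_right hy le_rfl]

/-- The two nodal local basis functions. -/
theorem basis_one_eq (hβm : 0 < βm) (hβp : 0 < βp) {i : ℕ} (hi : i < T.N) {y : ℝ}
    (hy : y ∈ T.elem i) : T.basis βm βp i 1 y =
      (∫ t in (T.x i)..y, (beta α βm βp t)⁻¹) / ∫ t in (T.x i)..(T.x (i + 1)), (beta α βm βp t)⁻¹ ∧
      T.basis βm βp i 0 y = 1 - T.basis βm βp i 1 y := by
  have hlen : 0 < T.len i := T.len_pos hi
  have hlen' : T.len i = T.x (i + 1) - T.x i := rfl
  have hlr := T.lt_succ i hi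
  by_cases hik : i = T.k
  · have hl : T.x i < α := hik ▸ T.left_lt
    have hr : α < T.x (i + 1) := hik ▸ T.lt_right
    have hlt : T.toRef i y < T.toRef i α ↔ y < α := by
      unfold toRef
      rw [div_lt_div_iff_of_pos_right hlen]
      constructor <;> intro h <;> linarith
    have e1 : 1 + T.toRef i y = 2 * (y - T.x i) / T.len i := by
      unfold toRef; rw [hlen']; rw [hlen'] at hlen; field_simp; ring
    have e2 : 1 - T.toRef i y = 2 * (T.x (i + 1) - y) / T.len i := by
      unfold toRef; rw [hlen']; rw [hlen'] at hlen; field_simp; ring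
    have e3 : 1 + T.toRef i α = 2 * (α - T.x i) / T.len i := by
      unfold toRef; rw [hlen']; rw [hlen'] at hlen; field_simp; ring
    have e4 : 1 - T.toRef i α = 2 * (T.x (i + 1) - α) / T.len i := by
      unfold toRef; rw [hlen']; rw [hlen'] at hlen; field_simp; ring
    have e5 : T.toRef i α - T.toRef i y = 2 * (α - y) / T.len i := by
      unfold toRef; field_simp; ring
    have e6 : T.toRef i y - T.toRef i α = 2 * (y - α) / T.len i := by
      unfold toRef; field_simp; ring
    have p1 : 0 < α - T.x i := sub_pos.2 hl
    have p2 : 0 < T.x (i + 1) - α := sub_pos.2 hr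
    have hD : 0 < (T.x (i + 1) - α) * βm + (α - T.x i) * βp := by positivity
    rw [integral_inv_beta_cross hβm hβp hl.le hr.le, basis, basis, if_pos hik, if_pos hik,
      genLobatto, genLobatto, if_neg one_ne_zero, if_pos rfl, if_pos rfl, refInterface, ← hik]
    have hW : (α - T.x i) * βm⁻¹ + (T.x (i + 1) - α) * βp⁻¹ =
        ((T.x (i + 1) - α) * βm + (α - T.x i) * βp) / (βm * βp) := by field_simp; ring
    simp only [hlt, e1, e2, e3, e4, e5, e6]
    have hDD : 2 * (T.x (i + 1) - α) / T.len i * βm + 2 * (α - T.x i) / T.len i * βp =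
        2 / T.len i * ((T.x (i + 1) - α) * βm + (α - T.x i) * βp) := by ring
    rw [hDD, hW]
    set D := (T.x (i + 1) - α) * βm + (α - T.x i) * βp with hDdef
    split_ifs with h
    · rw [integral_inv_beta_left hy.1 h.le]
      constructor
      · field_simp
      · field_simp; rw [hDdef]; ring
    · rw [integral_inv_beta_cross hβm hβp hl.le (not_lt.1 h)]
      constructor
      · field_simp; ring
      · field_simp; rw [hDdef]; ring
  · obtain ⟨β₀, hβ₀, hβ⟩ := T.beta_eq_of_ne βm βp hi hik
    have hβ₀' : β₀ ≠ 0 := by rcases hβ₀ with rfl | rfl; exacts [hβm.ne', hβp.ne']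
    have hint : ∀ z ∈ T.elem i, ∫ t in (T.x i)..z, (beta α βm βp t)⁻¹ = (z - T.x i) * β₀⁻¹ := by
      intro z hz
      rw [intervalIntegral.integral_congr (g := fun _ => β₀⁻¹) fun t ht => ?_,
        intervalIntegral.integral_const, smul_eq_mul]
      rw [uIcc_of_le hz.1] at ht
      simp only [hβ t ⟨ht.1, ht.2.trans hz.2⟩]
    rw [hint y hy, hint _ (right_mem_Icc.2 hlr.le), basis, basis, if_neg hik, if_neg hik, lobatto,
      lobatto, if_neg one_ne_zero, if_pos rfl, if_pos rfl, toRef, ← hlen']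
    constructor
    · rw [hlen']; rw [hlen'] at hlen; field_simp; ring
    · ring

end Mesh

/-! ### Fluxes of trial functions and of the projection. -/

theorem integral_congr_off {f g : ℝ → ℝ} {l r : ℝ} (α : ℝ) (hlr : l ≤ r)
    (h : ∀ x ∈ Ioo l r, x ≠ α → f x = g x) : ∫ x in l..r, f x = ∫ x in l..r, g x := by
  rw [← setIntegral_Ioo_eq hlr, ← setIntegral_Ioo_eq hlr]
  refine setIntegral_congr_ae measurableSet_Ioo ?_
  filter_upwards [(countable_singleton α).ae_notMem volume] with x hx hxm using h x hxm hx

theorem intervalIntegrable_congr_off {f g : ℝ → ℝ} {l r : ℝ} (α : ℝ) (hlr : l ≤ r)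
    (h : ∀ x ∈ Ioo l r, x ≠ α → f x = g x) (hg : IntervalIntegrable g volume l r) :
    IntervalIntegrable f volume l r := by
  rw [intervalIntegrable_iff_integrableOn_Ioo_of_le hlr] at hg ⊢
  refine hg.congr_fun_ae ?_
  rw [EventuallyEq, ae_restrict_iff' measurableSet_Ioo]
  filter_upwards [(countable_singleton α).ae_notMem volume] with x hx hxm using (h x hxm hx).symm

theorem eventually_ne_nhdsNE (α g : ℝ) : ∀ᶠ y in 𝓝[≠] g, y ≠ α := by
  by_cases h : g = α
  · subst h; exact self_mem_nhdsWithin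
  · exact nhdsWithin_le_nhds (isOpen_ne.mem_nhds h)

theorem eventuallyEq_beta {α βm βp x : ℝ} (hx : x ≠ α) :
    ∀ᶠ y in 𝓝 x, beta α βm βp y = beta α βm βp x := by
  rcases lt_or_gt_of_ne hx with h | h
  · filter_upwards [Iio_mem_nhds h] with y hy
    rw [beta, beta, if_pos (show y < α from hy), if_pos h]
  · filter_upwards [Ioi_mem_nhds h] with y hy
    rw [beta, beta, if_neg (not_lt.2 (le_of_lt hy)), if_neg (not_lt.2 h.le)]

theorem hasDerivAt_primitive_beta {α βm βp : ℝ} (hβm : 0 < βm) (hβp : 0 < βp) {P : ℝ → ℝ}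
    (hP : Continuous P) (l : ℝ) {x : ℝ} (hx : x ≠ α) :
    HasDerivAt (fun y => ∫ t in l..y, (beta α βm βp t)⁻¹ * P t) ((beta α βm βp x)⁻¹ * P x) x := by
  have hw := boundedWeight_beta hβm hβp α
  refine intervalIntegral.integral_hasDerivAt_right
    (hw.intervalIntegrable_mul (hP.intervalIntegrable _ _)) ?_ ?_
  · exact (hw.meas.mul hP.measurable).stronglyMeasurable.stronglyMeasurableAtFilter
  · refine ContinuousAt.mul ?_ hP.continuousAt
    refine (continuousAt_const (y := (beta α βm βp x)⁻¹)).congr ?_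
    filter_upwards [eventuallyEq_beta hx] with y hy
    rw [hy]

/-- Only a punctured neighbourhood matters, so a Gauss point that coincides with α needs no separate
treatment. -/
theorem flux_eq {α βm βp : ℝ} {v F : ℝ → ℝ} {g : ℝ}
    (h : ∀ᶠ y in 𝓝[≠] g, beta α βm βp y * deriv v y = F y) (hF : ContinuousAt F g) :
    flux α βm βp v g = F g :=
  Tendsto.limUnder_eq ((hF.tendsto.mono_left nhdsWithin_le_nhds).congr' (h.mono fun _ h => h.symm))

theorem beta_pos {α βm βp : ℝ} (hβm : 0 < βm) (hβp : 0 < βp) (x : ℝ) : 0 < beta α βm βp x := by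
  unfold beta; split_ifs <;> assumption

namespace Mesh

variable {a b α : ℝ} (T : Mesh a b α) {βm βp : ℝ}

/-- The flux of the element of the local trial space with the given coefficients. -/
def fluxPoly (βm βp : ℝ) (i t : ℕ) (k : ℝ) (d : ℕ → ℝ) : ℝ[X] :=
  C k + ∑ j ∈ Finset.range t, C (d j) * T.orthoOn βm βp i (j + 1)

theorem degree_fluxPoly {i : ℕ} (hi : i < T.N) (t : ℕ) (k : ℝ) (d : ℕ → ℝ) :
    (T.fluxPoly βm βp i t k d).degree < (t + 1 : ℕ) := by
  refine (degree_add_le _ _).trans_lt (max_lt (degree_C_le.trans_lt ?_) ?_)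
  · exact_mod_cast Nat.succ_pos t
  · refine mem_degreeLT.1 (Submodule.sum_mem _ fun j hj => mem_degreeLT.2 ?_)
    refine (degree_mul_le _ _).trans_lt ?_
    rw [T.degree_orthoOn βm βp hi]
    have := Finset.mem_range.1 hj
    calc _ ≤ (0 : WithBot ℕ) + ((j + 1 : ℕ) : WithBot ℕ) := add_le_add_left degree_C_le _
      _ < ((t + 1 : ℕ) : WithBot ℕ) := by rw [zero_add]; exact_mod_cast (by omega)

theorem exists_basis_scale (hβm : 0 < βm) (hβp : 0 < βp) {i : ℕ} (hi : i < T.N) :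
    ∃ κ : ℕ → ℝ, ∀ n, κ n ≠ 0 ∧ ∀ y ∈ T.elem i, T.basis βm βp i (n + 2) y =
      κ n * ∫ t in (T.x i)..y, (beta α βm βp t)⁻¹ * (T.orthoOn βm βp i (n + 1)).eval t := by
  choose κ h using T.basis_eq_integral hβm hβp hi
  exact ⟨κ, h⟩

/-- The nodal part has the constant flux (s 1 - s 0)/∫w, and the other basis functions have
multiples of orthogonal polynomials as fluxes. -/
theorem sum_basis_eq (hβm : 0 < βm) (hβp : 0 < βp) {i : ℕ} (hi : i < T.N) {κ : ℕ → ℝ}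
    (hκ : ∀ n, κ n ≠ 0 ∧ ∀ y ∈ T.elem i, T.basis βm βp i (n + 2) y =
      κ n * ∫ t in (T.x i)..y, (beta α βm βp t)⁻¹ * (T.orthoOn βm βp i (n + 1)).eval t)
    (t : ℕ) (s : ℕ → ℝ) : ∀ y ∈ T.elem i,
    ∑ n ∈ Finset.range (t + 2), s n * T.basis βm βp i n y =
      s 0 + ∫ z in (T.x i)..y, (beta α βm βp z)⁻¹ * (T.fluxPoly βm βp i t
        ((s 1 - s 0) / ∫ z in (T.x i)..(T.x (i + 1)), (beta α βm βp z)⁻¹)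
        (fun j => s (j + 2) * κ j)).eval z := by
  intro y hy
  have hw := boundedWeight_beta hβm hβp α
  set W := ∫ z in (T.x i)..(T.x (i + 1)), (beta α βm βp z)⁻¹ with hW
  have e : ∀ z, (beta α βm βp z)⁻¹ * (T.fluxPoly βm βp i t ((s 1 - s 0) / W)
      (fun j => s (j + 2) * κ j)).eval z = (s 1 - s 0) / W * (beta α βm βp z)⁻¹ +
      ∑ j ∈ Finset.range t, s (j + 2) * κ j *
        ((beta α βm βp z)⁻¹ * (T.orthoOn βm βp i (j + 1)).eval z) := fun z => by
    rw [fluxPoly, eval_add, eval_C, eval_finsetSum, mul_add, Finset.mul_sum]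
    congr 1
    · ring
    · refine Finset.sum_congr rfl fun j _ => ?_
      rw [eval_mul, eval_C]; ring
  have hi1 : ∀ j ∈ Finset.range t, IntervalIntegrable (fun z => s (j + 2) * κ j *
      ((beta α βm βp z)⁻¹ * (T.orthoOn βm βp i (j + 1)).eval z)) volume (T.x i) y := fun j _ =>
    (hw.intervalIntegrable_eval _ _ _).const_mul _
  simp_rw [e]
  rw [intervalIntegral.integral_add ((hw.intervalIntegrable _ _).const_mul _)
    (by simpa only [Finset.sum_fn] using IntervalIntegrable.sum _ hi1),
    intervalIntegral.integral_const_mul, intervalIntegral.integral_finsetSum hi1,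
    Finset.sum_range_succ', Finset.sum_range_succ']
  have h1 := T.basis_one_eq hβm hβp hi hy
  rw [zero_add, h1.2, h1.1, ← hW]
  have h2 : ∀ j ∈ Finset.range t, s (j + 1 + 1) * T.basis βm βp i (j + 1 + 1) y =
      ∫ z in (T.x i)..y, s (j + 2) * κ j *
        ((beta α βm βp z)⁻¹ * (T.orthoOn βm βp i (j + 1)).eval z) := fun j _ => by
    rw [intervalIntegral.integral_const_mul, (hκ j).2 y hy]; ring
  rw [Finset.sum_congr rfl h2]
  ring

/-- On every element the flux of a trial function is a polynomial of degree less than `p`. -/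
theorem MemTrialSpace.exists_flux {T : Mesh a b α} {p : ℕ} {v : ℝ → ℝ}
    (hv : T.MemTrialSpace βm βp p v) (hβm : 0 < βm) (hβp : 0 < βp) (hp : 0 < p) {i : ℕ}
    (hi : i < T.N) : ∃ P : ℝ[X], P.degree < p ∧ ∀ y ∈ T.elem i,
      v y = v (T.x i) + ∫ t in (T.x i)..y, (beta α βm βp t)⁻¹ * P.eval t := by
  -- The p + 1 basis functions are the two nodal ones and t others, so the flux has degree at most
  -- t.
  obtain ⟨t, rfl⟩ : ∃ t, p = t + 1 := ⟨p - 1, by omega⟩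
  obtain ⟨s, hs⟩ := hv.2.2.2 i hi
  obtain ⟨κ, hκ⟩ := T.exists_basis_scale hβm hβp hi
  have h := T.sum_basis_eq hβm hβp hi hκ t s
  refine ⟨T.fluxPoly βm βp i t _ _, T.degree_fluxPoly hi t
    ((s 1 - s 0) / ∫ z in (T.x i)..(T.x (i + 1)), (beta α βm βp z)⁻¹)
    (fun j => s (j + 2) * κ j), fun y hy => ?_⟩
  have h0 := h (T.x i) (left_mem_Icc.2 (T.lt_succ i hi).le)
  rw [← hs _ (left_mem_Icc.2 (T.lt_succ i hi).le), intervalIntegral.integral_same, add_zero] at h0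
  rw [hs y hy, h y hy, h0]

/-- The flux of the Gauss-Lobatto projection is the weighted projection of the flux. -/
theorem exists_isProj_gaussLobattoProj (hβm : 0 < βm) (hβp : 0 < βp) {n : ℕ} {M : ℝ}
    {u q q' : ℝ → ℝ} (hu : RegularFlux a b α βm βp n M u q q') {p : ℕ} (hp : 2 ≤ p) {i : ℕ}
    (hi : i < T.N) : ∃ D : ℝ[X],
      IsProj (fun x => (beta α βm βp x)⁻¹) (T.x i) (T.x (i + 1)) p q D ∧
      ∀ y ∈ T.elem i, T.gaussLobattoProj βm βp p u i y =
        u (T.x i) + ∫ t in (T.x i)..y, (beta α βm βp t)⁻¹ * D.eval t := by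
  obtain ⟨t, rfl⟩ : ∃ t, p = t + 1 := ⟨p - 1, by omega⟩
  obtain ⟨κ, hκ⟩ := T.exists_basis_scale hβm hβp hi
  have hw := boundedWeight_beta hβm hβp α
  set w : ℝ → ℝ := fun x => (beta α βm βp x)⁻¹ with hwdef
  have hlr := T.lt_succ i hi
  have hsub : Ioo (T.x i) (T.x (i + 1)) ⊆ Ioo a b :=
    Ioo_subset_Ioo (T.x_mem hi.le).1 (T.x_mem (i := i + 1) hi).2
  set W := ∫ z in (T.x i)..(T.x (i + 1)), w z with hW
  have hWpos : 0 < W := (mul_pos hw.pos (sub_pos.2 hlr)).trans_le (hw.le_integral hlr.le)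
  set s := T.lobattoCoeff βm βp u i with hs
  have hs0 : s 0 = u (T.x i) := by simp [hs, lobattoCoeff]
  have hs1 : s 1 = u (T.x (i + 1)) := by simp [hs, lobattoCoeff]
  set L : ℕ → ℝ[X] := fun n => T.orthoOn βm βp i n with hL
  have hder : ∀ j, ∀ y ∈ Ioo (T.x i) (T.x (i + 1)), y ≠ α →
      deriv (T.basis βm βp i (j + 2)) y = κ j * (w y * (L (j + 1)).eval y) := by
    intro j y hy hyα
    have h1 := (hasDerivAt_primitive_beta hβm hβp (L (j + 1)).continuous (T.x i) hyα).const_mul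
      (κ j)
    refine HasDerivAt.deriv (h1.congr_of_eventuallyEq ?_)
    filter_upwards [Icc_mem_nhds hy.1 hy.2] with z hz using (hκ j).2 z hz
  have hqc : ContinuousOn q (uIcc (T.x i) (T.x (i + 1))) := by
    rw [uIcc_of_le hlr.le]; exact hu.cont.mono (T.elem_subset hi)
  have hwb : ∀ y, beta α βm βp y * w y = 1 := fun y => mul_inv_cancel₀ (beta_pos hβm hβp y).ne'
  -- Since βw = 1, the energy products defining the coefficients are weighted products of fluxes, so
  -- these are the Fourier coefficients of q.
  have hcoef : ∀ j, s (j + 2) * κ j * (∫ y in (T.x i)..(T.x (i + 1)),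
      w y * ((L (j + 1)).eval y * (L (j + 1)).eval y)) =
      ∫ y in (T.x i)..(T.x (i + 1)), w y * (q y * (L (j + 1)).eval y) := by
    intro j
    have hnum : ∫ y in (T.x i)..(T.x (i + 1)),
        beta α βm βp y * deriv u y * deriv (T.basis βm βp i (j + 2)) y =
        κ j * ∫ y in (T.x i)..(T.x (i + 1)), w y * (q y * (L (j + 1)).eval y) := by
      rw [← intervalIntegral.integral_const_mul]
      refine integral_congr_off α hlr.le fun y hy hyα => ?_
      rw [hder j y hy hyα, (hu.hasDerivAt_u y (hsub hy) hyα).deriv]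
      linear_combination (κ j * w y * q y * (L (j + 1)).eval y) * hwb y
    have hden : ∫ y in (T.x i)..(T.x (i + 1)), beta α βm βp y *
        deriv (T.basis βm βp i (j + 2)) y * deriv (T.basis βm βp i (j + 2)) y =
        κ j ^ 2 * ∫ y in (T.x i)..(T.x (i + 1)),
          w y * ((L (j + 1)).eval y * (L (j + 1)).eval y) := by
      rw [← intervalIntegral.integral_const_mul]
      refine integral_congr_off α hlr.le fun y hy hyα => ?_
      rw [hder j y hy hyα]
      linear_combination (κ j ^ 2 * w y * (L (j + 1)).eval y ^ 2) * hwb y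
    have hLL : 0 < ∫ y in (T.x i)..(T.x (i + 1)),
        w y * ((L (j + 1)).eval y * (L (j + 1)).eval y) := by
      have hne : L (j + 1) ≠ 0 := by
        intro h0
        have := T.degree_orthoOn βm βp hi (j + 1)
        rw [show T.orthoOn βm βp i (j + 1) = 0 from h0, degree_zero] at this
        exact absurd this (WithBot.bot_ne_coe (a := j + 1))
      have := hw.integral_eval_pos hlr (mul_ne_zero hne hne)
        (fun x _ => by rw [eval_mul]; exact mul_self_nonneg _)
      simpa only [eval_mul] using this
    have hκj := (hκ j).1
    rw [hs, lobattoCoeff, if_neg (by omega), if_neg (by omega), hnum, hden]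
    generalize (∫ y in (T.x i)..(T.x (i + 1)),
      w y * ((L (j + 1)).eval y * (L (j + 1)).eval y)) = J at hLL ⊢
    field_simp
  set D := T.fluxPoly βm βp i t ((s 1 - s 0) / W) (fun j => s (j + 2) * κ j) with hD
  have hsum := T.sum_basis_eq hβm hβp hi hκ t s
  refine ⟨D, ⟨T.degree_fluxPoly hi t _ _, ?_⟩, fun y hy => ?_⟩
  swap
  · exact (hsum y hy).trans (by rw [← hs0])
  have hint : ∀ P : ℝ[X], IntervalIntegrable (fun y => w y * (q y * P.eval y)) volume (T.x i)
      (T.x (i + 1)) := fun P => hw.intervalIntegrable_mul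
        (hqc.mul P.continuous.continuousOn).intervalIntegrable
  refine orthBelow_of_family hw (L := L) (T.degree_orthoOn βm βp hi)
    (hqc.intervalIntegrable.sub (D.continuous.intervalIntegrable _ _)) fun k hk => ?_
  have hLorth : ∀ j l, l < j → ∫ y in (T.x i)..(T.x (i + 1)),
      w y * ((L j).eval y * (L l).eval y) = 0 := fun j l hlj =>
    (T.gaussElement hβm hβp hi j).orth (L l)
      (by rw [hL, T.degree_orthoOn βm βp hi]; exact_mod_cast hlj)
  have hLorth' : ∀ j l, l ≠ j → ∫ y in (T.x i)..(T.x (i + 1)),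
      w y * ((L j).eval y * (L l).eval y) = 0 := by
    intro j l hlj
    rcases lt_or_gt_of_ne hlj with h | h
    · exact hLorth j l h
    · rw [← hLorth l j h]; congr 1; ext y; ring
  have e : ∀ y, w y * ((q y - D.eval y) * (L k).eval y) = w y * (q y * (L k).eval y) -
      ((s 1 - s 0) / W * (w y * (L k).eval y) + ∑ j ∈ Finset.range t,
        s (j + 2) * κ j * (w y * ((L (j + 1)).eval y * (L k).eval y))) := fun y => by
    have h1 : D.eval y = (s 1 - s 0) / W +
        ∑ j ∈ Finset.range t, s (j + 2) * κ j * (L (j + 1)).eval y := by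
      rw [hD, fluxPoly, eval_add, eval_C, eval_finsetSum]
      congr 1
      exact Finset.sum_congr rfl fun j _ => by rw [eval_mul, eval_C]
    have h2 : ∑ j ∈ Finset.range t,
        s (j + 2) * κ j * (w y * ((L (j + 1)).eval y * (L k).eval y)) =
        w y * (L k).eval y * ∑ j ∈ Finset.range t, s (j + 2) * κ j * (L (j + 1)).eval y := by
      rw [Finset.mul_sum]
      exact Finset.sum_congr rfl fun j _ => by ring
    rw [h1, h2]; ring
  have hi1 : ∀ j ∈ Finset.range t, IntervalIntegrable (fun y =>
      s (j + 2) * κ j * (w y * ((L (j + 1)).eval y * (L k).eval y))) volume (T.x i)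
      (T.x (i + 1)) := fun j _ => (hw.intervalIntegrable_mul
        (((L (j + 1)).continuous.mul (L k).continuous).intervalIntegrable _ _)).const_mul _
  have hi2 : IntervalIntegrable (fun y => (s 1 - s 0) / W * (w y * (L k).eval y)) volume (T.x i)
      (T.x (i + 1)) := (hw.intervalIntegrable_eval _ _ _).const_mul _
  have hi3 : IntervalIntegrable (fun y => ∑ j ∈ Finset.range t,
      s (j + 2) * κ j * (w y * ((L (j + 1)).eval y * (L k).eval y))) volume (T.x i)
      (T.x (i + 1)) := by simpa only [Finset.sum_fn] using IntervalIntegrable.sum _ hi1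
  simp_rw [e]
  rw [intervalIntegral.integral_sub (hint _) (hi2.add hi3), intervalIntegral.integral_add hi2 hi3,
    intervalIntegral.integral_const_mul, intervalIntegral.integral_finsetSum hi1]
  simp_rw [intervalIntegral.integral_const_mul]
  -- Orthogonality to constants holds because the nodal values of u fix ∫wq over the element; for
  -- higher degrees it is the choice of the Fourier coefficient.
  rcases Nat.eq_zero_or_pos k with rfl | hk0
  · rw [Finset.sum_eq_zero fun j _ => by rw [hLorth' (j + 1) 0 (by omega), mul_zero], add_zero]
    obtain ⟨l0, hl0⟩ : ∃ l0, L 0 = C l0 :=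
      ⟨_, eq_C_of_degree_le_zero (T.degree_orthoOn βm βp hi 0).le⟩
    simp only [hl0, eval_C]
    simp_rw [← mul_assoc]
    rw [intervalIntegral.integral_mul_const, intervalIntegral.integral_mul_const]
    have hqa : ContinuousOn q (uIcc a (T.x i)) := hu.cont.mono (by
      rw [uIcc_of_le (T.x_mem hi.le).1]
      exact Icc_subset_Icc_right (T.x_mem hi.le).2)
    have hadd := intervalIntegral.integral_add_adjacent_intervals
      (hw.intervalIntegrable_mul hqa.intervalIntegrable)
      (hw.intervalIntegrable_mul hqc.intervalIntegrable)
    have hu1 := hu.eq_integral _ (T.x_mem hi.le)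
    have hu2 := hu.eq_integral _ (T.x_mem (i := i + 1) hi)
    have : ∫ y in (T.x i)..(T.x (i + 1)), w y * q y = s 1 - s 0 := by
      rw [hs0, hs1, hu1, hu2, ← hadd]; ring
    rw [this, ← hW]; field_simp; ring
  · obtain ⟨j, rfl⟩ : ∃ j, k = j + 1 := ⟨k - 1, by omega⟩
    have h0 : ∫ y in (T.x i)..(T.x (i + 1)), w y * (L (j + 1)).eval y = 0 := by
      have := (T.gaussElement hβm hβp hi (j + 1)).orth 1
        (degree_one_le.trans_lt (by exact_mod_cast Nat.succ_pos j))
      simpa using this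
    rw [h0, Finset.sum_eq_single j, hcoef j]
    · ring
    · intro j' _ hj'
      rw [hLorth' (j' + 1) (j + 1) (by omega), mul_zero]
    · intro hj; exact absurd (Finset.mem_range.2 (by omega)) hj

end Mesh

/-! ### The finite volume equations as an identity at the Gauss points. -/

/-- Compare the smallest point whose value differs from that at the minimum of S with its
predecessor in S. -/
theorem eq_of_consecutive_eq {S : Set ℝ} (hS : S.Finite) {Ψ : ℝ → ℝ}
    (h : ∀ y ∈ S, ∀ z ∈ S, y < z → (∀ t ∈ S, ¬ (y < t ∧ t < z)) → Ψ y = Ψ z) :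
    ∃ κ, ∀ y ∈ S, Ψ y = κ := by
  rcases S.eq_empty_or_nonempty with rfl | hne
  · exact ⟨0, fun y hy => absurd hy (notMem_empty y)⟩
  obtain ⟨g₀, hg₀, hmin⟩ := hS.exists_minimalFor id S hne
  refine ⟨Ψ g₀, fun y hy => ?_⟩
  by_contra hcon
  set B := {z ∈ S | Ψ z ≠ Ψ g₀} with hB
  obtain ⟨z, ⟨hzS, hzne⟩, hzmin⟩ := (hS.subset (sep_subset S _)).exists_minimalFor id B ⟨y, hy, hcon⟩
  have hzg : g₀ < z := by
    rcases lt_trichotomy g₀ z with h1 | h1 | h1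
    · exact h1
    · exact absurd (h1 ▸ rfl) hzne
    · exact absurd (hmin hzS h1.le) (not_le.2 h1)
  set D := {t ∈ S | t < z} with hD
  obtain ⟨t, ⟨htS, htz⟩, htmax⟩ :=
    (hS.subset (sep_subset S _)).exists_maximalFor id D ⟨g₀, hg₀, hzg⟩
  have h1 : Ψ t = Ψ z := h t htS z hzS htz fun s hs hst =>
    absurd (htmax (j := s) ⟨hs, hst.2⟩ hst.1.le) (not_le.2 hst.1)
  have h2 : Ψ t = Ψ g₀ := by
    by_contra hne'
    exact absurd (hzmin (j := t) ⟨htS, hne'⟩ htz.le) (not_le.2 htz)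
  exact hzne (h1.symm.trans h2)

namespace Mesh

variable {a b α : ℝ} {T : Mesh a b α} {βm βp : ℝ}

theorem hasDerivAt_of_flux (hβm : 0 < βm) (hβp : 0 < βp) {v : ℝ → ℝ} {i : ℕ} {P : ℝ[X]}
    (hP : ∀ y ∈ T.elem i, v y = v (T.x i) + ∫ t in (T.x i)..y, (beta α βm βp t)⁻¹ * P.eval t)
    {y : ℝ} (hy : y ∈ Ioo (T.x i) (T.x (i + 1))) (hyα : y ≠ α) :
    HasDerivAt v ((beta α βm βp y)⁻¹ * P.eval y) y := by
  refine ((hasDerivAt_primitive_beta hβm hβp P.continuous (T.x i) hyα).const_add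
    (v (T.x i))).congr_of_eventuallyEq ?_
  filter_upwards [Icc_mem_nhds hy.1 hy.2] with z hz using hP z hz

theorem flux_trial_eq (hβm : 0 < βm) (hβp : 0 < βp) {v : ℝ → ℝ} {i : ℕ} {P : ℝ[X]}
    (hP : ∀ y ∈ T.elem i, v y = v (T.x i) + ∫ t in (T.x i)..y, (beta α βm βp t)⁻¹ * P.eval t)
    {g : ℝ} (hg : g ∈ Ioo (T.x i) (T.x (i + 1))) : flux α βm βp v g = P.eval g := by
  refine flux_eq (F := fun y => P.eval y) ?_ P.continuous.continuousAt
  filter_upwards [nhdsWithin_le_nhds (Ioo_mem_nhds hg.1 hg.2), eventually_ne_nhdsNE α g]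
    with y hy hyα
  rw [(hasDerivAt_of_flux hβm hβp hP hy hyα).deriv, mul_inv_cancel_left₀
    (beta_pos hβm hβp y).ne']

theorem flux_error_eq (hβm : 0 < βm) (hβp : 0 < βp) {n : ℕ} {M : ℝ} {u q q' : ℝ → ℝ}
    (hu : RegularFlux a b α βm βp n M u q q') {v : ℝ → ℝ} {i : ℕ} (hi : i < T.N) {P : ℝ[X]}
    (hP : ∀ y ∈ T.elem i, v y = v (T.x i) + ∫ t in (T.x i)..y, (beta α βm βp t)⁻¹ * P.eval t)
    {g : ℝ} (hg : g ∈ Ioo (T.x i) (T.x (i + 1))) :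
    flux α βm βp (fun y => u y - v y) g = q g - P.eval g := by
  have hsub : Ioo (T.x i) (T.x (i + 1)) ⊆ Ioo a b :=
    Ioo_subset_Ioo (T.x_mem hi.le).1 (T.x_mem (i := i + 1) hi).2
  refine flux_eq (F := fun y => q y - P.eval y) ?_
    ((hu.hasDerivAt g (hsub hg)).continuousAt.sub P.continuous.continuousAt)
  filter_upwards [nhdsWithin_le_nhds (Ioo_mem_nhds hg.1 hg.2), eventually_ne_nhdsNE α g]
    with y hy hyα
  have h1 := (hu.hasDerivAt_u y (hsub hy) hyα).sub (hasDerivAt_of_flux hβm hβp hP hy hyα)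
  have hb := (beta_pos (α := α) hβm hβp y).ne'
  have h2 : deriv (fun y => u y - v y) y = _ := h1.deriv
  rw [h2]
  field_simp

theorem intervalIntegrable_of_elem {F : ℝ → ℝ}
    (h : ∀ i < T.N, IntervalIntegrable F volume (T.x i) (T.x (i + 1))) :
    IntervalIntegrable F volume a b := by
  have h1 := IntervalIntegrable.trans_iterate (a := T.x) (n := T.N) h
  have h0 := T.x_zero
  have hN := T.x_last
  rwa [h0, hN] at h1

theorem MemTrialSpace.intervalIntegrable_deriv {p : ℕ} {v : ℝ → ℝ}
    (hv : T.MemTrialSpace βm βp p v) (hβm : 0 < βm) (hβp : 0 < βp) (hp : 0 < p) :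
    IntervalIntegrable (deriv v) volume a b := by
  have hw := boundedWeight_beta hβm hβp α
  refine T.intervalIntegrable_of_elem fun i hi => ?_
  obtain ⟨P, -, hP⟩ := hv.exists_flux hβm hβp hp hi
  exact intervalIntegrable_congr_off α (T.lt_succ i hi).le
    (fun y hy hyα => (hasDerivAt_of_flux hβm hβp hP hy hyα).deriv)
    (hw.intervalIntegrable_eval P _ _)

theorem MemTrialSpace.integral_deriv {p : ℕ} {v : ℝ → ℝ}
    (hv : T.MemTrialSpace βm βp p v) (hβm : 0 < βm) (hβp : 0 < βp) (hp : 0 < p) {y z : ℝ}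
    (hy : y ∈ Icc a b) (hz : z ∈ Icc a b) (hyz : y ≤ z) : ∫ x in y..z, deriv v x = v z - v y := by
  have hsub : Icc y z ⊆ Icc a b := Icc_subset_Icc hy.1 hz.2
  refine integral_eq_of_hasDerivAt_off_countable_of_le v (deriv v) hyz
    -- At the nodes and at α the derivative may not exist; these finitely many points do not affect
    -- the integral.
    (s := insert α (T.x '' Iic T.N)) (((finite_Iic _).image _).insert α).countable
    (hv.1.mono hsub) (fun x hx => ?_) ?_
  · obtain ⟨hx1, hx2⟩ := hx
    rw [mem_insert_iff, not_or] at hx2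
    obtain ⟨i, hi, hxi⟩ := T.exists_mem_elem (hsub (Ioo_subset_Icc_self hx1))
    obtain ⟨P, -, hP⟩ := hv.exists_flux hβm hβp hp hi
    have hxi' : x ∈ Ioo (T.x i) (T.x (i + 1)) := by
      refine ⟨lt_of_le_of_ne hxi.1 fun h => hx2.2 ⟨i, hi.le, h⟩,
        lt_of_le_of_ne hxi.2 fun h => hx2.2 ⟨i + 1, hi, h.symm⟩⟩
    exact (hasDerivAt_of_flux hβm hβp hP hxi' hx2.1).differentiableAt.hasDerivAt
  · exact (hv.intervalIntegrable_deriv hβm hβp hp).mono_set (by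
      rw [uIcc_of_le hyz, uIcc_of_le (hy.1.trans hy.2)]; exact hsub)

end Mesh

theorem RegularFlux.continuousOn {a b α βm βp : ℝ} (hab : a ≤ b) (hβm : 0 < βm) (hβp : 0 < βp)
    {n : ℕ} {M : ℝ} {u q q' : ℝ → ℝ} (hu : RegularFlux a b α βm βp n M u q q') :
    ContinuousOn u (Icc a b) := by
  have hw := boundedWeight_beta hβm hβp α
  have hq : ContinuousOn q (uIcc a b) := by rw [uIcc_of_le hab]; exact hu.cont
  have := intervalIntegral.continuousOn_primitive_interval'
    (hw.intervalIntegrable_mul hq.intervalIntegrable) (left_mem_uIcc)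
  rw [uIcc_of_le hab] at this
  exact this.congr hu.eq_integral

/-- The continuous counterpart of a control volume equation. No interface term appears because q is
differentiable across α. -/
theorem RegularFlux.integral_rhs {a b α βm βp γ c : ℝ} (hβm : 0 < βm)
    (hβp : 0 < βp) {n : ℕ} {M : ℝ} {u q q' f : ℝ → ℝ} (hu : RegularFlux a b α βm βp n M u q q')
    (hf : SolvesEquation a b α βm βp γ c f u) {y z : ℝ} (hy : y ∈ Icc a b) (hz : z ∈ Icc a b)
    (hyz : y ≤ z) :
    ∫ x in y..z, f x = q y - q z + γ * (u z - u y) + c * ∫ x in y..z, u x := by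
  have hab : a ≤ b := hy.1.trans hy.2
  have hw := boundedWeight_beta hβm hβp α
  have hsub : Icc y z ⊆ Icc a b := Icc_subset_Icc hy.1 hz.2
  have hsub' : uIcc y z ⊆ Icc a b := by rw [uIcc_of_le hyz]; exact hsub
  have hsubo : Ioo y z ⊆ Ioo a b := Ioo_subset_Ioo hy.1 hz.2
  have huc := hu.continuousOn hab hβm hβp
  have hfeq : ∀ x ∈ Ioo y z, x ≠ α →
      f x = -q' x + γ * ((beta α βm βp x)⁻¹ * q x) + c * u x := by
    intro x hx hxα
    rw [← hf x (hsubo hx) hxα, (hu.hasDerivAt_u x (hsubo hx) hxα).deriv]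
    congr 3
    rw [← (hu.hasDerivAt x (hsubo hx)).deriv]
    refine EventuallyEq.deriv_eq ?_
    filter_upwards [isOpen_Ioo.mem_nhds (hsubo hx), isOpen_ne.mem_nhds hxα] with t ht htα
    rw [(hu.hasDerivAt_u t ht htα).deriv, mul_inv_cancel_left₀ (beta_pos hβm hβp t).ne']
  have i1 : IntervalIntegrable (fun x => -q' x) volume y z :=
    ((hu.cont'.mono hsub').intervalIntegrable).neg
  have i2 : IntervalIntegrable (fun x => γ * ((beta α βm βp x)⁻¹ * q x)) volume y z :=
    (hw.intervalIntegrable_mul (hu.cont.mono hsub').intervalIntegrable).const_mul γ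
  have i3 : IntervalIntegrable (fun x => c * u x) volume y z :=
    ((huc.mono hsub').intervalIntegrable).const_mul c
  have hq : ∫ x in y..z, q' x = q z - q y :=
    intervalIntegral.integral_eq_sub_of_hasDerivAt_of_le hyz (hu.cont.mono hsub)
      (fun x hx => hu.hasDerivAt x (hsubo hx)) (hu.cont'.mono hsub').intervalIntegrable
  have hu' : ∫ x in y..z, (beta α βm βp x)⁻¹ * q x = u z - u y :=
    integral_eq_of_hasDerivAt_off_countable_of_le u _ hyz (countable_singleton α)
      (huc.mono hsub) (fun x hx => hu.hasDerivAt_u x (hsubo hx.1) hx.2)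
      (hw.intervalIntegrable_mul (hu.cont.mono hsub').intervalIntegrable)
  rw [integral_congr_off α hyz hfeq, intervalIntegral.integral_add (i1.add i2) i3,
    intervalIntegral.integral_add i1 i2, intervalIntegral.integral_neg,
    intervalIntegral.integral_const_mul, intervalIntegral.integral_const_mul, hq, hu']
  ring

namespace Mesh

variable {a b α : ℝ} {T : Mesh a b α} {βm βp : ℝ}

theorem isGaussPoint_iff (hβm : 0 < βm) (hβp : 0 < βp) {p : ℕ} {g : ℝ} :
    T.IsGaussPoint βm βp p g ↔ ∃ i < T.N, (T.orthoOn βm βp i p).eval g = 0 := by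
  constructor
  · rintro ⟨i, hi, -, h⟩
    obtain ⟨κ, hκ, h'⟩ := T.legendreOn_eq hβm hβp hi p
    rw [h'] at h
    exact ⟨i, hi, (mul_eq_zero.1 h).resolve_left hκ⟩
  · rintro ⟨i, hi, h⟩
    obtain ⟨κ, hκ, h'⟩ := T.legendreOn_eq hβm hβp hi p
    exact ⟨i, hi, (T.gaussElement hβm hβp hi p).mem_Icc h, by rw [h', h, mul_zero]⟩

theorem finite_gaussPoints (hβm : 0 < βm) (hβp : 0 < βp) (p : ℕ) :
    {g | T.IsGaussPoint βm βp p g}.Finite := by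
  have : {g | T.IsGaussPoint βm βp p g} ⊆
      ⋃ i ∈ Finset.range T.N, (gaussSet (T.orthoOn βm βp i p) : Set ℝ) := by
    intro g hg
    obtain ⟨i, hi, h⟩ := (isGaussPoint_iff hβm hβp).1 hg
    simp only [mem_iUnion]
    exact ⟨i, Finset.mem_range.2 hi, (mem_gaussSet (T.degree_orthoOn βm βp hi p)).2 h⟩
  exact ((Finset.range T.N).finite_toSet.biUnion fun _ _ => Finset.finite_toSet _).subset this

/-- The finite volume scheme determines the error of the flux at the Gauss points up to a single
constant. -/
theorem IsIFVSolution.exists_const {γ c : ℝ} (hβm : 0 < βm) (hβp : 0 < βp) {n : ℕ} {M : ℝ}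
    {u q q' f v : ℝ → ℝ} (hu : RegularFlux a b α βm βp n M u q q')
    (hf : SolvesEquation a b α βm βp γ c f u) {p : ℕ} (hp : 0 < p)
    (hv : T.IsIFVSolution βm βp γ c p f v) :
    ∃ κ : ℝ, ∀ g, T.IsGaussPoint βm βp p g → flux α βm βp (fun y => u y - v y) g =
      γ * (u g - v g) + c * (∫ x in a..g, (u x - v x)) + κ := by
  have hab : a ≤ b := T.x_zero.symm.trans_le ((T.x_le_x (Nat.zero_le _) le_rfl).trans_eq T.x_last)
  have huc := hu.continuousOn hab hβm hβp
  have hmem : ∀ g, T.IsGaussPoint βm βp p g → ∃ i < T.N, g ∈ Ioo (T.x i) (T.x (i + 1)) :=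
    fun g hg => by
      obtain ⟨i, hi, h⟩ := (isGaussPoint_iff hβm hβp).1 hg
      exact ⟨i, hi, (T.gaussElement hβm hβp hi p).mem_Ioo h⟩
  have hmemI : ∀ g, T.IsGaussPoint βm βp p g → g ∈ Icc a b := fun g hg => by
    obtain ⟨i, hi, h⟩ := hmem g hg
    exact T.elem_subset hi (Ioo_subset_Icc_self h)
  have hflux : ∀ g, T.IsGaussPoint βm βp p g →
      flux α βm βp (fun y => u y - v y) g = q g - flux α βm βp v g := fun g hg => by
    obtain ⟨i, hi, h⟩ := hmem g hg
    obtain ⟨P, -, hP⟩ := hv.1.exists_flux hβm hβp hp hi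
    rw [flux_error_eq hβm hβp hu hi hP h, flux_trial_eq hβm hβp hP h]
  have hint : ∀ y z, y ∈ Icc a b → z ∈ Icc a b → ∀ F : ℝ → ℝ, ContinuousOn F (Icc a b) →
      IntervalIntegrable F volume y z := fun y z hy hz F hF =>
    (hF.mono (uIcc_subset_Icc hy hz)).intervalIntegrable
  have ha : a ∈ Icc a b := left_mem_Icc.2 hab
  -- The difference of the exact and the discrete balance says that this Ψ agrees at consecutive
  -- Gauss points, also when they belong to different elements.
  obtain ⟨κ, hκ⟩ := eq_of_consecutive_eq (T.finite_gaussPoints hβm hβp p)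
    (Ψ := fun g => flux α βm βp (fun y => u y - v y) g - γ * (u g - v g) -
      c * ∫ x in a..g, (u x - v x)) fun y hy z hz hyz hcons => by
    have h := hv.2 y z ⟨hy, hz, hyz, hcons⟩
    have hyI := hmemI y hy
    have hzI := hmemI z hz
    have hd := (hv.1.intervalIntegrable_deriv hβm hβp hp).mono_set (c := y) (d := z) (by
      rw [uIcc_of_le hab]; exact uIcc_subset_Icc hyI hzI)
    rw [hu.integral_rhs hβm hβp hf hyI hzI hyz.le, intervalIntegral.integral_add
      (hd.const_mul γ) ((hint y z hyI hzI v hv.1.1).const_mul c),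
      intervalIntegral.integral_const_mul, intervalIntegral.integral_const_mul,
      hv.1.integral_deriv hβm hβp hp hyI hzI hyz.le] at h
    have h2 := intervalIntegral.integral_add_adjacent_intervals
      (hint a y ha hyI _ (huc.sub hv.1.1)) (hint y z hyI hzI _ (huc.sub hv.1.1))
    have h3 := intervalIntegral.integral_sub (hint y z hyI hzI _ huc) (hint y z hyI hzI _ hv.1.1)
    simp only [Pi.sub_apply] at h2
    rw [h3] at h2
    rw [hflux y hy, hflux z hz, ← h2]
    linarith
  refine ⟨κ, fun g hg => ?_⟩
  have := hκ g hg
  linarith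

end Mesh

/-! ### Local consistency of the discrete flux. -/

/-- Constant in the bound for the nodal values of the local flux error. -/
def nodeConst (m' K γ c : ℝ) : ℝ := (1 + K) * (1 + |γ| * m' + |c| * m')

/-- Constant in the bound for the Lipschitz constant of the local flux error. -/
def lipConst (m' K γ c G : ℝ) : ℝ := |γ| * m' * K * (nodeConst m' K γ c + G) + |c|

/-- Constant in the bound for the local consistency error. -/
def elemConst (m' K γ c G : ℝ) : ℝ :=
  m' * K * nodeConst m' K γ c + m' * (1 + K) * lipConst m' K γ c G

section Local

variable {m m' : ℝ} {w : ℝ → ℝ} {l r : ℝ} {p : ℕ} {Q : ℝ[X]} {K : ℝ}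

/-- The discrete flux error `d` on one element satisfies the integrated equation
`d = F` up to a superconvergent remainder, if it satisfies it at the Gauss points up to the
projection errors. -/
theorem GaussElement.consistency_le (E : GaussElement m m' w l r p Q)
    (hK : IsStabilityConst p m m' K) (hp : 2 ≤ p) {q : ℝ → ℝ} {D : ℝ[X]}
    (hD : IsProj w l r p q D) (hq : ContinuousOn q (Icc l r)) {M : ℝ} (hM : 0 ≤ M)
    (hA₀ : Approx p M q l r) (hA₁ : Approx (p + 1) M q l r) (hA₂ : Approx (2 * p) M q l r)
    {h : ℝ} (hlr : r - l ≤ h) (h1 : h ≤ 1) {d : ℝ[X]} (hd : d.degree < p) {γ c G X : ℝ}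
    (hG : 0 ≤ G) (hX : 0 ≤ X) {N F : ℝ → ℝ} (hFc : ContinuousOn F (Icc l r))
    (hN : ∀ x ∈ Icc l r, |N x| ≤ m' * (1 + K) * M * (r - l) ^ (p + 2))
    (hF : ∀ x ∈ Icc l r, |F x| ≤ G * X)
    (hLip : ∀ S, (∀ x ∈ Icc l r, |d.eval x| ≤ S) → ∀ x ∈ Icc l r, ∀ y ∈ Icc l r,
      |F x - F y| ≤ (|γ| * m' * S + |c| * X) * |x - y|)
    (hnode : ∀ g, Q.eval g = 0 → d.eval g =
      (D.eval g - q g) + γ * (∫ t in l..g, w t * (q t - D.eval t)) + c * N g + F g) :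
    (∀ y ∈ Icc l r, |∫ t in l..y, w t * (d.eval t - F t)| ≤
      elemConst m' K γ c G * (M * h ^ (p + 2) + h * X)) ∧
    ∀ κ, (∀ x ∈ Ioo l r, w x = κ) → |∫ t in l..r, w t * (d.eval t - F t)| ≤
      elemConst m' K γ c G * (M * h ^ (p + 2) + h * X) * (r - l) := by
  have hw := E.weight
  have hK0 := hK.1
  have hm' := hw.upper_pos
  have hp0 : 0 < p := by omega
  have hH : 0 < r - l := sub_pos.2 E.lt
  have hh : 0 < h := hH.trans_le hlr
  have hH1 : r - l ≤ 1 := hlr.trans h1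
  set H := r - l with hHdef
  have hc2 : 0 ≤ nodeConst m' K γ c := by unfold nodeConst; positivity
  have hc3 : 0 ≤ lipConst m' K γ c G := by unfold lipConst; positivity
  set η : ℝ → ℝ := fun y => ∫ t in l..y, w t * (q t - D.eval t) with hη
  have hηb := hD.primitive_le hw E.lt hK hq hM hA₀
  have hpow : H ^ (p + 2) ≤ H ^ (p + 1) := pow_le_pow_of_le_one hH.le hH1 (by omega)
  set f : ℝ → ℝ := fun x => D.eval x - q x + (γ * η x + c * N x) with hf
  have hfb : ∀ g, Q.eval g = 0 → |f g| ≤ nodeConst m' K γ c * M * H ^ (p + 1) := fun g hg => by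
    have a1 := E.proj_error_node_le hK hD hq hM hA₁ hg
    have a2 := hηb g (E.mem_Icc hg)
    have a3 := (hN g (E.mem_Icc hg)).trans
      (mul_le_mul_of_nonneg_left hpow (by positivity : 0 ≤ m' * (1 + K) * M))
    calc |f g| ≤ |D.eval g - q g| + (|γ| * |η g| + |c| * |N g|) := by
          refine (abs_add_le _ _).trans ?_
          gcongr
          refine (abs_add_le _ _).trans ?_
          rw [abs_mul, abs_mul]
      _ ≤ (1 + K) * M * H ^ (p + 1) + (|γ| * (m' * (1 + K) * M * H ^ (p + 1)) +
            |c| * (m' * (1 + K) * M * H ^ (p + 1))) := by gcongr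
      _ = _ := by unfold nodeConst; ring
  have hfB : 0 ≤ nodeConst m' K γ c * M * H ^ (p + 1) := by positivity
  have hi := E.interp_le hK hp0 hfB hfb
  -- As d has degree less than p, it is the interpolant of its nodal values.
  have hdi : d = interp Q f + interp Q F := by
    rw [← interp_add]
    refine E.orth.eq_interp hw E.lt E.deg hd fun g hg => ?_
    rw [hnode g hg, hf, hη]; ring
  -- This crude bound serves only to make F Lipschitz through `hLip`; then F is close to its
  -- interpolant with an extra factor H.
  have hdb : ∀ x ∈ Icc l r, |d.eval x| ≤ K * (nodeConst m' K γ c * M * H ^ (p + 1) + G * X) := by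
    intro x hx
    have := E.interp_le hK hp0 (f := F) (by positivity) (fun g hg => hF g (E.mem_Icc hg)) x hx
    rw [hdi, eval_add, mul_add]
    exact (abs_add_le _ _).trans (add_le_add (hi x hx) this)
  have hΛ : |γ| * m' * (K * (nodeConst m' K γ c * M * H ^ (p + 1) + G * X)) + |c| * X ≤
      lipConst m' K γ c G * (M * h ^ (p + 1) + X) := by
    have e1 : H ^ (p + 1) ≤ h ^ (p + 1) := pow_le_pow_left₀ hH.le hlr _
    have e2 : nodeConst m' K γ c * M * H ^ (p + 1) + G * X ≤
        (nodeConst m' K γ c + G) * (M * h ^ (p + 1) + X) := by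
      have : nodeConst m' K γ c * M * H ^ (p + 1) ≤ nodeConst m' K γ c * M * h ^ (p + 1) := by
        gcongr
      have t1 : 0 ≤ nodeConst m' K γ c * X := by positivity
      have t2 : 0 ≤ G * (M * h ^ (p + 1)) := by positivity
      linarith
    calc _ ≤ |γ| * m' * (K * ((nodeConst m' K γ c + G) * (M * h ^ (p + 1) + X))) +
          |c| * (M * h ^ (p + 1) + X) := by
          gcongr
          have : 0 ≤ M * h ^ (p + 1) := by positivity
          linarith
      _ = _ := by unfold lipConst; ring
  have hs := E.interp_sub_le hK hp0 (by positivity : 0 ≤ lipConst m' K γ c G * (M * h ^ (p + 1) + X))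
    (fun x hx y hy => (hLip _ hdb x hx y hy).trans
      (mul_le_mul_of_nonneg_right hΛ (abs_nonneg _)))
  have hY : ∀ k, p + 1 ≤ k → H ^ k ≤ h ^ (p + 1) * H ^ (k - (p + 1)) := fun k hk => by
    calc H ^ k = H ^ (p + 1) * H ^ (k - (p + 1)) := by rw [← pow_add]; congr 1; omega
      _ ≤ _ := by gcongr
  refine ⟨fun y hy => ?_, fun κ hκ => ?_⟩
  -- For an arbitrary weight the pointwise order p + 1 is used, and integration over the element
  -- gives one more power.
  · have hpt : ∀ x ∈ Icc l y, |d.eval x - F x| ≤ K * (nodeConst m' K γ c * M * H ^ (p + 1)) +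
        (1 + K) * (lipConst m' K γ c G * (M * h ^ (p + 1) + X)) * H := fun x hx => by
      have hx' : x ∈ Icc l r := ⟨hx.1, hx.2.trans hy.2⟩
      rw [hdi, eval_add, add_sub_assoc]
      exact (abs_add_le _ _).trans (add_le_add (hi x hx') (hs x hx'))
    refine (hw.abs_integral_mul_le hy.1 hpt).trans ?_
    have hyl : y - l ≤ h := by linarith [hy.2]
    have hyl0 : 0 ≤ y - l := sub_nonneg.2 hy.1
    calc _ ≤ m' * (K * (nodeConst m' K γ c * M * h ^ (p + 1)) +
          (1 + K) * (lipConst m' K γ c G * (M * h ^ (p + 1) + X)) * 1) * h := by gcongr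
      _ = m' * K * nodeConst m' K γ c * (M * h ^ (p + 2)) +
          m' * (1 + K) * lipConst m' K γ c G * (M * h ^ (p + 2) + h * X) := by ring
      _ ≤ m' * K * nodeConst m' K γ c * (M * h ^ (p + 2) + h * X) +
          m' * (1 + K) * lipConst m' K γ c G * (M * h ^ (p + 2) + h * X) := by
          gcongr
          have : 0 ≤ h * X := by positivity
          linarith
      _ = _ := by unfold elemConst; ring
  · have hqi : IntervalIntegrable q volume l r := by
      rw [← uIcc_of_le E.lt.le] at hq; exact hq.intervalIntegrable
    have hFi : IntervalIntegrable F volume l r := by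
      rw [← uIcc_of_le E.lt.le] at hFc; exact hFc.intervalIntegrable
    have hPi : ∀ P : ℝ[X], IntervalIntegrable (fun t => w t * P.eval t) volume l r := fun P =>
      hw.intervalIntegrable_eval P l r
    have hDD : interp Q (fun x => D.eval x) = D :=
      (E.orth.eq_interp hw E.lt E.deg hD.deg fun g _ => rfl).symm
    have i1 := hw.intervalIntegrable_mul (hqi.sub ((interp Q q).continuous.intervalIntegrable l r))
    have i2 := hw.intervalIntegrable_mul (hqi.sub (D.continuous.intervalIntegrable l r))
    have i3 := hw.intervalIntegrable_mul (((interp Q F).continuous.intervalIntegrable l r).sub hFi)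
    -- Writing the interpolant of D - q as (q - interp q) - (q - D) exposes a quadrature error and a
    -- term of zero mean. The interpolants of η and of N have the needed order by exactness and by
    -- the bound on N.
    have hsplit : (fun t => w t * (d.eval t - F t)) = fun t =>
        (w t * (q t - (interp Q q).eval t) - w t * (q t - D.eval t)) +
        (γ * (w t * (interp Q η).eval t) + c * (w t * (interp Q N).eval t)) +
        w t * ((interp Q F).eval t - F t) := by
      ext t
      rw [hdi, hf, interp_add, interp_add, interp_sub, interp_const_mul, interp_const_mul, hDD]
      simp only [eval_add, eval_sub, eval_smul, smul_eq_mul]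
      ring
    rw [hsplit, intervalIntegral.integral_add ((i1.sub i2).add
        (((hPi _).const_mul γ).add ((hPi _).const_mul c))) i3,
      intervalIntegral.integral_add (i1.sub i2) (((hPi _).const_mul γ).add ((hPi _).const_mul c)),
      intervalIntegral.integral_sub i1 i2,
      intervalIntegral.integral_add ((hPi _).const_mul γ) ((hPi _).const_mul c),
      intervalIntegral.integral_const_mul, intervalIntegral.integral_const_mul,
      hD.integral_eq_zero hp0, sub_zero]
    have b1 := E.quadrature_error_le hK hp0 hq hM hA₂
    have b2 := E.integral_interp_primitive_le hK hp hκ hD hq hM hA₁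
    have b3 := hw.abs_integral_mul_le E.lt.le (E.interp_le hK hp0 (f := N)
      (B := m' * (1 + K) * M * H ^ (p + 2)) (by positivity) fun g hg => hN g (E.mem_Icc hg))
    have b4 := hw.abs_integral_mul_le E.lt.le hs
    have e1 : H ^ (2 * p + 1) ≤ h ^ (p + 2) * H := by
      calc H ^ (2 * p + 1) = H ^ (2 * p) * H := pow_succ _ _
        _ ≤ H ^ (p + 2) * H := by
          gcongr ?_ * _
          exact pow_le_pow_of_le_one hH.le hH1 (by omega)
        _ ≤ _ := by gcongr
    have e2 : H ^ (p + 2) * H ≤ h ^ (p + 2) * H := by gcongr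
    have e3 : H ^ (p + 3) = H ^ (p + 2) * H := pow_succ _ _
    calc _ ≤ |∫ t in l..r, w t * (q t - (interp Q q).eval t)| +
          (|γ| * |∫ t in l..r, w t * (interp Q η).eval t| +
            |c| * |∫ t in l..r, w t * (interp Q N).eval t|) +
          |∫ t in l..r, w t * ((interp Q F).eval t - F t)| := by
          refine (abs_add_le _ _).trans ?_
          gcongr
          refine (abs_add_le _ _).trans ?_
          gcongr
          refine (abs_add_le _ _).trans ?_
          rw [abs_mul, abs_mul]
      _ ≤ m' * (1 + K) * M * (h ^ (p + 2) * H) +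
          (|γ| * (m' ^ 2 * K * (1 + K) * M * (h ^ (p + 2) * H)) +
            |c| * (m' * (K * (m' * (1 + K) * M * h ^ (p + 2))) * H)) +
          m' * ((1 + K) * (lipConst m' K γ c G * (M * h ^ (p + 1) + X)) * h) * H := by
          gcongr
          · exact b1.trans (mul_le_mul_of_nonneg_left e1 (by positivity))
          · refine b2.trans (mul_le_mul_of_nonneg_left ?_ (by positivity))
            rw [← hHdef, e3]; exact e2
          · refine b3.trans ?_
            rw [← hHdef]
            gcongr
          · refine b4.trans ?_
            rw [← hHdef]
            gcongr
      -- The harmless factor K ≥ 1 is inserted so that all terms share the shape of `elemConst`.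
      _ ≤ m' * K * (1 + K) * M * (h ^ (p + 2) * H) +
          (|γ| * (m' ^ 2 * K * (1 + K) * M * (h ^ (p + 2) * H)) +
            |c| * (m' * (K * (m' * (1 + K) * M * h ^ (p + 2))) * H)) +
          m' * ((1 + K) * (lipConst m' K γ c G * (M * h ^ (p + 1) + X)) * h) * H := by
          gcongr
          nlinarith
      _ = (m' * K * nodeConst m' K γ c * (M * h ^ (p + 2)) +
          m' * (1 + K) * lipConst m' K γ c G * (M * h ^ (p + 2) + h * X)) * H := by
          unfold nodeConst; ring
      _ ≤ (m' * K * nodeConst m' K γ c * (M * h ^ (p + 2) + h * X) +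
          m' * (1 + K) * lipConst m' K γ c G * (M * h ^ (p + 2) + h * X)) * H := by
          gcongr
          have : 0 ≤ h * X := by positivity
          linarith
      _ = _ := by unfold elemConst; ring

end Local

/-! ### From elements to the whole interval, and the splitting of the error. -/

namespace Mesh

variable {a b α : ℝ} (T : Mesh a b α)

theorem induction_nodes {C : ℕ → Prop} (h0 : C 0) (hs : ∀ i < T.N, C i → C (i + 1)) :
    ∀ i ≤ T.N, C i := by
  intro i
  induction i with
  | zero => exact fun _ => h0
  | succ i ih => exact fun hi => hs i hi (ih (Nat.le_of_succ_le hi))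

/-- A function that agrees with given functions inside the elements. -/
theorem exists_glue (F : ℕ → ℝ → ℝ) :
    ∃ f : ℝ → ℝ, ∀ i < T.N, ∀ y ∈ Ioo (T.x i) (T.x (i + 1)), f y = F i y := by
  classical
  refine ⟨fun y => ∑ i ∈ Finset.range T.N, (Ioo (T.x i) (T.x (i + 1))).indicator (F i) y,
    fun i hi y hy => ?_⟩
  dsimp only
  rw [Finset.sum_eq_single_of_mem i (Finset.mem_range.2 hi), indicator_of_mem hy]
  intro j hj hji
  refine indicator_of_notMem (fun hy' => ?_) _
  rw [Finset.mem_range] at hj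
  rcases Nat.lt_or_gt_of_ne hji with h | h
  · exact absurd (T.x_le_x h hi.le) (not_le.2 (hy.1.trans hy'.2))
  · exact absurd (T.x_le_x h hj.le) (not_le.2 (hy'.1.trans hy.2))

variable {T}

theorem intervalIntegrable_sub {F : ℝ → ℝ} (hab : a ≤ b) (hF : IntervalIntegrable F volume a b)
    {y z : ℝ} (hy : y ∈ Icc a b) (hz : z ∈ Icc a b) : IntervalIntegrable F volume y z :=
  hF.mono_set (by rw [uIcc_of_le hab]; exact uIcc_subset_Icc hy hz)

theorem integral_split {F : ℝ → ℝ} (hF : IntervalIntegrable F volume a b) {i : ℕ} (hi : i < T.N)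
    {y : ℝ} (hy : y ∈ T.elem i) :
    ∫ t in a..y, F t = (∫ t in a..(T.x i), F t) + ∫ t in (T.x i)..y, F t := by
  have hab : a ≤ b := (T.x_mem (Nat.zero_le _)).1.trans (T.x_mem (Nat.zero_le _)).2
  exact (intervalIntegral.integral_add_adjacent_intervals
    (intervalIntegrable_sub hab hF (left_mem_Icc.2 hab) (T.x_mem hi.le))
    (intervalIntegrable_sub hab hF (T.x_mem hi.le) (T.elem_subset hi hy))).symm

theorem right_mem_elem {i : ℕ} (hi : i < T.N) : T.x (i + 1) ∈ T.elem i :=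
  right_mem_Icc.2 (T.lt_succ i hi).le

theorem integral_node_eq_zero {F : ℝ → ℝ} (hF : IntervalIntegrable F volume a b)
    (h : ∀ i < T.N, ∫ t in (T.x i)..(T.x (i + 1)), F t = 0) :
    ∀ i ≤ T.N, ∫ t in a..(T.x i), F t = 0 := by
  refine T.induction_nodes ?_ fun i hi ih => ?_
  · have := T.x_zero
    rw [this, intervalIntegral.integral_same]
  · rw [integral_split hF hi (right_mem_elem hi), ih, h i hi, zero_add]

/-- A function with given increments over the elements is a primitive. -/
theorem eq_integral_of_elem {v F : ℝ → ℝ} (hF : IntervalIntegrable F volume a b) (h0 : v a = 0)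
    (h : ∀ i < T.N, ∀ y ∈ T.elem i, v y = v (T.x i) + ∫ t in (T.x i)..y, F t) :
    ∀ y ∈ Icc a b, v y = ∫ t in a..y, F t := by
  have hn : ∀ i ≤ T.N, v (T.x i) = ∫ t in a..(T.x i), F t := by
    refine T.induction_nodes ?_ fun i hi ih => ?_
    · have := T.x_zero
      rw [this, intervalIntegral.integral_same, h0]
    · rw [integral_split hF hi (right_mem_elem hi), ← ih, h i hi _ (right_mem_elem hi)]
  intro y hy
  obtain ⟨i, hi, hyi⟩ := T.exists_mem_elem hy
  rw [h i hi y hyi, hn i hi.le, ← integral_split hF hi hyi]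

/-- Summation of local bounds, with an exceptional bound on the interface element. -/
theorem abs_integral_le_of_elem {F : ℝ → ℝ} (hF : IntervalIntegrable F volume a b) {B₁ B₂ : ℝ}
    (hB₁ : 0 ≤ B₁) (hB₂ : 0 ≤ B₂)
    (h₁ : ∀ i < T.N, i ≠ T.k → |∫ t in (T.x i)..(T.x (i + 1)), F t| ≤ B₁ * T.len i)
    (h₂ : ∀ i < T.N, ∀ y ∈ T.elem i, |∫ t in (T.x i)..y, F t| ≤ B₂) :
    ∀ y ∈ Icc a b, |∫ t in a..y, F t| ≤ B₁ * (b - a) + 2 * B₂ := by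
  -- The exceptional bound is counted once, after the interface element has been passed; the last,
  -- partial element accounts for the second one.
  have hn : ∀ i ≤ T.N, |∫ t in a..(T.x i), F t| ≤
      B₁ * (T.x i - a) + if T.k < i then B₂ else 0 := by
    refine T.induction_nodes ?_ fun i hi ih => ?_
    · have := T.x_zero
      rw [this, intervalIntegral.integral_same]
      simp
    · rw [integral_split hF hi (right_mem_elem hi)]
      refine (abs_add_le _ _).trans ?_
      by_cases hik : i = T.k
      · have := h₂ i hi _ (right_mem_elem hi)
        rw [if_neg (by omega)] at ih
        rw [if_pos (by omega)]
        have := mul_le_mul_of_nonneg_left (T.lt_succ i hi).le hB₁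
        linarith
      · have h3 := h₁ i hi hik
        have : (if T.k < i + 1 then B₂ else 0) = if T.k < i then B₂ else 0 := by
          congr 1; rw [eq_iff_iff]; omega
        rw [this]
        unfold len at h3
        linarith
  intro y hy
  obtain ⟨i, hi, hyi⟩ := T.exists_mem_elem hy
  rw [integral_split hF hi hyi]
  have h3 := h₂ i hi y hyi
  have h4 := hn i hi.le
  have h5 := mul_le_mul_of_nonneg_left (sub_le_sub_right (T.x_mem hi.le).2 a) hB₁
  have h6 : (if T.k < i then B₂ else 0) ≤ B₂ := by split_ifs <;> linarith
  refine (abs_add_le _ _).trans ?_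
  linarith

end Mesh

namespace Mesh

variable {a b α : ℝ} {T : Mesh a b α} {βm βp : ℝ}

/-- The discretization error `u - v` in terms of the projections `D` of the flux and the discrete
fluxes `P`: it is the sum of the projection error `η`, which vanishes at the nodes, and the
discrete error `θ`. -/
theorem MemTrialSpace.exists_error_split (hβm : 0 < βm) (hβp : 0 < βp) {n : ℕ} {M : ℝ}
    {u q q' v : ℝ → ℝ} (hu : RegularFlux a b α βm βp n M u q q') (hu0 : u a = 0) (hub : u b = 0)
    {p : ℕ} (hp : 2 ≤ p) (hv : T.MemTrialSpace βm βp p v) :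
    ∃ (D P : ℕ → ℝ[X]) (δ ρ : ℝ → ℝ),
      (∀ i < T.N, IsProj (fun x => (beta α βm βp x)⁻¹) (T.x i) (T.x (i + 1)) p q (D i) ∧
        (P i).degree < p ∧
        (∀ y ∈ T.elem i, v y = v (T.x i) + ∫ t in (T.x i)..y, (beta α βm βp t)⁻¹ * (P i).eval t) ∧
        (∀ y ∈ Ioo (T.x i) (T.x (i + 1)), δ y = (D i - P i).eval y) ∧
        (∀ y ∈ T.elem i, ∫ t in a..y, (beta α βm βp t)⁻¹ * ρ t =
          ∫ t in (T.x i)..y, (beta α βm βp t)⁻¹ * (q t - (D i).eval t)) ∧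
        (∀ y ∈ T.elem i, T.gaussLobattoProj βm βp p u i y - v y =
          ∫ t in a..y, (beta α βm βp t)⁻¹ * δ t)) ∧
      IntervalIntegrable (fun t => (beta α βm βp t)⁻¹ * δ t) volume a b ∧
      IntervalIntegrable (fun t => (beta α βm βp t)⁻¹ * ρ t) volume a b ∧
      (∀ i < T.N, ∀ y ∈ T.elem i,
        ∫ t in a..y, ∫ s in a..t, (beta α βm βp s)⁻¹ * ρ s =
          ∫ t in (T.x i)..y, ∫ s in a..t, (beta α βm βp s)⁻¹ * ρ s) ∧
      (∀ y ∈ Icc a b, u y - v y = (∫ t in a..y, (beta α βm βp t)⁻¹ * δ t) +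
        ∫ t in a..y, (beta α βm βp t)⁻¹ * ρ t) ∧
      (∫ t in a..b, (beta α βm βp t)⁻¹ * δ t) = 0 := by
  have hab : a ≤ b := (T.x_mem (Nat.zero_le _)).1.trans (T.x_mem (Nat.zero_le _)).2
  have hw := boundedWeight_beta hβm hβp α
  have hex : ∀ i, ∃ D P : ℝ[X], i < T.N →
      (IsProj (fun x => (beta α βm βp x)⁻¹) (T.x i) (T.x (i + 1)) p q D ∧
        ∀ y ∈ T.elem i, T.gaussLobattoProj βm βp p u i y =
          u (T.x i) + ∫ t in (T.x i)..y, (beta α βm βp t)⁻¹ * D.eval t) ∧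
      P.degree < p ∧
      ∀ y ∈ T.elem i, v y = v (T.x i) + ∫ t in (T.x i)..y, (beta α βm βp t)⁻¹ * P.eval t :=
    fun i => by
    by_cases hi : i < T.N
    · obtain ⟨D, hD⟩ := T.exists_isProj_gaussLobattoProj hβm hβp hu hp hi
      obtain ⟨P, hP⟩ := hv.exists_flux hβm hβp (by omega) hi
      exact ⟨D, P, fun _ => ⟨hD, hP⟩⟩
    · exact ⟨0, 0, fun h => absurd h hi⟩
  choose D P hDP using hex
  obtain ⟨δ, hδ⟩ := T.exists_glue fun i y => (D i - P i).eval y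
  obtain ⟨ρ, hρ⟩ := T.exists_glue fun i y => q y - (D i).eval y
  have hqc : ∀ i < T.N, ContinuousOn q (Icc (T.x i) (T.x (i + 1))) := fun i hi =>
    hu.cont.mono (T.elem_subset hi)
  have hρi : ∀ i < T.N, IntervalIntegrable
      (fun t => (beta α βm βp t)⁻¹ * (q t - (D i).eval t)) volume (T.x i) (T.x (i + 1)) :=
    fun i hi => (hDP i hi).1.1.intervalIntegrable hw (T.lt_succ i hi) (hqc i hi)
  have hδint : IntervalIntegrable (fun t => (beta α βm βp t)⁻¹ * δ t) volume a b :=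
    intervalIntegrable_of_elem (T := T) fun i hi =>
      intervalIntegrable_congr_off α (T.lt_succ i hi).le
        (fun x hx _ => by rw [hδ i hi x hx]) (hw.intervalIntegrable_eval (D i - P i) _ _)
  have hρint : IntervalIntegrable (fun t => (beta α βm βp t)⁻¹ * ρ t) volume a b :=
    intervalIntegrable_of_elem (T := T) fun i hi =>
      intervalIntegrable_congr_off α (T.lt_succ i hi).le
        (fun x hx _ => by rw [hρ i hi x hx]) (hρi i hi)
  have hδe : ∀ i < T.N, ∀ y ∈ T.elem i, ∫ t in (T.x i)..y, (beta α βm βp t)⁻¹ * δ t =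
      ∫ t in (T.x i)..y, (beta α βm βp t)⁻¹ * (D i - P i).eval t := fun i hi y hy =>
    integral_congr_off α hy.1 fun x hx _ => by rw [hδ i hi x ⟨hx.1, hx.2.trans_le hy.2⟩]
  have hρe : ∀ i < T.N, ∀ y ∈ T.elem i, ∫ t in (T.x i)..y, (beta α βm βp t)⁻¹ * ρ t =
      ∫ t in (T.x i)..y, (beta α βm βp t)⁻¹ * (q t - (D i).eval t) := fun i hi y hy =>
    integral_congr_off α hy.1 fun x hx _ => by rw [hρ i hi x ⟨hx.1, hx.2.trans_le hy.2⟩]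
  -- The flux error of the projection has zero weighted mean on each element, so η vanishes at the
  -- nodes.
  have hρ0 : ∀ i ≤ T.N, ∫ t in a..(T.x i), (beta α βm βp t)⁻¹ * ρ t = 0 :=
    integral_node_eq_zero hρint fun i hi => by
      rw [hρe i hi _ (right_mem_elem hi), (hDP i hi).1.1.integral_eq_zero (by omega)]
  have hρy : ∀ i < T.N, ∀ y ∈ T.elem i, ∫ t in a..y, (beta α βm βp t)⁻¹ * ρ t =
      ∫ t in (T.x i)..y, (beta α βm βp t)⁻¹ * (q t - (D i).eval t) := fun i hi y hy => by
    rw [integral_split hρint hi hy, hρ0 i hi.le, zero_add, hρe i hi y hy]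
  have hηc : ContinuousOn (fun y => ∫ t in a..y, (beta α βm βp t)⁻¹ * ρ t) (Icc a b) := by
    rw [← uIcc_of_le hab]
    exact intervalIntegral.continuousOn_primitive_interval' hρint left_mem_uIcc
  have hηint : IntervalIntegrable (fun y => ∫ t in a..y, (beta α βm βp t)⁻¹ * ρ t) volume a b := by
    rw [← uIcc_of_le hab] at hηc
    exact hηc.intervalIntegrable
  -- Also η itself has zero mean on each element, so its contribution to the term with c does not
  -- accumulate.
  have hN0 : ∀ i ≤ T.N, ∫ t in a..(T.x i), ∫ s in a..t, (beta α βm βp s)⁻¹ * ρ s = 0 :=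
    integral_node_eq_zero hηint fun i hi => by
      rw [integral_congr_off α (T.lt_succ i hi).le fun x hx _ =>
        hρy i hi x (Ioo_subset_Icc_self hx)]
      exact (hDP i hi).1.1.integral_primitive hw (T.lt_succ i hi) hp (hqc i hi)
  have hqi : IntervalIntegrable (fun t => (beta α βm βp t)⁻¹ * q t) volume a b := by
    have := hu.cont
    rw [← uIcc_of_le hab] at this
    exact hw.intervalIntegrable_mul this.intervalIntegrable
  have he : ∀ y ∈ Icc a b, u y - v y = (∫ t in a..y, (beta α βm βp t)⁻¹ * δ t) +
      ∫ t in a..y, (beta α βm βp t)⁻¹ * ρ t := fun y hy => by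
    rw [← intervalIntegral.integral_add
      (intervalIntegrable_sub hab hδint (left_mem_Icc.2 hab) hy)
      (intervalIntegrable_sub hab hρint (left_mem_Icc.2 hab) hy)]
    refine eq_integral_of_elem (T := T) (v := fun y => u y - v y) (hδint.add hρint)
      (by rw [hu0, hv.2.1, sub_zero]) (fun i hi y hy => ?_) y hy
    have hyI := T.elem_subset hi hy
    have h1 : u y = u (T.x i) + ∫ t in (T.x i)..y, (beta α βm βp t)⁻¹ * q t := by
      rw [hu.eq_integral y hyI, hu.eq_integral _ (T.x_mem hi.le), integral_split hqi hi hy]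
    have hi1 := intervalIntegrable_sub hab hδint (T.x_mem hi.le) hyI
    have hi2 := intervalIntegrable_sub hab hρint (T.x_mem hi.le) hyI
    have hi3 := intervalIntegrable_sub hab hqi (T.x_mem hi.le) hyI
    have hi4 := hw.intervalIntegrable_eval (P i) (T.x i) y
    have h2 : ∫ t in (T.x i)..y, ((beta α βm βp t)⁻¹ * δ t + (beta α βm βp t)⁻¹ * ρ t) =
        (∫ t in (T.x i)..y, (beta α βm βp t)⁻¹ * q t) -
          ∫ t in (T.x i)..y, (beta α βm βp t)⁻¹ * (P i).eval t := by
      rw [← intervalIntegral.integral_sub hi3 hi4]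
      refine integral_congr_off α hy.1 fun x hx _ => ?_
      rw [hδ i hi x ⟨hx.1, hx.2.trans_le hy.2⟩, hρ i hi x ⟨hx.1, hx.2.trans_le hy.2⟩, eval_sub]
      ring
    rw [h2, h1, (hDP i hi).2.2 y hy]
    ring
  refine ⟨D, P, δ, ρ, fun i hi => ⟨(hDP i hi).1.1, (hDP i hi).2.1, (hDP i hi).2.2, hδ i hi,
    hρy i hi, fun y hy => ?_⟩, hδint, hρint, fun i hi y hy => ?_, he, ?_⟩
  · have h1 := he _ (T.x_mem hi.le)
    rw [hρ0 i hi.le, add_zero] at h1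
    rw [integral_split hδint hi hy, ← h1, hδe i hi y hy, (hDP i hi).1.2 y hy,
      (hDP i hi).2.2 y hy]
    have h2 : ∫ t in (T.x i)..y, (beta α βm βp t)⁻¹ * (D i - P i).eval t =
        (∫ t in (T.x i)..y, (beta α βm βp t)⁻¹ * (D i).eval t) -
          ∫ t in (T.x i)..y, (beta α βm βp t)⁻¹ * (P i).eval t := by
      rw [← intervalIntegral.integral_sub (hw.intervalIntegrable_eval (D i) _ _)
        (hw.intervalIntegrable_eval (P i) _ _)]
      congr 1; ext t; rw [eval_sub]; ring
    rw [h2]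
    ring
  · rw [integral_split hηint hi hy, hN0 i hi.le, zero_add]
  · have h1 := he b (right_mem_Icc.2 hab)
    have h2 := hρ0 T.N le_rfl
    have h3 := T.x_last
    rw [h3] at h2
    rw [hub, hv.2.2.1, h2, sub_zero, add_zero] at h1
    exact h1.symm

end Mesh

/-! ### Global error estimates. -/

/-- Stability of the integrated interface problem with interface position `α`. -/
def IsStable (a b α βm βp γ c S : ℝ) : Prop :=
  ∀ (θ r : ℝ → ℝ) (κ R : ℝ), 0 ≤ R → ContinuousOn θ (Icc a b) → θ b = 0 →
    (∀ x ∈ Icc a b, θ x = (∫ t in a..x, (beta α βm βp t)⁻¹ *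
      (γ * θ t + c * (∫ y in a..t, θ y) + κ)) + r x) →
    (∀ x ∈ Icc a b, |r x| ≤ R) → |κ| ≤ S * R ∧ ∀ x ∈ Icc a b, |θ x| ≤ S * R

/-- Constant in the bound for the discrete error. -/
def discreteConst (a b m' K γ c S : ℝ) : ℝ :=
  4 * S * ((b - a + 2) * elemConst m' K γ c (|γ| + |c| * (b - a) + 1))

namespace Mesh

variable {a b α : ℝ} {T : Mesh a b α} {βm βp : ℝ}

/-- Stability is applied to the discrete error θ with the summed local consistency errors as
residual. That residual involves θ and κ again, but with a factor h that the smallness hypothesis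
absorbs. -/
theorem IsIFVSolution.error_le {γ c : ℝ} (hβm : 0 < βm) (hβp : 0 < βp) {M : ℝ} (hM : 0 ≤ M)
    {S K : ℝ} (hS : 0 < S) (hstab : IsStable a b α βm βp γ c S) {p : ℕ} (hp : 2 ≤ p)
    (hK : IsStabilityConst p (min βm⁻¹ βp⁻¹) (max βm⁻¹ βp⁻¹) K)
    {u q q' f v : ℝ → ℝ} (hu : RegularFlux a b α βm βp (2 * p) M u q q')
    (hu0 : u a = 0) (hub : u b = 0)
    (hf : SolvesEquation a b α βm βp γ c f u) (hv : T.IsIFVSolution βm βp γ c p f v)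
    (h1 : T.size ≤ 1)
    (hsmall : discreteConst a b (max βm⁻¹ βp⁻¹) K γ c S * T.size ≤ 1) :
    (∀ i < T.N, ∀ y ∈ T.elem i, |v y - T.gaussLobattoProj βm βp p u i y| ≤
      discreteConst a b (max βm⁻¹ βp⁻¹) K γ c S * (M * T.size ^ (p + 2))) ∧
    (∀ l, T.IsLobattoPoint βm βp p l → |u l - v l| ≤
      (discreteConst a b (max βm⁻¹ βp⁻¹) K γ c S + max βm⁻¹ βp⁻¹ * (1 + K)) *
        (M * T.size ^ (p + 2))) ∧
    (∀ g, T.IsGaussPoint βm βp p g → |flux α βm βp (fun y => u y - v y) g| ≤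
      (|γ| + |c| * (b - a) + 1) *
        (discreteConst a b (max βm⁻¹ βp⁻¹) K γ c S + max βm⁻¹ βp⁻¹ * (1 + K)) *
        (M * T.size ^ (p + 1))) := by
  have hab' : a < b := by
    have h1 := (T.x_mem T.k_lt.le).1
    have h2 := (T.x_mem (i := T.k + 1) T.k_lt).2
    linarith [T.lt_succ _ T.k_lt]
  have hab : a ≤ b := hab'.le
  have haI : a ∈ Icc a b := left_mem_Icc.2 hab
  have hp0 : 0 < p := by omega
  have hw := boundedWeight_beta hβm hβp α
  obtain ⟨D, P, δ, ρ, hDP, hδint, hρint, hN, he, hθb⟩ :=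
    hv.1.exists_error_split hβm hβp hu hu0 hub hp
  obtain ⟨κ, hκ⟩ := hv.exists_const hβm hβp hu hf hp0
  set m' := max βm⁻¹ βp⁻¹ with hm'def
  have hm' : 0 < m' := hw.upper_pos
  have hK0 := hK.1
  set h := T.size with hhdef
  have hh : 0 < h := (T.len_pos T.k_lt).trans_le (T.len_le_size T.k_lt)
  set G := |γ| + |c| * (b - a) + 1 with hGdef
  have hba : 0 < b - a := sub_pos.2 hab'
  have hG : 0 ≤ G := by positivity
  set C := discreteConst a b m' K γ c S with hCdef
  set E := elemConst m' K γ c G with hEdef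
  have hE : 0 ≤ E := by
    have h1 : 0 ≤ nodeConst m' K γ c := by unfold nodeConst; positivity
    have h2 : 0 ≤ lipConst m' K γ c G := by unfold lipConst; positivity
    rw [hEdef]; unfold elemConst; positivity
  have hCE : C = 4 * S * ((b - a + 2) * E) := rfl
  have hC : 0 ≤ C := by rw [hCE]; positivity
  set θ : ℝ → ℝ := fun y => ∫ t in a..y, (beta α βm βp t)⁻¹ * δ t with hθ
  set η : ℝ → ℝ := fun y => ∫ t in a..y, (beta α βm βp t)⁻¹ * ρ t with hη
  have hcont : ∀ {F : ℝ → ℝ}, IntervalIntegrable F volume a b →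
      ContinuousOn (fun y => ∫ t in a..y, F t) (Icc a b) := fun {F} hF => by
    rw [← uIcc_of_le hab]
    exact intervalIntegral.continuousOn_primitive_interval' hF left_mem_uIcc
  have hii : ∀ {F : ℝ → ℝ}, ContinuousOn F (Icc a b) → IntervalIntegrable F volume a b :=
    fun {F} hF => by
      rw [← uIcc_of_le hab] at hF
      exact hF.intervalIntegrable
  have hθc : ContinuousOn θ (Icc a b) := hcont hδint
  have hηc : ContinuousOn η (Icc a b) := hcont hρint
  have hqc : ∀ i < T.N, ContinuousOn q (Icc (T.x i) (T.x (i + 1))) := fun i hi =>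
    hu.cont.mono (T.elem_subset hi)
  have happ : ∀ i < T.N, ∀ k ≤ 2 * p, Approx k M q (T.x i) (T.x (i + 1)) := fun i hi k hk =>
    hu.approx k hk _ _ (T.x_mem hi.le).1 (T.lt_succ i hi).le (T.x_mem (i := i + 1) hi).2
  obtain ⟨xm, hxm, hmax⟩ := isCompact_Icc.exists_isMaxOn ⟨a, haI⟩ hθc.abs
  set X := |θ xm| + |κ| with hXdef
  have hX : 0 ≤ X := by positivity
  have hθX : ∀ x ∈ Icc a b, |θ x| ≤ |θ xm| := fun x hx => hmax hx
  set Φ : ℝ → ℝ := fun y => ∫ t in a..y, θ t with hΦ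
  set F : ℝ → ℝ := fun x => γ * θ x + c * Φ x + κ with hF
  have hΦc : ContinuousOn Φ (Icc a b) := hcont (hii hθc)
  have hFc : ContinuousOn F (Icc a b) :=
    ((continuousOn_const.mul hθc).add (continuousOn_const.mul hΦc)).add continuousOn_const
  have hΦle : ∀ x ∈ Icc a b, ∀ y ∈ Icc a b, |Φ x - Φ y| ≤ |θ xm| * |x - y| := by
    intro x hx y hy
    have : Φ x - Φ y = ∫ t in y..x, θ t := intervalIntegral.integral_interval_sub_left
      (intervalIntegrable_sub hab (hii hθc) haI hx) (intervalIntegrable_sub hab (hii hθc) haI hy)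
    rw [this, ← Real.norm_eq_abs]
    exact intervalIntegral.norm_integral_le_of_norm_le_const fun t ht =>
      hθX t (uIcc_subset_Icc hy hx (uIoc_subset_uIcc ht))
  have hFb : ∀ x ∈ Icc a b, |F x| ≤ G * X := fun x hx => by
    have e1 := hθX x hx
    have e2 := hΦle x hx a haI
    have e3 : Φ a = 0 := intervalIntegral.integral_same
    rw [e3, sub_zero, abs_of_nonneg (sub_nonneg.2 hx.1)] at e2
    have e4 : |Φ x| ≤ |θ xm| * (b - a) := e2.trans (by gcongr; exact hx.2)
    calc |F x| ≤ |γ| * |θ x| + |c| * |Φ x| + |κ| := by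
          refine (abs_add_le _ _).trans ?_
          gcongr
          refine (abs_add_le _ _).trans ?_
          rw [abs_mul, abs_mul]
      _ ≤ |γ| * |θ xm| + |c| * (|θ xm| * (b - a)) + |κ| := by gcongr
      _ ≤ G * X := by
          rw [hGdef, hXdef]
          have t1 : 0 ≤ (|γ| + |c| * (b - a)) * |κ| := by positivity
          have t2 := abs_nonneg (θ xm)
          linarith
  have hηle : ∀ i < T.N, ∀ y ∈ T.elem i, |η y| ≤ m' * (1 + K) * M * T.len i ^ (p + 1) :=
    fun i hi y hy => by
      rw [hη]; dsimp only
      rw [(hDP i hi).2.2.2.2.1 y hy]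
      exact (hDP i hi).1.primitive_le hw (T.lt_succ i hi) hK (hqc i hi) hM
        (happ i hi p (by omega)) y hy
  have hNle : ∀ i < T.N, ∀ y ∈ T.elem i,
      |∫ t in a..y, η t| ≤ m' * (1 + K) * M * T.len i ^ (p + 2) := fun i hi y hy => by
    rw [hN i hi y hy, ← Real.norm_eq_abs]
    have hl := T.len_pos hi
    refine (intervalIntegral.norm_integral_le_of_norm_le_const
      (C := m' * (1 + K) * M * T.len i ^ (p + 1)) fun t ht => ?_).trans ?_
    · rw [uIoc_of_le hy.1] at ht
      exact hηle i hi t ⟨ht.1.le, ht.2.trans hy.2⟩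
    · rw [abs_of_nonneg (sub_nonneg.2 hy.1), pow_succ _ (p + 1), ← mul_assoc]
      gcongr
      exact sub_le_sub_right hy.2 _
  have heI : ∀ x ∈ Icc a b, u x - v x = θ x + η x := he
  have hδe : ∀ i < T.N, ∀ y ∈ T.elem i, ∀ y' ∈ T.elem i, ∀ F : ℝ → ℝ,
      ∫ t in y..y', (beta α βm βp t)⁻¹ * (δ t - F t) =
      ∫ t in y..y', (beta α βm βp t)⁻¹ * ((D i - P i).eval t - F t) := fun i hi => by
    have : ∀ y ∈ T.elem i, ∀ y' ∈ T.elem i, y ≤ y' → ∀ F : ℝ → ℝ,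
      ∫ t in y..y', (beta α βm βp t)⁻¹ * (δ t - F t) =
      ∫ t in y..y', (beta α βm βp t)⁻¹ * ((D i - P i).eval t - F t) := fun y hy y' hy' hyy F =>
      integral_congr_off α hyy fun x hx _ => by
        rw [(hDP i hi).2.2.2.1 x ⟨hy.1.trans_lt hx.1, hx.2.trans_le hy'.2⟩]
    intro y hy y' hy' F
    rcases le_total y y' with hyy | hyy
    · exact this y hy y' hy' hyy F
    · rw [intervalIntegral.integral_symm, this y' hy' y hy hyy F,
        ← intervalIntegral.integral_symm]
  have hLip : ∀ i < T.N, ∀ B, (∀ x ∈ T.elem i, |(D i - P i).eval x| ≤ B) → ∀ x ∈ T.elem i,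
      ∀ y ∈ T.elem i, |F x - F y| ≤ (|γ| * m' * B + |c| * X) * |x - y| := by
    intro i hi B hB x hx y hy
    have hxI := T.elem_subset hi hx
    have hyI := T.elem_subset hi hy
    have e1 : θ x - θ y = ∫ t in y..x, (beta α βm βp t)⁻¹ * (D i - P i).eval t := by
      have e := hδe i hi y hy x hx fun _ => 0
      simp only [sub_zero] at e
      rw [← e]
      exact intervalIntegral.integral_interval_sub_left
        (intervalIntegrable_sub hab hδint haI hxI) (intervalIntegrable_sub hab hδint haI hyI)
    have e2 : |θ x - θ y| ≤ m' * B * |x - y| := by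
      rw [e1, ← Real.norm_eq_abs]
      refine intervalIntegral.norm_integral_le_of_norm_le_const fun t ht => ?_
      rw [norm_mul]
      exact mul_le_mul (hw.abs_le t) (hB t (uIcc_subset_Icc hy hx (uIoc_subset_uIcc ht)))
        (norm_nonneg _) hm'.le
    have e3 := hΦle x hxI y hyI
    have e4 : |θ xm| ≤ X := by rw [hXdef]; linarith [abs_nonneg κ]
    calc |F x - F y| = |γ * (θ x - θ y) + c * (Φ x - Φ y)| := by rw [hF]; congr 1; ring
      _ ≤ |γ| * |θ x - θ y| + |c| * |Φ x - Φ y| := by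
          refine (abs_add_le _ _).trans ?_
          rw [abs_mul, abs_mul]
      _ ≤ |γ| * (m' * B * |x - y|) + |c| * (X * |x - y|) := by
          gcongr
          exact e3.trans (by gcongr)
      _ = _ := by ring
  have hIe : ∀ y ∈ Icc a b, ∫ t in a..y, (u t - v t) = Φ y + ∫ t in a..y, η t := fun y hy => by
    rw [hΦ, ← intervalIntegral.integral_add (intervalIntegrable_sub hab (hii hθc) haI hy)
      (intervalIntegrable_sub hab (hii hηc) haI hy)]
    refine integral_congr_off α hy.1 fun x hx _ => heI x ⟨hx.1.le, hx.2.le.trans hy.2⟩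
  have hlocal : ∀ i < T.N, _ := fun i hi =>
    (T.gaussElement hβm hβp hi p).consistency_le hK hp (hDP i hi).1 (hqc i hi) hM
      (happ i hi p (by omega)) (happ i hi (p + 1) (by omega)) (happ i hi (2 * p) le_rfl)
      (T.len_le_size hi) h1 (d := D i - P i)
      ((degree_sub_le _ _).trans_lt (max_lt (hDP i hi).1.deg (hDP i hi).2.1))
      (γ := γ) (c := c) hG hX (N := fun y => ∫ t in a..y, η t)
      (hFc.mono (T.elem_subset hi)) (hNle i hi) (fun x hx => hFb x (T.elem_subset hi hx))
      (hLip i hi) fun g hg => by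
        have hgI := (T.gaussElement hβm hβp hi p).mem_Ioo hg
        have hgE : g ∈ T.elem i := Ioo_subset_Icc_self hgI
        have hgab := T.elem_subset hi hgE
        have e1 := hκ g ((isGaussPoint_iff hβm hβp).2 ⟨i, hi, hg⟩)
        rw [flux_error_eq hβm hβp hu hi (hDP i hi).2.2.1 hgI, heI g hgab, hIe g hgab] at e1
        have e2 : η g = _ := (hDP i hi).2.2.2.2.1 g hgE
        rw [← e2, eval_sub, hF]
        linarith
  -- Now θ is the primitive of wF plus the primitive of w(δ - F), and the latter is the residual to
  -- be summed over the elements.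
  have hFi := hw.intervalIntegrable_mul (hii hFc)
  have hsi : IntervalIntegrable (fun t => (beta α βm βp t)⁻¹ * (δ t - F t)) volume a b := by
    have : (fun t => (beta α βm βp t)⁻¹ * (δ t - F t)) = fun t =>
        (beta α βm βp t)⁻¹ * δ t - (beta α βm βp t)⁻¹ * F t := by ext t; ring
    rw [this]; exact hδint.sub hFi
  set Y := M * h ^ (p + 2) + h * X with hYdef
  have hY : 0 ≤ Y := by positivity
  have hr := abs_integral_le_of_elem hsi (B₁ := E * Y) (B₂ := E * Y) (by positivity)
    (by positivity) (fun i hi hik => by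
      rw [hδe i hi _ (left_mem_Icc.2 (T.lt_succ i hi).le) _ (right_mem_elem hi)]
      obtain ⟨β₀, -, hβ₀⟩ := T.beta_eq_of_ne βm βp hi hik
      exact (hlocal i hi).2 β₀⁻¹ fun x hx => by rw [hβ₀ x (Ioo_subset_Icc_self hx)])
    (fun i hi y hy => by
      rw [hδe i hi _ (left_mem_Icc.2 (T.lt_succ i hi).le) _ hy]
      exact (hlocal i hi).1 y hy)
  obtain ⟨s1, s2⟩ := hstab θ (fun y => ∫ t in a..y, (beta α βm βp t)⁻¹ * (δ t - F t)) κ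
    (E * Y * (b - a) + 2 * (E * Y)) (by positivity) hθc hθb (fun x hx => by
      rw [← intervalIntegral.integral_add (intervalIntegrable_sub hab hFi haI hx)
        (intervalIntegrable_sub hab hsi haI hx)]
      rw [hθ]
      dsimp only
      congr 1
      ext t
      rw [hF]
      ring) hr
  -- Stability gives X ≤ (C/2)(M h^(p+2) + hX), and Ch ≤ 1 lets half of X be moved to the left.
  have hXle : X ≤ C * (M * h ^ (p + 2)) := by
    have e1 : X ≤ C / 2 * Y := by
      have := s2 xm hxm
      rw [hXdef, hCE]
      linarith
    have e2 : C * h * X ≤ 1 * X := mul_le_mul_of_nonneg_right hsmall hX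
    rw [hYdef] at e1
    linarith
  have hθle : ∀ x ∈ Icc a b, |θ x| ≤ C * (M * h ^ (p + 2)) := fun x hx =>
    (hθX x hx).trans (le_trans (by rw [hXdef]; linarith [abs_nonneg κ]) hXle)
  have hκle : |κ| ≤ C * (M * h ^ (p + 2)) :=
    le_trans (by rw [hXdef]; linarith [abs_nonneg (θ xm)]) hXle
  have hmul : M * h ^ (p + 2) ≤ M * h ^ (p + 1) :=
    mul_le_mul_of_nonneg_left (pow_le_pow_of_le_one hh.le h1 (by omega)) hM
  refine ⟨fun i hi y hy => ?_, ?_, ?_⟩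
  · rw [abs_sub_comm, (hDP i hi).2.2.2.2.2 y hy]
    exact hθle y (T.elem_subset hi hy)
  · rintro l ⟨i, hi, hl, hl0⟩
    rw [heI l (T.elem_subset hi hl), add_mul]
    refine (abs_add_le _ _).trans (add_le_add (hθle l (T.elem_subset hi hl)) ?_)
    -- The basis function of index p + 1 is a nonzero multiple of the primitive of wQ, so the
    -- leading part of η vanishes at the Lobatto points.
    obtain ⟨z, hz0, hz⟩ := T.basis_eq_integral hβm hβp hi (p - 1)
    rw [show p - 1 + 2 = p + 1 by omega, show p - 1 + 1 = p by omega] at hz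
    have hint : ∫ t in (T.x i)..l, (beta α βm βp t)⁻¹ * (T.orthoOn βm βp i p).eval t = 0 := by
      have := hz l hl
      rw [hl0] at this
      exact (mul_eq_zero.1 this.symm).resolve_left hz0
    obtain ⟨k, hk⟩ := (T.gaussElement hβm hβp hi p).primitive_lobatto_le hK (hDP i hi).1
      (hqc i hi) hM (happ i hi (p + 1) (by omega))
    have e2 : η l = _ := (hDP i hi).2.2.2.2.1 l hl
    have := hk l hl
    rw [hint, mul_zero, sub_zero, ← e2] at this
    refine this.trans ?_
    rw [mul_assoc _ M]
    have hl := T.len_pos hi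
    unfold len at hl
    gcongr
    exact T.len_le_size hi
  · intro g hg
    -- The flux error is expressed through e, ∫e and κ; the maximum of e is only of order h^(p+1),
    -- which limits the rate here.
    rw [hκ g hg]
    have hele : ∀ x ∈ Icc a b, |u x - v x| ≤ (C + m' * (1 + K)) * (M * h ^ (p + 1)) :=
      fun x hx => by
      obtain ⟨i, hi, hxi⟩ := T.exists_mem_elem hx
      rw [heI x hx, add_mul]
      refine (abs_add_le _ _).trans (add_le_add ((hθle x hx).trans ?_)
        ((hηle i hi x hxi).trans ?_))
      · gcongr
      · rw [mul_assoc _ M]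
        have hl := T.len_pos hi
        gcongr
        exact T.len_le_size hi
    have hgI : g ∈ Icc a b := by
      obtain ⟨i, hi, hg, -⟩ := hg
      exact T.elem_subset hi hg
    have e1 : |∫ t in a..g, (u t - v t)| ≤
        (C + m' * (1 + K)) * (M * h ^ (p + 1)) * (b - a) := by
      rw [← Real.norm_eq_abs]
      refine (intervalIntegral.norm_integral_le_of_norm_le_const fun t ht =>
        hele t (uIcc_subset_Icc haI hgI (uIoc_subset_uIcc ht))).trans ?_
      rw [abs_of_nonneg (sub_nonneg.2 hgI.1)]
      gcongr
      exact hgI.2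
    have e2 : |κ| ≤ (C + m' * (1 + K)) * (M * h ^ (p + 1)) := by
      refine hκle.trans ?_
      gcongr
      linarith [(by positivity : 0 ≤ m' * (1 + K))]
    calc _ ≤ |γ| * |u g - v g| + |c| * |∫ t in a..g, (u t - v t)| + |κ| := by
          refine (abs_add_le _ _).trans ?_
          gcongr
          refine (abs_add_le _ _).trans ?_
          rw [abs_mul, abs_mul]
      _ ≤ |γ| * ((C + m' * (1 + K)) * (M * h ^ (p + 1))) +
          |c| * ((C + m' * (1 + K)) * (M * h ^ (p + 1)) * (b - a)) +
          (C + m' * (1 + K)) * (M * h ^ (p + 1)) := by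
          gcongr
          exact hele g hgI
      _ = _ := by rw [hGdef]; ring

/-- Without lower order terms the flux error is the same at all Gauss points, and everything is
governed by the Gauss quadrature error. -/
theorem IsIFVSolution.pure_diffusion_error_le (hβm : 0 < βm) (hβp : 0 < βp) {M : ℝ}
    (hM : 0 ≤ M) {K : ℝ} {p : ℕ} (hp : 0 < p)
    (hK : IsStabilityConst p (min βm⁻¹ βp⁻¹) (max βm⁻¹ βp⁻¹) K)
    {u q q' f v : ℝ → ℝ} (hu : RegularFlux a b α βm βp (2 * p) M u q q')
    (hu0 : u a = 0) (hub : u b = 0)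
    (hf : SolvesEquation a b α βm βp 0 0 f u) (hv : T.IsIFVSolution βm βp 0 0 p f v) :
    ∃ κ : ℝ, |κ| ≤ max βm⁻¹ βp⁻¹ * (1 + K) * M * T.size ^ (2 * p) / min βm⁻¹ βp⁻¹ ∧
      (∀ g, T.IsGaussPoint βm βp p g → flux α βm βp (fun y => u y - v y) g = κ) ∧
      (∀ i ≤ T.N, |(u (T.x i) - v (T.x i)) - κ * ∫ t in a..(T.x i), (beta α βm βp t)⁻¹| ≤
        max βm⁻¹ βp⁻¹ * (1 + K) * M * T.size ^ (2 * p) * (T.x i - a)) ∧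
      (∀ i < T.N, |(u (T.x (i + 1)) - v (T.x (i + 1))) - (u (T.x i) - v (T.x i)) -
          κ * ∫ t in (T.x i)..(T.x (i + 1)), (beta α βm βp t)⁻¹| ≤
        max βm⁻¹ βp⁻¹ * (1 + K) * M * T.size ^ (2 * p) * T.len i) := by
  have hw := boundedWeight_beta hβm hβp α
  have hm' := hw.upper_pos
  have hK0 := hK.1
  have hab' : a < b := by
    have h1 := (T.x_mem T.k_lt.le).1
    have h2 := (T.x_mem (i := T.k + 1) T.k_lt).2
    linarith [T.lt_succ _ T.k_lt]
  have hab : a ≤ b := hab'.le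
  obtain ⟨κ, hκ⟩ := hv.exists_const hβm hβp hu hf hp
  simp only [zero_mul, zero_add] at hκ
  set m' := max βm⁻¹ βp⁻¹ with hm'def
  set m := min βm⁻¹ βp⁻¹ with hmdef
  have hm : 0 < m := hw.pos
  have hqi : IntervalIntegrable (fun t => (beta α βm βp t)⁻¹ * q t) volume a b := by
    have := hu.cont
    rw [← uIcc_of_le hab] at this
    exact hw.intervalIntegrable_mul this.intervalIntegrable
  have hinc : ∀ i < T.N, |(u (T.x (i + 1)) - v (T.x (i + 1))) - (u (T.x i) - v (T.x i)) -
      κ * ∫ t in (T.x i)..(T.x (i + 1)), (beta α βm βp t)⁻¹| ≤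
      m' * (1 + K) * M * T.size ^ (2 * p) * T.len i := fun i hi => by
    have E := T.gaussElement hβm hβp hi p
    obtain ⟨P, hPd, hP⟩ := hv.1.exists_flux hβm hβp hp hi
    have hqc : ContinuousOn q (Icc (T.x i) (T.x (i + 1))) := hu.cont.mono (T.elem_subset hi)
    -- At the Gauss points q - P equals κ, and P has degree less than p.
    have hPe : P = interp (T.orthoOn βm βp i p) q - C κ := by
      have hc : interp (T.orthoOn βm βp i p) (fun _ => κ) = C κ :=
        (E.orth.eq_interp hw E.lt E.deg (degree_C_le.trans_lt (by exact_mod_cast hp))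
          fun g _ => by rw [eval_C]).symm
      rw [← hc, ← interp_sub]
      refine E.orth.eq_interp hw E.lt E.deg hPd fun g hg => ?_
      have e1 := hκ g ((isGaussPoint_iff hβm hβp).2 ⟨i, hi, hg⟩)
      rw [flux_error_eq hβm hβp hu hi hP (E.mem_Ioo hg)] at e1
      linarith
    have h1 : u (T.x (i + 1)) = u (T.x i) +
        ∫ t in (T.x i)..(T.x (i + 1)), (beta α βm βp t)⁻¹ * q t := by
      rw [hu.eq_integral _ (T.x_mem (i := i + 1) hi), hu.eq_integral _ (T.x_mem hi.le),
        integral_split hqi hi (right_mem_elem hi)]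
    have i1 := intervalIntegrable_sub hab hqi (T.x_mem hi.le) (T.x_mem (i := i + 1) hi)
    have i2 := hw.intervalIntegrable_eval P (T.x i) (T.x (i + 1))
    have i3 := (hw.intervalIntegrable (T.x i) (T.x (i + 1))).const_mul κ
    have h2 : (u (T.x (i + 1)) - v (T.x (i + 1))) - (u (T.x i) - v (T.x i)) -
        κ * ∫ t in (T.x i)..(T.x (i + 1)), (beta α βm βp t)⁻¹ =
        ∫ t in (T.x i)..(T.x (i + 1)), (beta α βm βp t)⁻¹ *
          (q t - (interp (T.orthoOn βm βp i p) q).eval t) := by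
      have : (fun t => (beta α βm βp t)⁻¹ * (q t - (interp (T.orthoOn βm βp i p) q).eval t)) =
          fun t => (beta α βm βp t)⁻¹ * q t - (beta α βm βp t)⁻¹ * P.eval t -
            κ * (beta α βm βp t)⁻¹ := by
        ext t; rw [hPe, eval_sub, eval_C]; ring
      rw [this, intervalIntegral.integral_sub (i1.sub i2) i3, intervalIntegral.integral_sub i1 i2,
        intervalIntegral.integral_const_mul, h1, hP _ (right_mem_elem hi)]
      ring
    rw [h2]
    refine (E.quadrature_error_le hK hp hqc hM (hu.approx _ le_rfl _ _ (T.x_mem hi.le).1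
      (T.lt_succ i hi).le (T.x_mem (i := i + 1) hi).2)).trans ?_
    have hl := T.len_pos hi
    have e : T.x (i + 1) - T.x i = T.len i := rfl
    rw [e, pow_succ, ← mul_assoc]
    gcongr
    exact T.len_le_size hi
  have hnode : ∀ i ≤ T.N, |(u (T.x i) - v (T.x i)) - κ * ∫ t in a..(T.x i), (beta α βm βp t)⁻¹| ≤
      m' * (1 + K) * M * T.size ^ (2 * p) * (T.x i - a) := by
    refine T.induction_nodes ?_ fun i hi ih => ?_
    · have := T.x_zero
      rw [this, hu0, hv.1.2.1, intervalIntegral.integral_same]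
      simp
    · rw [integral_split (hw.intervalIntegrable a b) hi (right_mem_elem hi)]
      have := hinc i hi
      unfold len at this
      rw [abs_le] at this ih ⊢
      constructor <;> linarith [this.1, this.2, ih.1, ih.2]
  refine ⟨κ, ?_, hκ, hnode, hinc⟩
  -- The error vanishes at b, so κ∫w over [a, b] is bounded by the accumulated quadrature errors.
  have h1 := hnode T.N le_rfl
  have h3 := T.x_last
  rw [h3, hub, hv.1.2.2.1, sub_zero, zero_sub, abs_neg, abs_mul] at h1
  have h2 := hw.le_integral hab
  have hba : 0 < b - a := sub_pos.2 hab'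
  have h4 : |κ| * (m * (b - a)) ≤ m' * (1 + K) * M * T.size ^ (2 * p) * (b - a) :=
    le_trans (mul_le_mul_of_nonneg_left (h2.trans (le_abs_self _)) (abs_nonneg _)) h1
  rw [le_div_iff₀ hm]
  refine le_of_mul_le_mul_right ?_ hba
  linarith

end Mesh

/-! ### Passage to the norm and choice of the constants. -/

theorem MemSobolevInfty.bounded_of_norm_lt {I : Set ℝ} {m : ℕ} {v : ℝ → ℝ} {M : ℝ}
    (hv : MemSobolevInfty I m v) (hM : sobolevInftyNorm I m v < M) :
    0 ≤ M ∧ WeakDerivsBoundedBy I m v M := by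
  have hmono : ∀ {M₁ M₂ : ℝ}, M₁ ≤ M₂ → WeakDerivsBoundedBy I m v M₁ →
      WeakDerivsBoundedBy I m v M₂ := fun h hb j hj => by
    obtain ⟨g, hg, hgb⟩ := hb j hj
    exact ⟨g, hg, hgb.mono fun x hx => hx.trans h⟩
  obtain ⟨M₀, hM₀⟩ := hv
  obtain ⟨M₁, ⟨h0, h1⟩, hlt⟩ := exists_lt_of_csInf_lt
    (⟨max 0 M₀, le_max_left _ _, hmono (le_max_right _ _) hM₀⟩ :
      {M : ℝ | 0 ≤ M ∧ WeakDerivsBoundedBy I m v M}.Nonempty) hM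
  exact ⟨h0.trans hlt.le, hmono hlt.le h1⟩

/-- The norm is an infimum. Estimates are proved for every larger M, which avoids showing that it is
attained. -/
theorem le_mul_of_forall_gt {A x N : ℝ} (hA : 0 ≤ A) (h : ∀ M > N, x ≤ A * M) : x ≤ A * N := by
  refine le_of_forall_pos_le_add fun ε hε => ?_
  have h1 := h (N + ε / (A + 1)) (lt_add_of_pos_right _ (by positivity))
  have h2 : A * (ε / (A + 1)) ≤ ε := by
    rw [← mul_div_assoc, div_le_iff₀ (by positivity)]
    linarith
  linarith

end IFVM
end

theorem theorem4p2
    (a b βm βp γ c : ℝ) (hab : a < b) (hβm : 0 < βm) (hβp : 0 < βp) (p : ℕ) (hp : 2 ≤ p)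
    (A : Set ℝ) (hAclosed : IsClosed A) (hAsub : A ⊆ Set.Icc a b)
    -- unique solvability for all interface positions in `A` (automatic, with `A = [a, b]`, if `0 ≤ c`)
    (hA : ∀ α ∈ A, IFVM.HasUniqueSolutions a b α βm βp γ c) :
    ∃ h₀ C : ℝ, 0 < h₀ ∧ 0 < C ∧
      ∀ α ∈ A, α ∈ Set.Ioo a b → ∀ T : IFVM.Mesh a b α, T.size ≤ h₀ →
      ∀ f u uT : ℝ → ℝ,
        IFVM.MemInterfaceSobolev a b α βm βp (2 * p + 1) u →
        IFVM.SolvesEquation a b α βm βp γ c f u →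
        T.IsIFVSolution βm βp γ c p f uT →
        -- supercloseness to the Gauss-Lobatto projection
        (∀ i < T.N, ∀ y ∈ T.elem i,
          |uT y - T.gaussLobattoProj βm βp p u i y| ≤
            C * T.size ^ (p + 2) * IFVM.interfaceNorm a b α (2 * p + 1) u) ∧
        -- solution error at the generalized Lobatto points
        (∀ l, T.IsLobattoPoint βm βp p l →
          |u l - uT l| ≤ C * T.size ^ (p + 2) * IFVM.interfaceNorm a b α (2 * p + 1) u) ∧
        -- flux error at the generalized Gauss points
        (∀ g, T.IsGaussPoint βm βp p g →
          |IFVM.flux α βm βp (fun y => u y - uT y) g| ≤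
            C * T.size ^ (p + 1) * IFVM.interfaceNorm a b α (2 * p + 1) u) ∧
        -- pure diffusion
        (γ = 0 → c = 0 →
          (∀ g, T.IsGaussPoint βm βp p g →
            |IFVM.flux α βm βp (fun y => u y - uT y) g| ≤
              C * T.size ^ (2 * p) * IFVM.interfaceNorm a b α (2 * p + 1) u) ∧
          (∀ i ≤ T.N,
            |u (T.x i) - uT (T.x i)| ≤
              C * T.size ^ (2 * p) * IFVM.interfaceNorm a b α (2 * p + 1) u) ∧
          (∀ i < T.N,
            |(u (T.x (i + 1)) - uT (T.x (i + 1))) - (u (T.x i) - uT (T.x i))| ≤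
              C * T.size ^ (2 * p + 1) * IFVM.interfaceNorm a b α (2 * p + 1) u)) := by
  open IFVM in
  obtain ⟨S, hS, hstab⟩ := exists_stability hab hβm hβp hAclosed hAsub hA
  obtain ⟨K, hK⟩ : ∃ K, IsStabilityConst p (min βm⁻¹ βp⁻¹) (max βm⁻¹ βp⁻¹) K :=
    exists_abs_eval_le p _ _
  have hK0 := hK.1
  have hm : 0 < min βm⁻¹ βp⁻¹ := (boundedWeight_beta hβm hβp a).pos
  have hm' : 0 < max βm⁻¹ βp⁻¹ := (boundedWeight_beta hβm hβp a).upper_pos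
  have hB : 0 < max βm βp := lt_max_of_lt_left hβm
  have hba : 0 < b - a := sub_pos.2 hab
  set C₁ := discreteConst a b (max βm⁻¹ βp⁻¹) K γ c S with hC₁def
  have hC₁ : 0 ≤ C₁ := by
    have h1 : 0 ≤ nodeConst (max βm⁻¹ βp⁻¹) K γ c := by unfold nodeConst; positivity
    have h2 : 0 ≤ lipConst (max βm⁻¹ βp⁻¹) K γ c (|γ| + |c| * (b - a) + 1) := by
      unfold lipConst; positivity
    rw [hC₁def]; unfold discreteConst elemConst; positivity
  set m' := max βm⁻¹ βp⁻¹ with hm'def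
  set m := min βm⁻¹ βp⁻¹ with hmdef
  set B := max βm βp with hBdef
  set Q := m' * (1 + K) with hQdef
  have hQ : 0 < Q := by positivity
  set C₃ := (|γ| + |c| * (b - a) + 1) * (C₁ + Q) with hC₃def
  -- The first summand bounds κ. In the last factor, b - a serves the nodal errors and 1 serves the
  -- increments.
  set C₄ := Q / m + (Q + Q / m * m') * (1 + (b - a)) with hC₄def
  have hC₃ : 0 ≤ C₃ := by positivity
  have hC₄ : 0 < C₄ := by positivity
  -- The factor B converts a bound for the derivatives of u into one for those of the flux.
  set C := B * (C₁ + Q + C₃ + C₄) with hCdef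
  have hC : 0 < C := by positivity
  -- This choice ensures h ≤ 1 and C₁h ≤ 1; adding 1 covers a vanishing C₁.
  refine ⟨min 1 (1 / (C₁ + 1)), C, by positivity, hC, ?_⟩
  intro α hαA hα T hT f u uT hu hf huT
  set h := T.size with hhdef
  have hh : 0 < h := (T.len_pos T.k_lt).trans_le (T.len_le_size T.k_lt)
  have h1 : h ≤ 1 := hT.trans (min_le_left _ _)
  have hsmall : C₁ * h ≤ 1 := by
    have := hT.trans (min_le_right _ _)
    rw [le_div_iff₀ (by positivity)] at this
    linarith
  have hflux : ∀ M > interfaceNorm a b α (2 * p + 1) u, 0 ≤ M ∧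
      ∃ q q', RegularFlux a b α βm βp (2 * p) (B * M) u q q' := fun M hM => by
    obtain ⟨h0, hl⟩ := hu.2.2.2.1.bounded_of_norm_lt ((le_max_left _ _).trans_lt hM)
    obtain ⟨-, hr⟩ := hu.2.2.2.2.1.bounded_of_norm_lt ((le_max_right _ _).trans_lt hM)
    exact ⟨h0, exists_regularFlux hα hβm hβp (by omega) hu h0 hl hr⟩
  have hmono : ∀ {D : ℝ}, D ≤ C₁ + Q + C₃ + C₄ → ∀ {M : ℝ}, 0 ≤ M → ∀ k : ℕ,
      D * (B * M * h ^ k) ≤ C * h ^ k * M := fun {D} hD {M} hM k => by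
    calc D * (B * M * h ^ k) ≤ (C₁ + Q + C₃ + C₄) * (B * M * h ^ k) := by gcongr
      _ = _ := by rw [hCdef]; ring
  have hCk : ∀ k, 0 ≤ C * h ^ k := fun k => by positivity
  have main := fun (M : ℝ) (hM : M > interfaceNorm a b α (2 * p + 1) u) =>
    huT.error_le hβm hβp (mul_nonneg hB.le (hflux M hM).1) hS (hstab α hαA) hp hK
      (hflux M hM).2.choose_spec.choose_spec hu.2.1 hu.2.2.1 hf h1 hsmall
  refine ⟨fun i hi y hy => le_mul_of_forall_gt (hCk _) fun M hM => ?_,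
    fun l hl => le_mul_of_forall_gt (hCk _) fun M hM => ?_,
    fun g hg => le_mul_of_forall_gt (hCk _) fun M hM => ?_, ?_⟩
  · exact ((main M hM).1 i hi y hy).trans (hmono (by linarith) (hflux M hM).1 _)
  · exact ((main M hM).2.1 l hl).trans (hmono (by linarith) (hflux M hM).1 _)
  · exact ((main M hM).2.2 g hg).trans (hmono (by linarith) (hflux M hM).1 _)
  rintro rfl rfl
  have pure := fun (M : ℝ) (hM : M > interfaceNorm a b α (2 * p + 1) u) =>
    huT.pure_diffusion_error_le hβm hβp (mul_nonneg hB.le (hflux M hM).1) (by omega) hK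
      (hflux M hM).2.choose_spec.choose_spec hu.2.1 hu.2.2.1 hf
  have hw := boundedWeight_beta hβm hβp α
  have hQm : Q / m ≤ C₁ + Q + C₃ + C₄ := by
    have : 0 ≤ (Q + Q / m * m') * (1 + (b - a)) := by positivity
    linarith
  -- Here J is the integral of w over a stretch of length L. Nodal values use H = b - a, and
  -- increments use H = h, which yields the additional power of h.
  have hsum : ∀ {e κ J H L M : ℝ}, |κ| ≤ Q * (B * M) * h ^ (2 * p) / m →
      |e - κ * J| ≤ Q * (B * M) * h ^ (2 * p) * L → 0 ≤ J → J ≤ m' * L → 0 ≤ M → L ≤ H →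
      |e| ≤ (Q + Q / m * m') * H * (B * M * h ^ (2 * p)) := by
    intro e κ J H L M hκ he hJ0 hJ hM hLH
    have e1 : |κ * J| ≤ Q * (B * M) * h ^ (2 * p) / m * (m' * L) := by
      rw [abs_mul, abs_of_nonneg hJ0]
      gcongr
    have e2 : |e| ≤ |e - κ * J| + |κ * J| := by
      simpa using abs_add_le (e - κ * J) (κ * J)
    calc |e| ≤ Q * (B * M) * h ^ (2 * p) * L + Q * (B * M) * h ^ (2 * p) / m * (m' * L) := by
          linarith
      _ = (Q + Q / m * m') * L * (B * M * h ^ (2 * p)) := by ring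
      _ ≤ _ := by gcongr
  refine ⟨fun g hg => le_mul_of_forall_gt (hCk _) fun M hM => ?_,
    fun i hi => le_mul_of_forall_gt (hCk _) fun M hM => ?_,
    fun i hi => le_mul_of_forall_gt (hCk _) fun M hM => ?_⟩
  · obtain ⟨κ, hκ, h2, -⟩ := pure M hM
    rw [h2 g hg]
    refine hκ.trans (le_of_eq_of_le ?_ (hmono hQm (hflux M hM).1 _))
    ring
  · obtain ⟨κ, hκ, -, h2, -⟩ := pure M hM
    have hxi := T.x_mem hi
    have hJ := hw.le_integral hxi.1
    have hx0 : 0 ≤ T.x i - a := sub_nonneg.2 hxi.1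
    refine (hsum hκ (h2 i hi) ((by positivity : 0 ≤ m * (T.x i - a)).trans hJ)
      (hw.integral_le hxi.1) (hflux M hM).1 (sub_le_sub_right hxi.2 a)).trans
      (hmono ?_ (hflux M hM).1 _)
    have : 0 ≤ Q + Q / m * m' := by positivity
    have : 0 ≤ Q / m := by positivity
    linarith
  · obtain ⟨κ, hκ, -, -, h2⟩ := pure M hM
    have hx0 : 0 ≤ T.x (i + 1) - T.x i := (T.len_pos hi).le
    have hJ := hw.le_integral (T.lt_succ i hi).le
    refine (hsum hκ (h2 i hi) ((by positivity : 0 ≤ m * (T.x (i + 1) - T.x i)).trans hJ)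
      (hw.integral_le (T.lt_succ i hi).le) (hflux M hM).1 (T.len_le_size hi)).trans ?_
    have e1 : (Q + Q / m * m') ≤ C₁ + Q + C₃ + C₄ := by
      have : 0 ≤ (Q + Q / m * m') * (b - a) := by positivity
      have : 0 ≤ Q / m := by positivity
      linarith
    refine le_of_eq_of_le ?_ (hmono e1 (hflux M hM).1 _)
    ring
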